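/- **Theorem (formal matrix integrals satisfy the same loop equations as convergent matrix integrals).** Let $V\in\mathbb{C}[x]$ be a polynomial of degree $d+1$ and let $N\in\mathbb{N}$. *Loop equations.* Let $S\subseteq\mathbb{C}$. A word is a finite product of letters, each letter being $M$ or a resolvent $(x-M)^{-1}$ with $x\in S$. Scalar observables are complex polynomials in the traces $\mathrm{Tr}\,w$ of words $w$; a change of variables $M\to M+\epsilon\,\delta(M)$ is given by a finite sum $\delta=\sum_w f_w(M)\,w(M)$ of words with scalar observables as coefficients. Its first-order Jacobian $J[\delta]$ is the scalar observable determined by linearity, the Leibniz rule, and (frozen factors being written with $m$, and $m\to M$ at the end) the split rules $$J[A(m)\,M\,B(m)]=\mathrm{Tr}A\;\mathrm{Tr}B,\qquad J\big[A(m)\tfrac1{x-M}B(m)\big]=\mathrm{Tr}\big(A\tfrac1{x-M}\big)\,\mathrm{Tr}\big(\tfrac1{x-M}B\big),$$ the merge rules $$J[A(m)\,\mathrm{Tr}(M\,B(m))]=\mathrm{Tr}(AB),\qquad J\big[A(m)\,\mathrm{Tr}(\tfrac1{x-M}B(m))\big]=\mathrm{Tr}\big(A\tfrac1{x-M}B\tfrac1{x-M}\big),$$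 and $J[A(m)]=0$. An expectation value $\langle\cdot\rangle$ satisfies the loop equations (with parameter $t$) if $N\,\langle \mathrm{Tr}\,V'(M)\,\delta(M)\rangle=t\,\langle J[\delta]\rangle$ for all such $\delta$. *(1) Convergent integrals.* Let $t\neq0$. Let $\gamma_1,\dots,\gamma_d$ be $C^1$ paths $\mathbb{R}\to\mathbb{C}$ going to infinity at both ends on which all integrals $\int_{\gamma_i}x^k e^{-\frac Nt V(x)}dx$, $k\ge0$, converge absolutely. For $S=\mathbb{C}\setminus\bigcup_i\gamma_i$ and every scalar observable $f$, the integrals $$\int_{\gamma_{c(1)}\times\dots\times\gamma_{c(N)}}\prod_a dx_a\prod_{a<b}(x_a-x_b)^2\,e^{-\frac Nt\sum_a V(x_a)}f(\mathrm{diag}(x_1,\dots,x_N)),\qquad c:\{1,\dots,N\}\to\{1,\dots,d\},$$ (normal-matrix integrals, reduced to eigenvalues, with fixed filling fractions $n_i=\#c^{-1}(i)$) converge absolutely. The corresponding expectation values, as well as those of the integral over normal matrices with eigenvalues on $\gamma=\sum_i\kappa_i\gamma_i$ (the sum over $c$ of the integrals above with weights $\prod_a\kappa_{c(a)}$, for arbitrary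 $\kappa_i\in\mathbb{C}$), satisfy the loop equations whenever the partition function (the integral of $f=1$) is nonzero. The same holds for the integral $\int_{\mathcal{H}_N}dM\,e^{-\frac Nt\mathrm{Tr}V(M)}f(M)$ over Hermitian matrices with Lebesgue measure, with $S=\mathbb{C}\setminus\mathbb{R}$, provided that $\int_{\mathbb R}x^ke^{-\frac NtV(x)}dx$ converges absolutely for all $k\ge0$. *(2) Formal integrals.* Let $\xi_1,\dots,\xi_d$ be $d$ distinct zeros of $V'$, let $\omega_i\in\mathbb{C}$ be directions with $\mathrm{Re}\big(V''(\xi_i)\,\omega_i^2\big)>0$, and let $n_1+\dots+n_d=N$, $n_i\ge 0$. Put $\delta V_i(x)=V(x)-V(\xi_i)-\tfrac12V''(\xi_i)(x-\xi_i)^2$. For $S=\mathbb{C}\setminus\{\xi_1,\dots,\xi_d\}$ and a scalar observable $f$, the formal matrix integral of $f$ is $$\sum_{k\ge0}\frac{(-N)^k}{t^k\,k!}\prod_{i}\Big(\int dM_i\Big)\Big(\sum_i\mathrm{Tr}\,\delta V_i(M_i)\Big)^k e^{-\frac{N}{2t}\sum_iV''(\xi_i)\mathrm{Tr}(M_i-\xi_i)^2}\prod_{j<i}\det(M_i\otimes1-1\otimes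 M_j)^2\,f(M_1\oplus\dots\oplus M_d),$$ where $M_i=\xi_i+\sqrt t\,\omega_iA_i$ with $A_i$ Hermitian of size $n_i$, and, the $A_i$ being kept fixed, the integrand (apart from the Gaussian factor, which no longer contains $t$) is expanded in powers of $\sqrt t$ and integrated term by term over the $A_i$; in particular $\frac1{x-M_i}=\sum_k\frac{(M_i-\xi_i)^k}{(x-\xi_i)^{k+1}}$. Overall constants, the power of $t$ coming from $dM_i$, and the factor $e^{-\frac Nt\sum_in_iV(\xi_i)}$ are dropped. Then all the Gaussian integrals occurring converge absolutely; the coefficients of odd powers of $\sqrt t$ vanish, so that the formal integral is a formal power series in $t$; the partition function (the case $f=1$) is invertible in $\mathbb{C}[[t]]$; and the formal expectation value (the quotient of the formal integral of $f$ by that of $1$) satisfies, as an identity in $\mathbb{C}[[t]]$, the same loop equations as in (1), that is $N\langle\mathrm{Tr}\,V'(M)\delta(M)\rangle=t\,\langle J[\delta]\rangle$ for all $\delta$. -/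

import Mathlib

noncomputable section

namespace MatrixModel

open MeasureTheory
open scoped Kronecker

/-! ### Observables, changes of variables and their Jacobians -/

/-- The letters from which functions of the random matrix `M` are written: `mat` stands for `M`,
and `res x` for the resolvent `1 / (x - M)` at a point `x ∈ S`. -/
inductive Letter (S : Set ℂ) where
  | mat : Letter S
  | res (x : S) : Letter S

/-- A word is an ordered product of letters; the empty word is the identity matrix. -/
abbrev Word (S : Set ℂ) := List (Letter S)

/-- Scalar observables: complex polynomials in the traces `Tr w` of words `w`. -/
abbrev Observable (S : Set ℂ) := MvPolynomial (Word S) ℂ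

/-- Matrix valued observables `δ(M) = ∑ f_w(M) w(M)`: finite sums of words whose coefficients are
scalar observables. These are the changes of variables `M ↦ M + ε δ(M)`. -/
abbrev Variation (S : Set ℂ) := Word S →₀ Observable S

variable {S : Set ℂ}

/-- The observable `Tr w`. -/
def tr (w : Word S) : Observable S := MvPolynomial.X w

/-- `splitAt p w = J[p(m) w(M)]`, where the word `p` is frozen: by the Leibniz rule, the sum over
the letters of `w` of the split of that letter, all the others being frozen:
`J[A(m) M B(m)] = Tr A Tr B` and
`J[A(m) (x - M)⁻¹ B(m)] = Tr (A (x - M)⁻¹) Tr ((x - M)⁻¹ B)`. -/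
def splitAt : Word S → Word S → Observable S
  | _, [] => 0
  | p, .mat :: q => tr p * tr q + splitAt (p ++ [.mat]) q
  | p, .res x :: q => tr (p ++ [.res x]) * tr (.res x :: q) + splitAt (p ++ [.res x]) q

/-- `mergeAt a p w = J[a(m) Tr (p(m) w(M))]`, where the words `a` and `p` are frozen: by the Leibniz
rule, the sum over the letters of `w` of the merge of that letter, all the others being frozen:
`J[A(m) Tr (P(m) M Q(m))] = Tr (A Q P)` and
`J[A(m) Tr (P(m) (x - M)⁻¹ Q(m))] = Tr (A (x - M)⁻¹ Q P (x - M)⁻¹)`. -/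
def mergeAt (a : Word S) : Word S → Word S → Observable S
  | _, [] => 0
  | p, .mat :: q => tr (a ++ q ++ p) + mergeAt a (p ++ [.mat]) q
  | p, .res x :: q => tr (a ++ .res x :: q ++ p ++ [.res x]) + mergeAt a (p ++ [.res x]) q

/-- The first order Jacobian `J` of the change of variable `M ↦ M + ε δ(M)`. On `δ = f(M) w(M)`
the Leibniz rule gives `f J[w] + J[f(M) w(m)]`, and the second term is a derivation in `f` whose
value on `f = Tr v` is the merge of `w` with `v`. -/
def jacobian (δ : Variation S) : Observable S :=
  δ.sum fun w f => f * splitAt [] w + MvPolynomial.mkDerivation ℂ (fun v => mergeAt w [] v) f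

/-- The observable `Tr (Q(M) δ(M))` for a polynomial `Q`. -/
def trPolyMul (Q : Polynomial ℂ) (δ : Variation S) : Observable S :=
  δ.sum fun w f =>
    Q.sum fun k a => MvPolynomial.C a * f * tr (List.replicate k Letter.mat ++ w)

/-- The loop equations of the one matrix model of size `N` with potential `V` and coupling `t`,
for an expectation value `⟨·⟩ = E` with values in `R`:
`(N / t) ⟨Tr V'(M) δ(M)⟩ = ⟨J[δ]⟩` for all `δ`. -/
def LoopEquations {R : Type*} [CommRing R] (V : Polynomial ℂ) (N : ℕ) (t : R)
    (E : Observable S → R) : Prop :=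
  ∀ δ : Variation S, (N : R) * E (trPolyMul V.derivative δ) = t * E (jacobian δ)

/-- The expectation value `⟨f⟩ = I f / I 1`, for an integral `I` with partition function `I 1`. -/
def mean {R : Type*} [CommRing R] (I : Observable S → R) (f : Observable S) : R :=
  I f * Ring.inverse (I 1)

section Evaluation

variable {ι : Type*} [Fintype ι] [DecidableEq ι] {R : Type*} [CommRing R] [Algebra ℂ R]

/-- The value of a letter at a matrix `M`, with entries in any commutative `ℂ`-algebra. -/
def Letter.eval (M : Matrix ι ι R) : Letter S → Matrix ι ι R
  | .mat => M
  | .res x => (algebraMap ℂ (Matrix ι ι R) x - M)⁻¹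

/-- The value of an observable at a matrix `M`. -/
def evalAt (M : Matrix ι ι R) (f : Observable S) : R :=
  MvPolynomial.aeval (fun w : Word S => Matrix.trace ((w.map (Letter.eval M)).prod)) f

end Evaluation

/-! ### Convergent matrix integrals -/

/-- A path from infinity to infinity on which all the integrals `∫ x ^ k e^{- c V(x)} dx` converge
absolutely. -/
structure AdmissiblePath (V : Polynomial ℂ) (c : ℂ) (γ : ℝ → ℂ) : Prop where
  contDiff : ContDiff ℝ 1 γ
  tendsto : Filter.Tendsto (fun u => ‖γ u‖) (Filter.cocompact ℝ) Filter.atTop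
  integrable : ∀ k : ℕ,
    Integrable fun u : ℝ => γ u ^ k * Complex.exp (-c * V.eval (γ u)) * deriv γ u

section Contour

variable {d N : ℕ} (V : Polynomial ℂ) (t : ℂ) (γ : Fin d → ℝ → ℂ)

/-- The integrand, in the parameters `u_a` of the eigenvalues `x_a ∈ γ_{c(a)}`, of the integral over
normal matrices of an observable `f`, once the unitary group is integrated out:
`∏ dx_a ∏_{a<b} (x_a - x_b)² e^{-(N/t) ∑ V(x_a)} f(diag x)`. -/
def contourIntegrand (c : Fin N → Fin d) (f : Observable S) (u : Fin N → ℝ) : ℂ :=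
  (∏ a, deriv (γ (c a)) (u a)) *
    (∏ a, ∏ b ∈ Finset.Ioi a, (γ (c a) (u a) - γ (c b) (u b)) ^ 2) *
    Complex.exp (-((N : ℂ) / t) * ∑ a, V.eval (γ (c a) (u a))) *
    evalAt (Matrix.diagonal fun a => γ (c a) (u a)) f

/-- The convergent integral with fixed filling fractions: the `a`-th eigenvalue runs over the
path `γ_{c(a)}`, so that `n_i = #{a | c(a) = i}` eigenvalues lie on `γ_i`. -/
def fillingIntegral (c : Fin N → Fin d) (f : Observable S) : ℂ :=
  ∫ u : Fin N → ℝ, contourIntegrand V t γ c f u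

/-- The convergent integral over normal matrices with eigenvalues on `γ = ∑ κ_i γ_i`. Grouping the
maps `c` by filling numbers gives `N! ∑_n ∏_i κ_i ^ n_i / n_i!` times the integral over
`γ_1 ^ n_1 × ⋯ × γ_d ^ n_d`. -/
def contourIntegral (κ : Fin d → ℂ) (f : Observable S) : ℂ :=
  ∑ c : Fin N → Fin d, (∏ a, κ (c a)) * fillingIntegral V t γ c f

end Contour

/-- The Hermitian matrix with real coordinates `B`: the diagonal is `B a a`, and for `a < b` the
`(a, b)` entry has real part `B a b` and imaginary part `B b a`. Lebesgue measure in `B` is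
`∏ dM_aa ∏_{a<b} d(Re M_ab) d(Im M_ab)`. -/
def hermitian {n : ℕ} (B : Fin n → Fin n → ℝ) : Matrix (Fin n) (Fin n) ℂ :=
  Matrix.of fun a b =>
    if a = b then (B a a : ℂ)
    else if a < b then (B a b : ℂ) + Complex.I * (B b a : ℂ)
    else (B b a : ℂ) - Complex.I * (B a b : ℂ)

/-- The integrand `e^{-(N/t) Tr V(M)} f(M)` at a Hermitian matrix `M`. -/
def hermitianIntegrand {N : ℕ} (V : Polynomial ℂ) (t : ℂ) (f : Observable S)
    (B : Fin N → Fin N → ℝ) : ℂ :=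
  Complex.exp (-((N : ℂ) / t) * Matrix.trace (Polynomial.aeval (hermitian B) V)) *
    evalAt (hermitian B) f

/-- The convergent integral over Hermitian matrices of size `N`. -/
def hermitianIntegral (N : ℕ) (V : Polynomial ℂ) (t : ℂ) (f : Observable S) : ℂ :=
  ∫ B : Fin N → Fin N → ℝ, hermitianIntegrand V t f B

/-! ### Formal matrix integrals

The blocks `M_i` run over `ξ_i + ω_i H`, `H` Hermitian of size `n_i`, i.e. over the normal matrices
with eigenvalues on the line through the saddle `ξ_i` of direction `ω_i`. The substitution
`M_i = ξ_i + s ω_i A_i` with `s² = t` turns the Gaussian weight into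
`e^{-(N/2) ∑_i V''(ξ_i) Tr (ω_i A_i)²}`, which does not contain `t`, and all the other factors
into power series in `s`. The Jacobian of the substitution and `e^{-(N/t) ∑_i n_i V(ξ_i)}` are
overall factors, which drop out of expectation values. -/

section Formal

variable {d : ℕ} (V : Polynomial ℂ) (ξ ω : Fin d → ℂ) (n : Fin d → ℕ)

/-- The real coordinates of the Hermitian matrices `A_1, …, A_d`. -/
abbrev Coords {d : ℕ} (n : Fin d → ℕ) := (i : Fin d) → Fin (n i) → Fin (n i) → ℝ

/-- The non-Gaussian part `δV_i(x) = V(x) - V(ξ_i) - (V''(ξ_i) / 2) (x - ξ_i)²`. -/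
def nonGaussian (i : Fin d) : Polynomial ℂ :=
  V - Polynomial.C (V.eval (ξ i)) -
    Polynomial.C (V.derivative.derivative.eval (ξ i) / 2) *
      (Polynomial.X - Polynomial.C (ξ i)) ^ 2

variable {n}

/-- The block `M_i = ξ_i + s ω_i A_i`, with power series in `s` as entries. -/
def block (B : Coords n) (i : Fin d) : Matrix (Fin (n i)) (Fin (n i)) (PowerSeries ℂ) :=
  algebraMap ℂ (Matrix (Fin (n i)) (Fin (n i)) (PowerSeries ℂ)) (ξ i) +
    (PowerSeries.X : PowerSeries ℂ) •
      ((ω i • hermitian (B i)).map (algebraMap ℂ (PowerSeries ℂ)))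

/-- The series in `s` under the `k`-th Gaussian integral for the observable `f`, up to the factor
`(-N/t)^k / k!`:
`(∑_i Tr δV_i(M_i))^k ∏_{j<i} det (M_i ⊗ 1 - 1 ⊗ M_j)² f(M)`, with `M` the block diagonal matrix
of the `M_i`. -/
def formalIntegrand (k : ℕ) (f : Observable S) (B : Coords n) : PowerSeries ℂ :=
  (∑ i, Matrix.trace (Polynomial.aeval (block ξ ω B i) (nonGaussian V ξ i))) ^ k *
    (∏ i, ∏ j ∈ Finset.Iio i,
      (Matrix.det (block ξ ω B i ⊗ₖ (1 : Matrix (Fin (n j)) (Fin (n j)) (PowerSeries ℂ)) -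
        (1 : Matrix (Fin (n i)) (Fin (n i)) (PowerSeries ℂ)) ⊗ₖ block ξ ω B j)) ^ 2) *
    evalAt (Matrix.blockDiagonal' (block ξ ω B)) f

/-- The Gaussian weight, with `N = ∑ n_i`. -/
def gaussianWeight (B : Coords n) : ℂ :=
  Complex.exp (-(((∑ i, n i : ℕ) : ℂ) / 2) *
    ∑ i, V.derivative.derivative.eval (ξ i) *
      Matrix.trace ((ω i • hermitian (B i)) ^ 2))

variable (n)

/-- The coefficient of `s ^ p` in the formal integral
`∑_k ((-N)^k / (t^k k!)) ∫ (∑ Tr δV_i(M_i))^k ∏ det² f(M) e^{Gaussian}`, `t = s²`.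
As `δV_i` starts with a cubic term, the `k`-th summand has order at least `3k - 2k = k` in `s`, so
only `k ≤ p` contribute. -/
def formalCoeff (p : ℕ) (f : Observable S) : ℂ :=
  ∑ k ∈ Finset.range (p + 1), (-((∑ i, n i : ℕ) : ℂ)) ^ k / (k.factorial : ℂ) *
    ∫ B : Coords n, PowerSeries.coeff (p + 2 * k) (formalIntegrand V ξ ω k f B) *
      gaussianWeight V ξ ω B

/-- The formal matrix integral of `f`, a formal power series in `t = s²`. -/
def formalIntegral (f : Observable S) : PowerSeries ℂ :=
  PowerSeries.mk fun q => formalCoeff V ξ ω n (2 * q) f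

end Formal

end MatrixModel

end

/-! A loop equation says that a total divergence integrates to zero. For `δ = f(M) w(M)`, consider
the vector field `f w` on the space of matrices, with density `Δ² e^{-action}`. Differentiating the
entries of `w` produces the splits of `w` inside one block, differentiating the Vandermonde factor
`Δ²` produces the splits between two different blocks, and differentiating `f` produces the merges;
together these are `J[δ]`. Differentiating the weight produces `(N/t) Tr V'(M) δ(M)`. So two things
are needed: an algebraic identity for the divergence, common to all the integrals, and an
integration by parts, different for each of them.

The identity is `divergence_eq`. It concerns blocks `M_i` over a commutative algebra `R` and
derivations from `R` to an `R`-algebra `R'` which send `M_i` to `Θ E_ab` and kill the other blocks.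
The delicate term is the Vandermonde: along the flow of `w`, the matrix `K = M_i ⊗ 1 - 1 ⊗ M_j`
changes by `Θ (w(M_i) ⊗ 1 - 1 ⊗ w(M_j))`, which equals `Θ T K` with `Tr T` the split of `w`
(`exists_word_kronecker_sub`). Jacobi's formula `derivation_det` then gives the logarithmic
derivative of `det K` without dividing by differences of eigenvalues.

The identity is used three times. For eigenvalues on paths there are `N` blocks of size one and `Θ =
∏ dx_b/du_b`; Fubini reduces the integration by parts to a single path, where the boundary terms
vanish by `AdmissiblePath.tendsto_zero`. For Hermitian matrices there is one block, no Vandermonde,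
and `Θ = 1`, the matrix units being complex combinations of Hermitian directions; the decay of the
weight is read off the eigenvalues. For formal integrals the blocks are `ξ_i + s ω_i A_i`, the
coefficients of the power series are functions of polynomial growth, and `Θ = s`.

In the formal case the integration by parts sees only the Gaussian weight, and so yields only the
part `V''(ξ_i)(M_i - ξ_i)` of `V'(M_i)`. The other part, `δV_i'(M_i)`, comes from the expanded
exponential: with `Φ = ∑ Tr δV_i(M_i)`, the derivative of `Φ^k` in the `k`-th term cancels `δV_i'`
in the term `k - 1` (`partial_sum_loop`). The sum telescopes, and the last term is of too high order
in `s` to contribute, because `δV_i` vanishes to third order at the critical point `ξ_i`. Odd powers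
of `s` disappear by the symmetry `A ↦ -A`, and at `s = 0` the partition function is `∏ (ξ_i -
ξ_j)^{2 n_i n_j}` times a nonzero Gaussian integral. -/

noncomputable section

namespace MatrixModel

open MeasureTheory
open scoped Kronecker

variable {S : Set ℂ}

set_option linter.unusedSectionVars false

/-! ### Words and observables evaluated at block diagonal matrices -/

section Words

variable {ι κ : Type*} [Fintype ι] [DecidableEq ι] [Fintype κ] [DecidableEq κ]
variable {R T : Type*} [CommRing R] [Algebra ℂ R] [CommRing T] [Algebra ℂ T]

/-- The value of a word at a matrix. -/
def wordEval (M : Matrix ι ι R) (w : Word S) : Matrix ι ι R := (w.map (Letter.eval M)).prod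

@[simp] lemma wordEval_nil (M : Matrix ι ι R) : wordEval M ([] : Word S) = 1 := rfl

lemma wordEval_cons (M : Matrix ι ι R) (l : Letter S) (w : Word S) :
    wordEval M (l :: w) = Letter.eval M l * wordEval M w := by
  simp [wordEval]

lemma wordEval_append (M : Matrix ι ι R) (v w : Word S) :
    wordEval M (v ++ w) = wordEval M v * wordEval M w := by
  simp [wordEval]

lemma wordEval_singleton (M : Matrix ι ι R) (l : Letter S) :
    wordEval M [l] = Letter.eval M l := by
  simp [wordEval]

lemma wordEval_replicate_mat (M : Matrix ι ι R) (k : ℕ) :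
    wordEval M (List.replicate k (Letter.mat : Letter S)) = M ^ k := by
  simp [wordEval, Letter.eval]

/-- All the resolvents `(x - M)⁻¹`, `x ∈ S`, exist. -/
def ResolventsExist (S : Set ℂ) (M : Matrix ι ι R) : Prop :=
  ∀ x ∈ S, IsUnit (algebraMap ℂ (Matrix ι ι R) x - M)

lemma ResolventsExist.mul_inv {M : Matrix ι ι R} (h : ResolventsExist S M) (x : S) :
    (algebraMap ℂ (Matrix ι ι R) x - M) * (algebraMap ℂ (Matrix ι ι R) x - M)⁻¹ = 1 :=
  Matrix.mul_nonsing_inv _ ((Matrix.isUnit_iff_isUnit_det _).1 (h x x.2))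

lemma ResolventsExist.inv_mul {M : Matrix ι ι R} (h : ResolventsExist S M) (x : S) :
    (algebraMap ℂ (Matrix ι ι R) x - M)⁻¹ * (algebraMap ℂ (Matrix ι ι R) x - M) = 1 :=
  Matrix.nonsing_inv_mul _ ((Matrix.isUnit_iff_isUnit_det _).1 (h x x.2))

lemma map_algebraMap_sub (φ : R →ₐ[ℂ] T) (M : Matrix ι ι R) (x : ℂ) :
    (algebraMap ℂ (Matrix ι ι R) x - M).map φ = algebraMap ℂ (Matrix ι ι T) x - M.map φ := by
  have := map_sub φ.mapMatrix (algebraMap ℂ (Matrix ι ι R) x) M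
  rwa [AlgHom.commutes] at this

lemma ResolventsExist.map {M : Matrix ι ι R} (h : ResolventsExist S M) (φ : R →ₐ[ℂ] T) :
    ResolventsExist S (M.map φ) := fun x hx => by
  rw [← map_algebraMap_sub]
  exact (h x hx).map φ.mapMatrix

/-- The matrix inverse is total, with value `0` at non-invertible matrices, and a homomorphism can
turn a non-unit into a unit. It therefore commutes with resolvents only once these exist over `R`.
-/
lemma ResolventsExist.map_letter {M : Matrix ι ι R} (h : ResolventsExist S M) (φ : R →ₐ[ℂ] T)
    (l : Letter S) : (Letter.eval M l).map φ = Letter.eval (M.map φ) l := by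
  cases l with
  | mat => rfl
  | res x =>
    have h1 : ((algebraMap ℂ (Matrix ι ι R) x - M)⁻¹).map φ *
        (algebraMap ℂ (Matrix ι ι T) x - M.map φ) = 1 := by
      rw [← map_algebraMap_sub, ← AlgHom.mapMatrix_apply, ← AlgHom.mapMatrix_apply, ← map_mul,
        h.inv_mul, map_one]
    exact (Matrix.inv_eq_left_inv h1).symm

lemma ResolventsExist.map_word {M : Matrix ι ι R} (h : ResolventsExist S M) (φ : R →ₐ[ℂ] T)
    (w : Word S) : (wordEval M w).map φ = wordEval (M.map φ) w := by
  induction w with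
  | nil => exact map_one φ.mapMatrix
  | cons l w ih =>
    rw [wordEval_cons, wordEval_cons, ← ih, ← h.map_letter]
    exact map_mul φ.mapMatrix _ _

lemma ResolventsExist.commute_letter {M : Matrix ι ι R} (h : ResolventsExist S M) (l : Letter S) :
    Commute M (Letter.eval M l) := by
  cases l with
  | mat => exact Commute.refl M
  | res x =>
    have h0 : Commute M (algebraMap ℂ (Matrix ι ι R) x - M) :=
      Commute.sub_right (Algebra.commutes (x : ℂ) M).symm (Commute.refl M)
    have h1 := h.mul_inv x
    have h2 := h.inv_mul x
    change M * (algebraMap ℂ (Matrix ι ι R) x - M)⁻¹ = (algebraMap ℂ (Matrix ι ι R) x - M)⁻¹ * M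
    set r := (algebraMap ℂ (Matrix ι ι R) x - M)⁻¹
    set y := (algebraMap ℂ (Matrix ι ι R) x - M)
    calc M * r = r * y * M * r := by rw [h2, one_mul]
      _ = r * (M * y) * r := by rw [h0.eq]; noncomm_ring
      _ = r * M * (y * r) := by noncomm_ring
      _ = r * M := by rw [h1, mul_one]

lemma ResolventsExist.commute_word {M : Matrix ι ι R} (h : ResolventsExist S M) (w : Word S) :
    Commute M (wordEval M w) := by
  induction w with
  | nil => exact Commute.one_right M
  | cons l w ih => rw [wordEval_cons]; exact (h.commute_letter l).mul_right ih

end Words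

/-! ### Observables of block diagonal matrices -/

section Blocks

variable {β : Type*} [Fintype β] {n : β → Type*} [∀ i, Fintype (n i)]
  [∀ i, DecidableEq (n i)]
variable {R T : Type*} [CommRing R] [Algebra ℂ R] [CommRing T] [Algebra ℂ T]

/-- The value of an observable at the block diagonal matrix with blocks `M i`. -/
def evalBlocks (M : ∀ i, Matrix (n i) (n i) R) : Observable S →ₐ[ℂ] R :=
  MvPolynomial.aeval fun w : Word S => ∑ i, Matrix.trace (wordEval (M i) w)

lemma evalBlocks_tr (M : ∀ i, Matrix (n i) (n i) R) (w : Word S) :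
    evalBlocks M (tr w) = ∑ i, Matrix.trace (wordEval (M i) w) := by
  simp [evalBlocks, tr]

lemma map_evalBlocks {M : ∀ i, Matrix (n i) (n i) R} (h : ∀ i, ResolventsExist S (M i))
    (φ : R →ₐ[ℂ] T) (f : Observable S) :
    φ (evalBlocks M f) = evalBlocks (fun i => (M i).map φ) f := by
  rw [evalBlocks, evalBlocks, ← AlgHom.comp_apply, MvPolynomial.comp_aeval]
  congr 2
  funext w
  rw [map_sum]
  refine Finset.sum_congr rfl fun i _ => ?_
  rw [← (h i).map_word, Matrix.trace, Matrix.trace, map_sum]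
  rfl

lemma blockDiagonal'_wordEval [DecidableEq β] {M : ∀ i, Matrix (n i) (n i) R}
    (h : ∀ i, ResolventsExist S (M i)) (w : Word S) :
    wordEval (Matrix.blockDiagonal' M) w = Matrix.blockDiagonal' fun i => wordEval (M i) w := by
  induction w with
  | nil => exact Matrix.blockDiagonal'_one.symm
  | cons l w ih =>
    have hl : Letter.eval (Matrix.blockDiagonal' M) l =
        Matrix.blockDiagonal' fun i => Letter.eval (M i) l := by
      cases l with
      | mat => rfl
      | res x =>
        refine Matrix.inv_eq_left_inv ?_
        have h1 : algebraMap ℂ (Matrix ((i : β) × n i) ((i : β) × n i) R) x =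
            Matrix.blockDiagonal' fun i => algebraMap ℂ (Matrix (n i) (n i) R) x := by
          ext ⟨i, a⟩ ⟨j, b⟩
          rw [Matrix.algebraMap_matrix_apply, Matrix.blockDiagonal'_apply]
          by_cases hij : i = j
          · subst hij
            simp [Matrix.algebraMap_matrix_apply]
          · simp [hij]
        rw [h1, ← Matrix.blockDiagonal'_sub, ← Matrix.blockDiagonal'_mul,
          ← Matrix.blockDiagonal'_one]
        congr 1
        funext i
        exact (h i).inv_mul x
    rw [wordEval_cons, ih, hl, ← Matrix.blockDiagonal'_mul]
    rfl

lemma evalAt_blockDiagonal' [DecidableEq β] {M : ∀ i, Matrix (n i) (n i) R}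
    (h : ∀ i, ResolventsExist S (M i)) (f : Observable S) : evalAt (Matrix.blockDiagonal' M) f = evalBlocks M f := by
  rw [evalAt, evalBlocks]
  congr 2
  funext w
  rw [← Matrix.trace_blockDiagonal', ← blockDiagonal'_wordEval h]
  rfl

lemma evalAt_eq_evalBlocks {ι : Type*} [Fintype ι] [DecidableEq ι] (M : Matrix ι ι R)
    (f : Observable S) : evalAt M f = evalBlocks (fun _ : Fin 1 => M) f := by
  rw [evalAt, evalBlocks]
  congr 2
  funext w
  simp [wordEval]

lemma evalBlocks_trPolyMul_single (M : ∀ i, Matrix (n i) (n i) R) (Q : Polynomial ℂ) (w : Word S)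
    (f : Observable S) :
    evalBlocks M (trPolyMul Q (Finsupp.single w f)) =
      evalBlocks M f * ∑ i, Matrix.trace (Polynomial.aeval (M i) Q * wordEval (M i) w) := by
  rw [trPolyMul, Finsupp.sum_single_index (by simp [Polynomial.sum]), Polynomial.sum, map_sum]
  simp_rw [map_mul, evalBlocks_tr, wordEval_append, wordEval_replicate_mat,
    Polynomial.aeval_eq_sum_range, Matrix.sum_mul, Matrix.trace_sum]
  rw [Finset.sum_comm, Finset.mul_sum]
  rw [Finset.sum_subset Polynomial.supp_subset_range_natDegree_succ]
  · refine Finset.sum_congr rfl fun k _ => ?_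
    simp only [Matrix.smul_mul, Matrix.trace_smul, ← Finset.smul_sum, ← MvPolynomial.algebraMap_eq,
      AlgHom.commutes]
    rw [Algebra.smul_def]
    ring
  · intro k _ hk
    rw [Polynomial.notMem_support_iff.1 hk]
    simp

end Blocks

/-- The loop equations are linear in the change of variables. -/
lemma loopEquations_mean {R : Type*} [CommRing R] {V : Polynomial ℂ} {N : ℕ} {t : R}
    (I : Observable S → R) (hI : ∀ f g, I (f + g) = I f + I g)
    (h : ∀ (w : Word S) (f : Observable S),
      (N : R) * I (trPolyMul V.derivative (Finsupp.single w f)) =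
        t * I (jacobian (Finsupp.single w f))) :
    LoopEquations V N t (mean I) := by
  intro δ
  have h0 : I 0 = 0 := by simpa using hI 0 0
  have key : (N : R) * I (trPolyMul V.derivative δ) = t * I (jacobian δ) := by
    induction δ using Finsupp.induction_linear with
    | zero => simp [trPolyMul, jacobian, h0]
    | add δ₁ δ₂ h₁ h₂ =>
      have e1 : trPolyMul V.derivative (δ₁ + δ₂) =
          trPolyMul V.derivative δ₁ + trPolyMul V.derivative δ₂ := by
        refine Finsupp.sum_add_index' (fun w => by simp [Polynomial.sum]) fun w f g => ?_
        simp only [Polynomial.sum, ← Finset.sum_add_distrib]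
        exact Finset.sum_congr rfl fun k _ => by ring
      have e2 : jacobian (δ₁ + δ₂) = jacobian δ₁ + jacobian δ₂ := by
        refine Finsupp.sum_add_index' (fun w => by simp) fun w f g => ?_
        rw [map_add]
        ring
      rw [e1, e2, hI, hI, mul_add, mul_add, h₁, h₂]
    | single w f => exact h w f
  -- Both sides are multiplied by the same factor `Ring.inverse (I 1)`.
  rw [mean, mean, ← mul_assoc, key, mul_assoc]

lemma jacobian_single (w : Word S) (f : Observable S) :
    jacobian (Finsupp.single w f) =
      f * splitAt [] w + MvPolynomial.mkDerivation ℂ (fun v => mergeAt w [] v) f :=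
  Finsupp.sum_single_index (by simp)

/-! ### Derivations of words, traces and determinants -/

section MatrixDerivation

variable {ι κ : Type*} [Fintype ι] [DecidableEq ι] [Fintype κ] [DecidableEq κ]
variable {R R' : Type*} [CommRing R] [Algebra ℂ R] [CommRing R'] [Algebra ℂ R'] [Algebra R R']
  [IsScalarTower ℂ R R']

/-- Derivations go from `R` to a possibly larger algebra `R'`: in the applications `R` consists of
`C¹` functions, or of power series in them, and the derivatives need not be `C¹`. Undifferentiated
factors are carried over by `algebraMap`. -/
lemma map_derivation_mul (D : Derivation ℂ R R') (K L : Matrix ι ι R) :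
    (K * L).map D = K.map D * L.map (algebraMap R R') + K.map (algebraMap R R') * L.map D := by
  ext a b
  simp only [Matrix.map_apply, Matrix.mul_apply, Matrix.add_apply, map_sum, Derivation.leibniz,
    Algebra.smul_def, Finset.sum_add_distrib]
  rw [add_comm]
  congr 1
  exact Finset.sum_congr rfl fun c _ => mul_comm _ _

lemma map_derivation_one (D : Derivation ℂ R R') : (1 : Matrix ι ι R).map D = 0 := by
  ext a b
  by_cases h : a = b <;> simp [h]

lemma map_derivation_algebraMap (D : Derivation ℂ R R') (x : ℂ) :
    (algebraMap ℂ (Matrix ι ι R) x).map D = 0 := by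
  ext a b
  by_cases h : a = b <;> simp [h, Matrix.algebraMap_matrix_apply]

lemma map_derivation_sub (D : Derivation ℂ R R') (K L : Matrix ι ι R) :
    (K - L).map D = K.map D - L.map D := by
  ext a b
  simp

lemma map_algebraMap_mul (K L : Matrix ι ι R) :
    (K * L).map (algebraMap R R') = K.map (algebraMap R R') * L.map (algebraMap R R') :=
  Matrix.map_mul

lemma trace_map_algebraMap (K : Matrix ι ι R) :
    Matrix.trace (K.map (algebraMap R R')) = algebraMap R R' (Matrix.trace K) := by
  simp [Matrix.trace]

lemma trace_map_derivation (D : Derivation ℂ R R') (K : Matrix ι ι R) :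
    Matrix.trace (K.map D) = D (Matrix.trace K) := by
  simp [Matrix.trace]

/-- Differentiate `r (x - M) = 1`, where the constant `x` is killed, and multiply by `r` on the
right. -/
lemma map_derivation_resolvent (D : Derivation ℂ R R') {M : Matrix ι ι R}
    (h : ResolventsExist S M) (x : S) :
    (Letter.eval M (.res x)).map D = (Letter.eval M (.res x)).map (algebraMap R R') * M.map D *
      (Letter.eval M (.res x)).map (algebraMap R R') := by
  have h1 := h.inv_mul x
  have h2 := h.mul_inv x
  rw [Letter.eval]
  set r := (algebraMap ℂ (Matrix ι ι R) x - M)⁻¹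
  have h3 := map_derivation_mul D r (algebraMap ℂ (Matrix ι ι R) x - M)
  rw [h1, map_derivation_one, map_derivation_sub, map_derivation_algebraMap, zero_sub,
    Matrix.mul_neg] at h3
  have h4 : (algebraMap ℂ (Matrix ι ι R) x - M).map (algebraMap R R') *
      r.map (algebraMap R R') = 1 := by
    rw [← map_algebraMap_mul, h2]
    exact map_one (algebraMap R R').mapMatrix
  calc r.map D = r.map D * ((algebraMap ℂ (Matrix ι ι R) x - M).map (algebraMap R R') *
      r.map (algebraMap R R')) := by rw [h4, mul_one]
    _ = _ := by
      rw [← mul_assoc, eq_comm, add_neg_eq_zero] at *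
      rw [h3]

/-- `D (Tr (M ^ j D (M ^ k)))` as for a function of a single variable. -/
lemma trace_pow_mul_map_derivation_pow (D : Derivation ℂ R R') (M : Matrix ι ι R) (k j : ℕ) :
    Matrix.trace ((M ^ j).map (algebraMap R R') * (M ^ k).map D) =
      k * Matrix.trace ((M ^ (j + k - 1)).map (algebraMap R R') * M.map D) := by
  induction k generalizing j with
  | zero => simp [map_derivation_one]
  | succ k ih =>
    rw [pow_succ, map_derivation_mul, mul_add, Matrix.trace_add, ← mul_assoc, ← mul_assoc,
      Matrix.trace_mul_comm, ← mul_assoc, ← map_algebraMap_mul, ← map_algebraMap_mul, ← pow_succ',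
      ← pow_add, ih (j + 1)]
    have e1 : j + 1 + k - 1 = j + k := by omega
    have e2 : j + (k + 1) - 1 = j + k := by omega
    rw [e1, e2]
    push_cast
    ring

/-- Under the trace, the powers of `M` on the two sides of `D M` recombine by cyclicity, so the
scalar chain rule survives although `M` and `D M` do not commute. This is what differentiates an
action `Tr V(M)`. -/
lemma derivation_trace_aeval (D : Derivation ℂ R R') (M : Matrix ι ι R) (p : Polynomial ℂ) :
    D (Matrix.trace (Polynomial.aeval M p)) =
      Matrix.trace ((Polynomial.aeval M p.derivative).map (algebraMap R R') * M.map D) := by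
  induction p using Polynomial.induction_on' with
  | add p q hp hq =>
    have : (Polynomial.aeval M p.derivative + Polynomial.aeval M q.derivative).map
        (algebraMap R R') = (Polynomial.aeval M p.derivative).map (algebraMap R R') +
          (Polynomial.aeval M q.derivative).map (algebraMap R R') :=
      map_add (algebraMap R R').mapMatrix _ _
    rw [map_add, Matrix.trace_add, map_add, hp, hq, Polynomial.derivative_add, map_add, this,
      add_mul, Matrix.trace_add]
  | monomial k c =>
    have h := trace_pow_mul_map_derivation_pow D M k 0
    have h1 : (1 : Matrix ι ι R).map (algebraMap R R') = 1 :=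
      map_one (algebraMap R R').mapMatrix
    rw [pow_zero, h1, one_mul, zero_add, trace_map_derivation] at h
    have : (((c * k : ℂ) • M ^ (k - 1)).map (algebraMap R R')) =
        (c * k : ℂ) • (M ^ (k - 1)).map (algebraMap R R') := by
      ext a b
      rw [Matrix.map_apply, Matrix.smul_apply, Matrix.smul_apply, Matrix.map_apply,
        Algebra.smul_def, map_mul, ← IsScalarTower.algebraMap_apply, ← Algebra.smul_def]
    rw [Polynomial.derivative_monomial, ← Polynomial.smul_X_eq_monomial,
      ← Polynomial.smul_X_eq_monomial, map_smul, map_smul, map_pow, map_pow, Polynomial.aeval_X,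
      Matrix.trace_smul, D.map_smul, h, this, Matrix.smul_mul, Matrix.trace_smul, mul_smul]
    congr 1
    simp [Algebra.smul_def]

/-- The Leibniz rule with full products as summands, the form in which it meets the permutation
expansion of a determinant. -/
lemma derivation_prod {α : Type*} [DecidableEq α] (D : Derivation ℂ R R') (s : Finset α)
    (f : α → R) :
    D (∏ i ∈ s, f i) =
      ∑ a ∈ s, ∏ i ∈ s, if i = a then D (f i) else algebraMap R R' (f i) := by
  induction s using Finset.induction_on with
  | empty => simp
  | insert b s hb ih =>
    have h1 : ∏ i ∈ s, (if i = b then D (f i) else algebraMap R R' (f i)) =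
        algebraMap R R' (∏ i ∈ s, f i) := by
      rw [map_prod]
      refine Finset.prod_congr rfl fun i hi => if_neg ?_
      rintro rfl
      exact hb hi
    rw [Finset.prod_insert hb, Derivation.leibniz, ih, Finset.sum_insert hb, Finset.prod_insert hb,
      if_pos rfl, h1, add_comm, Algebra.smul_def, Algebra.smul_def, mul_comm, Finset.mul_sum]
    congr 1
    refine Finset.sum_congr rfl fun a ha => ?_
    rw [Finset.prod_insert hb, if_neg]
    rintro rfl
    exact hb ha

/-- Jacobi's formula: a derivation acts on `det K` by the trace of its logarithmic derivative. -/
lemma derivation_det (D : Derivation ℂ R R') (K : Matrix ι ι R) (L : Matrix ι ι R')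
    (h : K.map D = L * K.map (algebraMap R R')) :
    D K.det = Matrix.trace L * algebraMap R R' K.det := by
  -- The rows of `D K = L K` are combinations of the rows of `K`; put in place of row `a`, only the
  -- multiple `L a a` of that row contributes to the determinant.
  have hrow : ∀ a, Matrix.det ((K.map (algebraMap R R')).updateRow a ((K.map D) a)) =
      L a a * algebraMap R R' K.det := by
    intro a
    have : (K.map D) a = ∑ b, L a b • (K.map (algebraMap R R')) b := by
      rw [h]
      ext c
      simp [Matrix.mul_apply]
    rw [this, Matrix.det_updateRow_sum, smul_eq_mul, RingHom.map_det]
    rfl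
  rw [Matrix.trace, Finset.sum_mul]
  simp_rw [Matrix.diag_apply, ← hrow]
  -- After transposition the products in the permutation expansion run over rows, so that
  -- differentiating one factor amounts to updating one row.
  rw [← Matrix.det_transpose K, Matrix.det_apply' K.transpose, map_sum]
  simp_rw [← Matrix.det_transpose (Matrix.updateRow _ _ _), Matrix.det_apply']
  rw [Finset.sum_comm]
  refine Finset.sum_congr rfl fun σ _ => ?_
  rw [← Finset.mul_sum, Derivation.leibniz, Derivation.map_intCast, smul_zero, add_zero,
    Algebra.smul_def, map_intCast, derivation_prod]
  congr 1
  refine Finset.sum_congr rfl fun a _ => Finset.prod_congr rfl fun i _ => ?_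
  simp only [Matrix.transpose_apply, Matrix.updateRow_apply, Matrix.map_apply]
  by_cases h : i = a <;> simp [h]

/-! ### The splitting rule -/

/-- The value `∑ Tr A(P) Tr B(Q)` of the split of the word `w` at two matrices, the prefix `p`
being frozen. -/
def splitPair (P : Matrix ι ι R) (Q : Matrix κ κ R) : Word S → Word S → R
  | _, [] => 0
  | p, .mat :: q => Matrix.trace (wordEval P p) * Matrix.trace (wordEval Q q) +
      splitPair P Q (p ++ [.mat]) q
  | p, .res x :: q => Matrix.trace (wordEval P (p ++ [.res x])) *
      Matrix.trace (wordEval Q (.res x :: q)) + splitPair P Q (p ++ [.res x]) q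

/-- Each summand is `K a a * L b b`. This is the origin of the split rule for a single letter. -/
lemma sum_sum_mul_single_mul (K L : Matrix ι ι R) :
    ∑ a, ∑ b, (K * (Matrix.single a b 1 : Matrix ι ι R) * L) a b = Matrix.trace K * Matrix.trace L := by
  have : ∀ a b, (K * (Matrix.single a b 1 : Matrix ι ι R) * L) a b = K a a * L b b := by
    intro a b
    rw [Matrix.mul_assoc, Matrix.mul_apply, Finset.sum_eq_single a]
    · simp
    · intro c _ hc
      rw [Matrix.single_mul_apply_of_ne _ _ _ _ _ hc, mul_zero]
    · simp
  simp_rw [this, Matrix.trace, Finset.sum_mul_sum, Matrix.diag_apply]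

/-- The divergence of the vector field `w(M)` is its split. -/
lemma sum_map_derivation_word (D : ι → ι → Derivation ℂ R R') {M : Matrix ι ι R}
    (h : ResolventsExist S M) (Θ : R')
    (hD : ∀ a b, M.map (D a b) = Θ • Matrix.single a b 1) (p w : Word S) :
    ∑ a, ∑ b, ((wordEval M p).map (algebraMap R R') * (wordEval M w).map (D a b)) a b =
      Θ * algebraMap R R' (splitPair M M p w) := by
  have hs : ∀ K L : Matrix ι ι R, ∑ a, ∑ b, (K.map (algebraMap R R') * M.map (D a b) *
      L.map (algebraMap R R')) a b =
        Θ * algebraMap R R' (Matrix.trace K * Matrix.trace L) := by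
    intro K L
    rw [map_mul, ← trace_map_algebraMap, ← trace_map_algebraMap, ← sum_sum_mul_single_mul,
      Finset.mul_sum]
    refine Finset.sum_congr rfl fun a _ => ?_
    rw [Finset.mul_sum]
    refine Finset.sum_congr rfl fun b _ => ?_
    rw [hD, Matrix.mul_smul, Matrix.smul_mul, Matrix.smul_apply, smul_eq_mul]
  induction w generalizing p with
  | nil => simp [map_derivation_one, splitPair]
  | cons l w ih =>
    have h1 : ∀ a b, (wordEval M p).map (algebraMap R R') * (wordEval M (l :: w)).map (D a b) =
        (wordEval M p).map (algebraMap R R') * (Letter.eval M l).map (D a b) *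
          (wordEval M w).map (algebraMap R R') +
        (wordEval M (p ++ [l])).map (algebraMap R R') * (wordEval M w).map (D a b) := by
      intro a b
      rw [wordEval_cons, map_derivation_mul, mul_add, wordEval_append, wordEval_singleton,
        map_algebraMap_mul, mul_assoc, mul_assoc]
    simp_rw [h1, Matrix.add_apply, Finset.sum_add_distrib]
    rw [ih]
    cases l with
    | mat =>
      rw [splitPair, map_add, mul_add, ← hs]
      rfl
    -- The two resolvents in `D r = r (D M) r` go one to each trace.
    | res x =>
      rw [splitPair, map_add, mul_add, ← hs, wordEval_append, wordEval_singleton, wordEval_cons]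
      simp_rw [map_derivation_resolvent _ h, map_algebraMap_mul, mul_assoc]

/-- Cyclicity of the split in the difference `w(P) ⊗ 1 - 1 ⊗ w(Q)`. -/
lemma exists_word_kronecker_sub {P : Matrix ι ι R} {Q : Matrix κ κ R} (hP : ResolventsExist S P)
    (hQ : ResolventsExist S Q) (p w : Word S) :
    ∃ T : Matrix (ι × κ) (ι × κ) R, Matrix.trace T = splitPair P Q p w ∧
      wordEval P (p ++ w) ⊗ₖ (1 : Matrix κ κ R) - wordEval P p ⊗ₖ wordEval Q w =
        T * (P ⊗ₖ (1 : Matrix κ κ R) - (1 : Matrix ι ι R) ⊗ₖ Q) := by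
  induction w generalizing p with
  | nil => exact ⟨0, by simp [splitPair], by simp⟩
  | cons l w ih =>
    -- Telescoping: moving the letter `l` into the prefix costs `p l ⊗ w - p ⊗ l w`. This is a
    -- multiple of `P ⊗ 1 - 1 ⊗ Q`, and the trace of the multiplier is the split of `l`. For `l = M`
    -- the multiplier is `p ⊗ w`, because `Q` commutes with `w(Q)`.
    obtain ⟨T, hT, hT'⟩ := ih (p ++ [l])
    rw [List.append_assoc, List.singleton_append] at hT'
    cases l with
    | mat =>
      refine ⟨wordEval P p ⊗ₖ wordEval Q w + T, ?_, ?_⟩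
      · rw [Matrix.trace_add, Matrix.trace_kronecker, hT, splitPair]
      · rw [add_mul, ← hT', mul_sub, ← Matrix.mul_kronecker_mul, ← Matrix.mul_kronecker_mul,
          mul_one, mul_one, wordEval_append P p [_], wordEval_singleton,
          ← (hQ.commute_word w).eq, wordEval_cons Q]
        simp only [Letter.eval]
        abel
    | res x =>
      refine ⟨wordEval P (p ++ [.res x]) ⊗ₖ wordEval Q (.res x :: w) + T, ?_, ?_⟩
      · rw [Matrix.trace_add, Matrix.trace_kronecker, hT, splitPair]
      -- Both resolvents satisfy `r P = x r - 1` and `r Q = x r - 1`; the terms in `x` cancel in the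
      -- difference.
      · have e1 : wordEval P (p ++ [.res x]) * P =
            algebraMap ℂ R x • wordEval P (p ++ [.res x]) - wordEval P p := by
          have := hP.inv_mul x
          rw [mul_sub, sub_eq_iff_eq_add, ← Algebra.commutes, ← Algebra.smul_def] at this
          rw [wordEval_append, wordEval_singleton, mul_assoc, Letter.eval, ← sub_eq_iff_eq_add'.2 this,
            mul_sub, mul_one, algebraMap_smul, Matrix.mul_smul]
        have e2 : wordEval Q (.res x :: w) * Q =
            algebraMap ℂ R x • wordEval Q (.res x :: w) - wordEval Q w := by
          have := hQ.mul_inv x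
          rw [sub_mul, sub_eq_iff_eq_add, ← Algebra.smul_def] at this
          rw [← (hQ.commute_word _).eq, wordEval_cons, ← mul_assoc, Letter.eval,
            ← sub_eq_iff_eq_add'.2 this, sub_mul, one_mul, algebraMap_smul, Matrix.smul_mul]
        rw [add_mul, ← hT', mul_sub, ← Matrix.mul_kronecker_mul, ← Matrix.mul_kronecker_mul,
          mul_one, mul_one, e1, e2]
        ext ⟨a, a'⟩ ⟨b, b'⟩
        simp only [Matrix.kronecker_apply, Matrix.sub_apply, Matrix.add_apply, Matrix.smul_apply,
          smul_eq_mul]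
        ring

/-- Jacobi's formula with the matrix `Θ T` of `exists_word_kronecker_sub` as logarithmic derivative.
The determinant is never inverted, so common eigenvalues of `P` and `Q` do no harm. -/
lemma derivation_det_kronecker_sub (D : Derivation ℂ R R') {P : Matrix ι ι R} {Q : Matrix κ κ R}
    (hP : ResolventsExist S P) (hQ : ResolventsExist S Q) (Θ : R') (w : Word S)
    (hDP : P.map D = Θ • (wordEval P w).map (algebraMap R R'))
    (hDQ : Q.map D = Θ • (wordEval Q w).map (algebraMap R R')) :
    D (Matrix.det (P ⊗ₖ (1 : Matrix κ κ R) - (1 : Matrix ι ι R) ⊗ₖ Q)) =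
      Θ * algebraMap R R' (splitPair P Q [] w *
        Matrix.det (P ⊗ₖ (1 : Matrix κ κ R) - (1 : Matrix ι ι R) ⊗ₖ Q)) := by
  obtain ⟨T, hT, hT'⟩ := exists_word_kronecker_sub hP hQ [] w
  rw [derivation_det D _ (Θ • T.map (algebraMap R R')), Matrix.trace_smul, trace_map_algebraMap,
    hT, map_mul, smul_eq_mul, mul_assoc]
  rw [Matrix.smul_mul, ← map_algebraMap_mul, ← hT', List.nil_append, wordEval_nil]
  ext ⟨a, a'⟩ ⟨b, b'⟩
  have h1 := congrFun₂ hDP a b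
  have h2 := congrFun₂ hDQ a' b'
  simp only [Matrix.map_apply, Matrix.smul_apply, smul_eq_mul] at h1 h2
  simp only [Matrix.map_apply, Matrix.sub_apply, Matrix.kronecker_apply, Matrix.smul_apply,
    smul_eq_mul, map_sub, map_mul, Derivation.leibniz, h1, h2]
  have h3 : ∀ c d : ι, D ((1 : Matrix ι ι R) c d) = 0 := fun c d => by
    rw [Matrix.one_apply]; split_ifs <;> simp
  have h4 : ∀ c d : κ, D ((1 : Matrix κ κ R) c d) = 0 := fun c d => by
    rw [Matrix.one_apply]; split_ifs <;> simp
  rw [h3, h4, smul_zero, smul_zero, Algebra.smul_def, Algebra.smul_def]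
  ring

lemma det_kronecker_sub_swap (P : Matrix ι ι R) (Q : Matrix κ κ R) :
    Matrix.det (Q ⊗ₖ (1 : Matrix ι ι R) - (1 : Matrix κ κ R) ⊗ₖ P) =
      (-1) ^ (Fintype.card (ι × κ)) *
        Matrix.det (P ⊗ₖ (1 : Matrix κ κ R) - (1 : Matrix ι ι R) ⊗ₖ Q) := by
  rw [← Matrix.det_neg, ← Matrix.det_submatrix_equiv_self (Equiv.prodComm κ ι)]
  congr 1
  ext ⟨a, b⟩ ⟨c, d⟩
  simp [mul_comm]

/-- Exchanging `P` and `Q` changes the determinant only by a sign, so its derivative can be written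
with either split. Using one form for each factor of the square supplies both ordered pairs of
blocks in `Tr A Tr B`; this is why the Vandermonde occurs squared. -/
lemma derivation_det_kronecker_sub_sq (D : Derivation ℂ R R') {P : Matrix ι ι R}
    {Q : Matrix κ κ R} (hP : ResolventsExist S P) (hQ : ResolventsExist S Q) (Θ : R') (w : Word S)
    (hDP : P.map D = Θ • (wordEval P w).map (algebraMap R R'))
    (hDQ : Q.map D = Θ • (wordEval Q w).map (algebraMap R R')) :
    D (Matrix.det (P ⊗ₖ (1 : Matrix κ κ R) - (1 : Matrix ι ι R) ⊗ₖ Q) ^ 2) =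
      Θ * algebraMap R R' ((splitPair P Q [] w + splitPair Q P [] w) *
        Matrix.det (P ⊗ₖ (1 : Matrix κ κ R) - (1 : Matrix ι ι R) ⊗ₖ Q) ^ 2) := by
  have h1 := derivation_det_kronecker_sub D hP hQ Θ w hDP hDQ
  have h2 := derivation_det_kronecker_sub D hQ hP Θ w hDQ hDP
  rw [det_kronecker_sub_swap] at h2
  set K := Matrix.det (P ⊗ₖ (1 : Matrix κ κ R) - (1 : Matrix ι ι R) ⊗ₖ Q)
  have hs : ((-1 : R) ^ (Fintype.card (ι × κ))) * (-1 : R) ^ (Fintype.card (ι × κ)) = 1 := by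
    rw [← mul_pow]
    simp
  have h3 : D K = Θ * algebraMap R R' (splitPair Q P [] w * K) := by
    have h4 := congrArg (fun z => (-1 : R) ^ (Fintype.card (ι × κ)) • z) h2
    have h5 : D ((-1 : R) ^ (Fintype.card (ι × κ)) * K) =
        (-1 : R) ^ (Fintype.card (ι × κ)) • D K := by
      rcases neg_one_pow_eq_or R (Fintype.card (ι × κ)) with h | h <;> simp [h]
    rw [h5, smul_smul, hs, one_smul] at h4
    rw [h4, Algebra.smul_def]
    calc _ = Θ * algebraMap R R' (((-1 : R) ^ (Fintype.card (ι × κ)) *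
          (-1 : R) ^ (Fintype.card (ι × κ))) * (splitPair Q P [] w * K)) := by
          simp only [map_mul]; ring
      _ = _ := by rw [hs, one_mul]
  rw [pow_two, Derivation.leibniz]
  nth_rewrite 1 [h1]
  rw [h3, Algebra.smul_def, Algebra.smul_def]
  simp only [map_mul, map_add]
  ring

end MatrixDerivation

/-! ### The algebraic form of the loop equations -/

section LoopAlgebra

variable {d : ℕ} {n : Fin d → Type*} [∀ i, Fintype (n i)] [∀ i, DecidableEq (n i)]
variable {R R' : Type*} [CommRing R] [Algebra ℂ R] [CommRing R'] [Algebra ℂ R'] [Algebra R R']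
  [IsScalarTower ℂ R R']

/-- The squared Vandermonde determinant of the blocks `M i`. -/
def blockVandermonde (M : ∀ i, Matrix (n i) (n i) R) : R :=
  ∏ i, ∏ j ∈ Finset.Iio i, (Matrix.det (M i ⊗ₖ (1 : Matrix (n j) (n j) R) -
    (1 : Matrix (n i) (n i) R) ⊗ₖ M j)) ^ 2

/-- A trace is a sum over blocks, so `Tr A Tr B` is a sum over pairs of blocks. The diagonal pairs
will come from the divergence of `w`, the others from the Vandermonde. -/
lemma evalBlocks_splitAt (M : ∀ i, Matrix (n i) (n i) R) (p w : Word S) :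
    evalBlocks M (splitAt p w) = ∑ i, ∑ j, splitPair (M i) (M j) p w := by
  induction w generalizing p with
  | nil => simp [splitAt, splitPair]
  | cons l w ih =>
    cases l with
    | mat =>
      simp_rw [splitAt, splitPair, map_add, map_mul, evalBlocks_tr, ih, Finset.sum_add_distrib,
        Finset.sum_mul_sum]
    | res x =>
      simp_rw [splitAt, splitPair, map_add, map_mul, evalBlocks_tr, ih, Finset.sum_add_distrib,
        Finset.sum_mul_sum]

lemma sum_sum_eq_diag_add_Iio {A : Type*} [AddCommMonoid A] (F : Fin d → Fin d → A) :
    ∑ i, ∑ j, F i j = ∑ i, F i i + ∑ i, ∑ j ∈ Finset.Iio i, (F i j + F j i) := by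
  have h1 : ∀ i, ∑ j, F i j = F i i + (∑ j ∈ Finset.Iio i, F i j + ∑ j ∈ Finset.Ioi i, F i j) := by
    intro i
    have : (Finset.univ : Finset (Fin d)) = insert i (Finset.Iio i ∪ Finset.Ioi i) := by
      ext j
      simp only [Finset.mem_univ, Finset.mem_insert, Finset.mem_union, Finset.mem_Iio,
        Finset.mem_Ioi, true_iff]
      exact (lt_trichotomy j i).elim (fun h => Or.inr (Or.inl h))
        (fun h => h.elim Or.inl fun h => Or.inr (Or.inr h))
    rw [this, Finset.sum_insert (by simp), Finset.sum_union]
    exact Finset.disjoint_left.2 fun j h1 h2 =>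
      lt_asymm (Finset.mem_Iio.1 h1) (Finset.mem_Ioi.1 h2)
  simp_rw [h1, Finset.sum_add_distrib]
  congr 2
  exact Finset.sum_comm' (by simp)

/-- Logarithmic derivatives add up; written without quotients, since the factors need not be
invertible. -/
lemma derivation_prod_of_log {α : Type*} [DecidableEq α] (D : Derivation ℂ R R') (Θ : R')
    (s : Finset α) (f c : α → R) (h : ∀ i ∈ s, D (f i) = Θ * algebraMap R R' (c i * f i)) :
    D (∏ i ∈ s, f i) = Θ * algebraMap R R' ((∑ i ∈ s, c i) * ∏ i ∈ s, f i) := by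
  induction s using Finset.induction_on with
  | empty => simp
  | insert b s hb ih =>
    rw [Finset.prod_insert hb, Derivation.leibniz, Finset.sum_insert hb,
      ih fun i hi => h i (Finset.mem_insert_of_mem hi), h b (Finset.mem_insert_self b s),
      Algebra.smul_def, Algebra.smul_def]
    simp only [map_mul, map_add]
    ring

lemma derivation_sum_apply {α : Type*} (s : Finset α) (E : α → Derivation ℂ R R') (g : R) :
    (∑ i ∈ s, E i) g = ∑ i ∈ s, E i g := by
  classical
  induction s using Finset.induction_on with
  | empty => simp
  | insert a s ha ih => rw [Finset.sum_insert ha, Finset.sum_insert ha, Derivation.add_apply, ih]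

variable (M : ∀ i, Matrix (n i) (n i) R) (D : ∀ i, n i → n i → Derivation ℂ R R') (w : Word S)

/-- The derivation along the vector field `w(M)`. -/
def flow : Derivation ℂ R R' := ∑ i, ∑ a, ∑ b, wordEval (M i) w a b • D i a b

lemma flow_apply (g : R) :
    flow M D w g = ∑ i, ∑ a, ∑ b, algebraMap R R' (wordEval (M i) w a b) * D i a b g := by
  rw [flow, derivation_sum_apply]
  refine Finset.sum_congr rfl fun i _ => ?_
  rw [derivation_sum_apply]
  refine Finset.sum_congr rfl fun a _ => ?_
  rw [derivation_sum_apply]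
  exact Finset.sum_congr rfl fun b _ => by rw [Derivation.smul_apply, Algebra.smul_def]

variable {M D}
variable (hM : ∀ i, ResolventsExist S (M i)) {Θ : R'}
  (hD : ∀ i a b, (M i).map (D i a b) = Θ • Matrix.single a b 1)
  (hD' : ∀ i j a b, j ≠ i → (M j).map (D i a b) = 0)

include hD hD' in
lemma map_flow (j : Fin d) :
    (M j).map (flow M D w) = Θ • (wordEval (M j) w).map (algebraMap R R') := by
  ext a b
  rw [Matrix.map_apply, flow_apply, Finset.sum_eq_single j]
  · have : ∀ c e, D j c e (M j a b) = Θ * Matrix.single c e 1 a b := fun c e =>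
      congrFun₂ (hD j c e) a b
    simp_rw [this]
    rw [Finset.sum_eq_single a, Finset.sum_eq_single b]
    · simp [mul_comm]
    · intro e _ he
      simp [Matrix.single_apply_of_col_ne _ _ he]
    · simp
    · intro c _ hc
      refine Finset.sum_eq_zero fun e _ => ?_
      rw [Matrix.single_apply_of_row_ne hc, mul_zero, mul_zero]
    · simp
  · intro i _ hi
    refine Finset.sum_eq_zero fun c _ => Finset.sum_eq_zero fun e _ => ?_
    have : D i c e (M j a b) = 0 := congrFun₂ (hD' i j c e hi.symm) a b
    rw [this, mul_zero]
  · simp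

include hM hD hD'

lemma flow_blockVandermonde :
    flow M D w (blockVandermonde M) = Θ * algebraMap R R'
      ((∑ i, ∑ j ∈ Finset.Iio i,
        (splitPair (M i) (M j) [] w + splitPair (M j) (M i) [] w)) * blockVandermonde M) := by
  refine derivation_prod_of_log _ Θ _ _ _ fun i _ => derivation_prod_of_log _ Θ _ _ _ fun j _ => ?_
  exact derivation_det_kronecker_sub_sq _ (hM i) (hM j) Θ w (map_flow w hD hD' i)
    (map_flow w hD hD' j)

/-- The divergence of the vector field `w(M) g`, with respect to the Vandermonde density. -/
lemma divergence_eq (g : R) :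
    ∑ i, ∑ a, ∑ b, D i a b (wordEval (M i) w a b * (blockVandermonde M * g)) =
      Θ * algebraMap R R' (evalBlocks M (splitAt [] w) * (blockVandermonde M * g)) +
        algebraMap R R' (blockVandermonde M) * flow M D w g := by
  have h1 : ∀ i, ∑ a, ∑ b, D i a b (wordEval (M i) w a b) =
      Θ * algebraMap R R' (splitPair (M i) (M i) [] w) := by
    intro i
    have := sum_map_derivation_word (D i) (hM i) Θ (hD i) [] w
    rw [← this]
    refine Finset.sum_congr rfl fun a _ => Finset.sum_congr rfl fun b _ => ?_
    have h1 : (1 : Matrix (n i) (n i) R).map (algebraMap R R') = 1 :=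
      map_one (algebraMap R R').mapMatrix
    rw [wordEval_nil, h1, one_mul, Matrix.map_apply]
  simp_rw [Derivation.leibniz (D _ _ _) (wordEval _ _ _ _), Finset.sum_add_distrib,
    ← Finset.smul_sum, h1, Algebra.smul_def, ← flow_apply]
  -- The splits inside the blocks and the splits between blocks combine into the double sum over all
  -- pairs.
  rw [Derivation.leibniz, flow_blockVandermonde w hM hD hD', evalBlocks_splitAt,
    sum_sum_eq_diag_add_Iio, ← Finset.mul_sum, Algebra.smul_def,
    Algebra.smul_def, ← map_sum]
  simp only [map_mul, map_add]
  ring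

omit hM in
lemma flow_trace_aeval (p : Polynomial ℂ) (i : Fin d) :
    flow M D w (Matrix.trace (Polynomial.aeval (M i) p)) = Θ * algebraMap R R'
      (Matrix.trace (Polynomial.aeval (M i) p.derivative * wordEval (M i) w)) := by
  rw [derivation_trace_aeval, map_flow w hD hD', Matrix.mul_smul, Matrix.trace_smul,
    ← map_algebraMap_mul, trace_map_algebraMap, smul_eq_mul]

/-- Follows the recursion of `mergeAt`: the flow replaces `D M_i` by `Θ w(M_i)`, and cyclicity of
the trace carries the frozen prefix behind the remaining letters. -/
lemma sum_trace_map_flow_word (p v : Word S) :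
    ∑ i, Matrix.trace ((wordEval (M i) p).map (algebraMap R R') *
      (wordEval (M i) v).map (flow M D w)) =
        Θ * algebraMap R R' (evalBlocks M (mergeAt w p v)) := by
  induction v generalizing p with
  | nil => simp [map_derivation_one, mergeAt]
  | cons l v ih =>
    have h1 : ∀ i, Matrix.trace ((wordEval (M i) p).map (algebraMap R R') *
        (wordEval (M i) (l :: v)).map (flow M D w)) =
        Matrix.trace ((wordEval (M i) p).map (algebraMap R R') *
          (Letter.eval (M i) l).map (flow M D w) * (wordEval (M i) v).map (algebraMap R R')) +
        Matrix.trace ((wordEval (M i) (p ++ [l])).map (algebraMap R R') *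
          (wordEval (M i) v).map (flow M D w)) := by
      intro i
      rw [← Matrix.trace_add]
      congr 1
      rw [wordEval_cons, map_derivation_mul, mul_add, wordEval_append, wordEval_singleton,
        map_algebraMap_mul, mul_assoc, mul_assoc]
    simp_rw [h1, Finset.sum_add_distrib]
    rw [ih]
    have h2 : ∀ (i : Fin d) (K L : Matrix (n i) (n i) R), Matrix.trace (K.map (algebraMap R R') *
        (M i).map (flow M D w) * L.map (algebraMap R R')) =
          Θ * algebraMap R R' (Matrix.trace (wordEval (M i) w * (L * K))) := by
      intro i K L
      rw [map_flow w hD hD', Matrix.mul_smul, Matrix.smul_mul, Matrix.trace_smul,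
        ← map_algebraMap_mul, ← map_algebraMap_mul, trace_map_algebraMap, smul_eq_mul,
        ← Matrix.mul_assoc, Matrix.trace_mul_comm (_ * L), ← Matrix.mul_assoc]
    cases l with
    | mat =>
      simp only [mergeAt, map_add, mul_add]
      congr 1
      rw [evalBlocks_tr, map_sum, Finset.mul_sum]
      refine Finset.sum_congr rfl fun i _ => ?_
      rw [wordEval_append, wordEval_append, mul_assoc (wordEval (M i) w), ← h2]
      rfl
    | res x =>
      simp only [mergeAt, map_add, mul_add]
      congr 1
      rw [evalBlocks_tr, map_sum, Finset.mul_sum]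
      refine Finset.sum_congr rfl fun i _ => ?_
      rw [List.append_assoc, wordEval_append, wordEval_append, mul_assoc (wordEval (M i) w),
        wordEval_append, wordEval_singleton, wordEval_cons, ← h2, map_derivation_resolvent _ (hM i),
        map_algebraMap_mul, map_algebraMap_mul]
      simp only [mul_assoc]

/-- Both sides are derivations in `f`, so it is enough to compare them on the traces of words. -/
lemma flow_evalBlocks (f : Observable S) :
    flow M D w (evalBlocks M f) = Θ * algebraMap R R'
      (evalBlocks M (MvPolynomial.mkDerivation ℂ (fun v => mergeAt w [] v) f)) := by
  induction f using MvPolynomial.induction_on with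
  | C a =>
    have : (MvPolynomial.C a : Observable S) = algebraMap ℂ _ a := rfl
    rw [this, Derivation.map_algebraMap, AlgHom.commutes, Derivation.map_algebraMap, map_zero,
      map_zero, mul_zero]
  | add f g hf hg => simp only [map_add, hf, hg, mul_add]
  | mul_X f v hf =>
    have h1 : flow M D w (evalBlocks M (MvPolynomial.X v)) =
        Θ * algebraMap R R' (evalBlocks M (mergeAt w [] v)) := by
      have h := evalBlocks_tr M v
      rw [tr] at h
      rw [h, map_sum, ← sum_trace_map_flow_word w hM hD hD']
      refine Finset.sum_congr rfl fun i _ => ?_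
      have h1 : (1 : Matrix (n i) (n i) R).map (algebraMap R R') = 1 :=
        map_one (algebraMap R R').mapMatrix
      rw [wordEval_nil, h1, one_mul, trace_map_derivation]
    rw [map_mul, Derivation.leibniz, Derivation.leibniz, hf, h1, MvPolynomial.mkDerivation_X,
      Algebra.smul_def, Algebra.smul_def, smul_eq_mul, smul_eq_mul, map_add, map_mul, map_mul,
      map_add, map_mul, map_mul]
    ring

end LoopAlgebra

/-! ### Functions of polynomial growth and integration by parts -/

section PolyGrowth

variable {E : Type*} [NormedAddCommGroup E] [NormedSpace ℝ E]

/-- The derivation `g ↦ ρ (∂_v g + i ∂_v' g)` on an algebra of differentiable functions. -/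
def dirDeriv (A : Subalgebra ℂ (E → ℂ)) (hA : ∀ g ∈ A, Differentiable ℝ g) (ρ : E → ℂ) (v v' : E) :
    Derivation ℂ A (E → ℂ) :=
  Derivation.mk'
    { toFun := fun g x => ρ x * (fderiv ℝ (g : E → ℂ) x v + Complex.I * fderiv ℝ (g : E → ℂ) x v')
      map_add' := fun f g => by
        funext x
        simp only [Subalgebra.coe_add, fderiv_add (hA f f.2 x) (hA g g.2 x), add_apply, Pi.add_apply]
        ring
      map_smul' := fun c f => by
        funext x
        simp only [Subalgebra.coe_smul, fderiv_const_smul (hA f f.2 x), Pi.smul_apply, smul_eq_mul,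
          RingHom.id_apply, smul_apply]
        ring }
    fun f g => by
      funext x
      simp only [LinearMap.coe_mk, AddHom.coe_mk, Subalgebra.coe_mul,
        fderiv_mul (hA f f.2 x) (hA g g.2 x), add_apply, Pi.add_apply, smul_apply, smul_eq_mul,
        Algebra.smul_def, Pi.mul_apply]
      change _ = (f : E → ℂ) x * _ + (g : E → ℂ) x * _
      ring

lemma dirDeriv_apply (A : Subalgebra ℂ (E → ℂ)) (hA : ∀ g ∈ A, Differentiable ℝ g) (ρ : E → ℂ)
    (v v' : E) (g : A) (x : E) :
    dirDeriv A hA ρ v v' g x =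
      ρ x * (fderiv ℝ (g : E → ℂ) x v + Complex.I * fderiv ℝ (g : E → ℂ) x v') := rfl

/-- A function bounded by a power of `1 + ‖x‖`. -/
def PolyBounded {F : Type*} [NormedAddCommGroup F] (g : E → F) : Prop :=
  ∃ (C : ℝ) (k : ℕ), ∀ x, ‖g x‖ ≤ C * (1 + ‖x‖) ^ k

lemma PolyBounded.of_le {F G : Type*} [NormedAddCommGroup F] [NormedAddCommGroup G] {g : E → F}
    {h : E → G} (hh : PolyBounded h) (c : ℝ) (hc : 0 ≤ c) (hg : ∀ x, ‖g x‖ ≤ c * ‖h x‖) :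
    PolyBounded g := by
  obtain ⟨C, k, hC⟩ := hh
  refine ⟨c * C, k, fun x => (hg x).trans ?_⟩
  rw [mul_assoc]
  exact mul_le_mul_of_nonneg_left (hC x) hc

lemma PolyBounded.add {F : Type*} [NormedAddCommGroup F] {g h : E → F} (hg : PolyBounded g)
    (hh : PolyBounded h) : PolyBounded fun x => g x + h x := by
  obtain ⟨C, k, hC⟩ := hg
  obtain ⟨C', k', hC'⟩ := hh
  refine ⟨|C| + |C'|, k + k', fun x => (norm_add_le _ _).trans ?_⟩
  have h1 : (1 : ℝ) ≤ 1 + ‖x‖ := by linarith [norm_nonneg x]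
  have h2 : (1 + ‖x‖) ^ k ≤ (1 + ‖x‖) ^ (k + k') := pow_le_pow_right₀ h1 (by omega)
  have h3 : (1 + ‖x‖) ^ k' ≤ (1 + ‖x‖) ^ (k + k') := pow_le_pow_right₀ h1 (by omega)
  rw [add_mul]
  refine add_le_add ((hC x).trans ?_) ((hC' x).trans ?_)
  · exact mul_le_mul (le_abs_self C) h2 (by positivity) (abs_nonneg C)
  · exact mul_le_mul (le_abs_self C') h3 (by positivity) (abs_nonneg C')

lemma PolyBounded.mul_of_le {F G H : Type*} [NormedAddCommGroup F] [NormedAddCommGroup G]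
    [NormedAddCommGroup H] {g : E → F} {h : E → G} {f : E → H} (hg : PolyBounded g)
    (hh : PolyBounded h) (hf : ∀ x, ‖f x‖ ≤ ‖g x‖ * ‖h x‖) : PolyBounded f := by
  obtain ⟨C, k, hC⟩ := hg
  obtain ⟨C', k', hC'⟩ := hh
  refine ⟨C * C', k + k', fun x => (hf x).trans ?_⟩
  calc ‖g x‖ * ‖h x‖ ≤ (C * (1 + ‖x‖) ^ k) * (C' * (1 + ‖x‖) ^ k') :=
        mul_le_mul (hC x) (hC' x) (norm_nonneg _) ((norm_nonneg _).trans (hC x))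
    _ = _ := by ring

lemma PolyBounded.const {F : Type*} [NormedAddCommGroup F] (c : F) :
    PolyBounded fun _ : E => c := ⟨‖c‖, 0, fun x => by simp⟩

variable (E) in
/-- The algebra of `C¹` functions which are, with their derivative, of polynomial growth. -/
def polyGrowth : Subalgebra ℂ (E → ℂ) where
  carrier := {g | ContDiff ℝ 1 g ∧ PolyBounded g ∧ PolyBounded (fderiv ℝ g)}
  mul_mem' := by
    rintro f g ⟨hf, hf', hf''⟩ ⟨hg, hg', hg''⟩
    refine ⟨hf.mul hg, hf'.mul_of_le hg' fun x => (norm_mul _ _).le, ?_⟩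
    have : fderiv ℝ (f * g) = fun x => f x • fderiv ℝ g x + g x • fderiv ℝ f x := by
      funext x
      exact fderiv_mul (hf.differentiable one_ne_zero x) (hg.differentiable one_ne_zero x)
    rw [this]
    exact (hf'.mul_of_le hg'' fun x => (norm_smul _ _).le).add
      (hg'.mul_of_le hf'' fun x => (norm_smul _ _).le)
  add_mem' := by
    rintro f g ⟨hf, hf', hf''⟩ ⟨hg, hg', hg''⟩
    refine ⟨hf.add hg, hf'.add hg', ?_⟩
    have : fderiv ℝ (f + g) = fun x => fderiv ℝ f x + fderiv ℝ g x := by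
      funext x
      exact fderiv_add (hf.differentiable one_ne_zero x) (hg.differentiable one_ne_zero x)
    rw [this]
    exact hf''.add hg''
  algebraMap_mem' := fun c => by
    refine ⟨contDiff_const, PolyBounded.const c, ?_⟩
    have : fderiv ℝ (algebraMap ℂ (E → ℂ) c) = fun _ => 0 := by
      funext x
      exact fderiv_const_apply c
    rw [this]
    exact PolyBounded.const 0

lemma differentiable_of_mem_polyGrowth (g : E → ℂ) (hg : g ∈ polyGrowth E) : Differentiable ℝ g :=
  hg.1.differentiable one_ne_zero

lemma clm_mem_polyGrowth (L : E →L[ℝ] ℂ) : (L : E → ℂ) ∈ polyGrowth E := by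
  refine ⟨L.contDiff, ⟨‖L‖, 1, fun x => (L.le_opNorm x).trans ?_⟩, ?_⟩
  · exact mul_le_mul_of_nonneg_left (by simp) (norm_nonneg L)
  · have : fderiv ℝ (L : E → ℂ) = fun _ => L := by
      funext x
      exact L.fderiv
    rw [this]
    exact PolyBounded.const L

/-- A uniform lower bound, and not just the absence of zeros, keeps `1/g` and `-g'/g²` of polynomial
growth. -/
lemma inv_mem_polyGrowth {g : E → ℂ} (hg : g ∈ polyGrowth E) {c : ℝ} (hc : 0 < c)
    (h : ∀ x, c ≤ ‖g x‖) : (fun x => (g x)⁻¹) ∈ polyGrowth E := by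
  have h0 : ∀ x, g x ≠ 0 := fun x => norm_pos_iff.1 (hc.trans_le (h x))
  have hb : ∀ x, ‖(g x)⁻¹‖ ≤ c⁻¹ := fun x => by
    rw [norm_inv]
    exact inv_anti₀ hc (h x)
  refine ⟨hg.1.inv h0, ⟨c⁻¹, 0, by simpa using hb⟩, ?_⟩
  have : fderiv ℝ (fun x => (g x)⁻¹) = fun x => -((g x)⁻¹ ^ 2) • fderiv ℝ g x := by
    funext x
    have h1 := ((hasDerivAt_inv (h0 x)).comp_hasFDerivAt x
      (differentiable_of_mem_polyGrowth g hg x).hasFDerivAt)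
    rw [← inv_pow] at h1
    exact h1.fderiv
  rw [this]
  refine hg.2.2.of_le (c⁻¹ ^ 2) (by positivity) fun x => ?_
  rw [norm_smul, norm_neg, norm_pow]
  gcongr
  exact hb x

/-- A function decaying faster than any power of `1 + ‖x‖`. -/
def RapidDecay (W : E → ℂ) : Prop := ∀ k : ℕ, ∃ C : ℝ, ∀ x, (1 + ‖x‖) ^ k * ‖W x‖ ≤ C

variable [FiniteDimensional ℝ E] [MeasureSpace E] [BorelSpace E]
  [(volume : Measure E).IsAddHaarMeasure]

lemma integrable_mul_rapidDecay {g W : E → ℂ} (hg : Continuous g) (hg' : PolyBounded g)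
    (hW : Continuous W) (hW' : RapidDecay W) : Integrable fun x => g x * W x := by
  obtain ⟨C, k, hC⟩ := hg'
  -- The power `k` absorbs the growth of `g`; the additional `finrank + 1` leaves an integrable
  -- power of `1 + ‖x‖`.
  obtain ⟨C', hC'⟩ := hW' (k + (Module.finrank ℝ E + 1))
  have h1 : Integrable fun x : E => C * C' * (1 + ‖x‖) ^ (-((Module.finrank ℝ E + 1 : ℕ) : ℝ)) := by
    refine (integrable_one_add_norm ?_).const_mul _
    push_cast
    linarith
  refine h1.mono' (hg.mul hW).aestronglyMeasurable (Filter.Eventually.of_forall fun x => ?_)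
  have hx : 0 < 1 + ‖x‖ := by positivity
  rw [Real.rpow_neg hx.le, Real.rpow_natCast, norm_mul, ← div_eq_mul_inv, le_div_iff₀ (by positivity)]
  have hC0 : 0 ≤ C := by
    have := (norm_nonneg _).trans (hC 0)
    simpa using this
  calc ‖g x‖ * ‖W x‖ * (1 + ‖x‖) ^ (Module.finrank ℝ E + 1)
      ≤ C * (1 + ‖x‖) ^ k * ‖W x‖ * (1 + ‖x‖) ^ (Module.finrank ℝ E + 1) := by
        gcongr
        exact hC x
    _ = C * ((1 + ‖x‖) ^ (k + (Module.finrank ℝ E + 1)) * ‖W x‖) := by ring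
    _ ≤ C * C' := mul_le_mul_of_nonneg_left (hC' x) hC0

lemma integrable_polyGrowth_mul {W : E → ℂ} (hW : Continuous W) (hW' : RapidDecay W)
    (g : polyGrowth E) : Integrable fun x => (g : E → ℂ) x * W x :=
  integrable_mul_rapidDecay g.2.1.continuous g.2.2.1 hW hW'

lemma continuous_fderiv_apply_of_mem_polyGrowth {g : E → ℂ} (hg : g ∈ polyGrowth E) (v : E) :
    Continuous fun x => fderiv ℝ g x v :=
  (hg.1.continuous_fderiv one_ne_zero).clm_apply continuous_const

lemma polyBounded_fderiv_apply {g : E → ℂ} (hg : g ∈ polyGrowth E) (v : E) :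
    PolyBounded fun x => fderiv ℝ g x v :=
  hg.2.2.of_le ‖v‖ (norm_nonneg v) fun x => by
    rw [mul_comm]
    exact ContinuousLinearMap.le_opNorm _ _

lemma integrable_fderiv_mul {W : E → ℂ} (hW : Continuous W) (hW' : RapidDecay W) {g : E → ℂ}
    (hg : g ∈ polyGrowth E) (v : E) : Integrable fun x => fderiv ℝ g x v * W x :=
  integrable_mul_rapidDecay (continuous_fderiv_apply_of_mem_polyGrowth hg v)
    (polyBounded_fderiv_apply hg v) hW hW'

/-- The weight `e^{-h}`. -/
def expWeight (h : E → ℂ) (x : E) : ℂ := Complex.exp (-h x)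

lemma contDiff_expWeight {h : E → ℂ} (hh : h ∈ polyGrowth E) : ContDiff ℝ 1 (expWeight h) :=
  (hh.1.neg).cexp

lemma integral_fderiv_mul_expWeight {g h : E → ℂ} (hg : g ∈ polyGrowth E) (hh : h ∈ polyGrowth E)
    (hW : RapidDecay (expWeight h)) (v : E) :
    ∫ x, fderiv ℝ g x v * expWeight h x = ∫ x, g x * fderiv ℝ h x v * expWeight h x := by
  have hWc := (contDiff_expWeight hh).continuous
  have hd : ∀ x, fderiv ℝ (expWeight h) x v = -(fderiv ℝ h x v * expWeight h x) := by
    intro x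
    have h1 := ((differentiable_of_mem_polyGrowth h hh x).hasFDerivAt.neg).cexp
    rw [show fderiv ℝ (expWeight h) x = _ from h1.fderiv]
    simp [expWeight, mul_comm]
  have h2 : Integrable fun x => g x * fderiv ℝ h x v * expWeight h x :=
    integrable_mul_rapidDecay (hg.1.continuous.mul (continuous_fderiv_apply_of_mem_polyGrowth hh v))
      (hg.2.1.mul_of_le (polyBounded_fderiv_apply hh v) fun x => (norm_mul _ _).le) hWc hW
  have h3 := integral_mul_fderiv_eq_neg_fderiv_mul_of_integrable (μ := (volume : Measure E))
    (v := v) (f := g) (g := expWeight h) (integrable_fderiv_mul hWc hW hg v)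
    (by simp only [hd, mul_neg, ← mul_assoc]; exact h2.neg)
    (integrable_polyGrowth_mul hWc hW ⟨g, hg⟩)
    (fun x _ => differentiable_of_mem_polyGrowth g hg x)
    (fun x _ => (contDiff_expWeight hh).differentiable one_ne_zero x)
  simp only [hd, mul_neg, integral_neg, neg_inj] at h3
  rw [← h3]
  simp only [mul_assoc]

variable (E) in
/-- The derivation `c (∂_v + i ∂_v')`. -/
abbrev polyDeriv (c : ℂ) (v v' : E) : Derivation ℂ (polyGrowth E) (E → ℂ) :=
  dirDeriv (polyGrowth E) differentiable_of_mem_polyGrowth (fun _ => c) v v'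

lemma integrable_polyDeriv_mul {W : E → ℂ} (hW : Continuous W) (hW' : RapidDecay W) (c : ℂ)
    (v v' : E) (g : polyGrowth E) : Integrable fun x => polyDeriv E c v v' g x * W x := by
  simp only [dirDeriv_apply, mul_add, add_mul, mul_assoc]
  exact ((integrable_fderiv_mul hW hW' g.2 v).const_mul c).add
    (((integrable_fderiv_mul hW hW' g.2 v').const_mul Complex.I).const_mul c)

/-- Integration by parts against the weight `e^{-h}`. -/
lemma integral_polyDeriv_mul (h : polyGrowth E) (hW : RapidDecay (expWeight (h : E → ℂ))) (c : ℂ)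
    (v v' : E) (g : polyGrowth E) :
    ∫ x, polyDeriv E c v v' g x * expWeight (h : E → ℂ) x =
      ∫ x, (g : E → ℂ) x * polyDeriv E c v v' h x * expWeight (h : E → ℂ) x := by
  have hWc := (contDiff_expWeight h.2).continuous
  have hi : ∀ u, Integrable fun x => (g : E → ℂ) x * fderiv ℝ (h : E → ℂ) x u *
      expWeight (h : E → ℂ) x := fun u =>
    integrable_mul_rapidDecay
      (g.2.1.continuous.mul (continuous_fderiv_apply_of_mem_polyGrowth h.2 u))
      (g.2.2.1.mul_of_le (polyBounded_fderiv_apply h.2 u) fun x => (norm_mul _ _).le) hWc hW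
  have e1 : ∀ x, polyDeriv E c v v' g x * expWeight (h : E → ℂ) x =
      c * (fderiv ℝ (g : E → ℂ) x v * expWeight (h : E → ℂ) x +
        Complex.I * (fderiv ℝ (g : E → ℂ) x v' * expWeight (h : E → ℂ) x)) := fun x => by
    rw [dirDeriv_apply]
    ring
  have e2 : ∀ x, (g : E → ℂ) x * polyDeriv E c v v' h x * expWeight (h : E → ℂ) x =
      c * ((g : E → ℂ) x * fderiv ℝ (h : E → ℂ) x v * expWeight (h : E → ℂ) x +
        Complex.I * ((g : E → ℂ) x * fderiv ℝ (h : E → ℂ) x v' * expWeight (h : E → ℂ) x)) :=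
    fun x => by
      rw [dirDeriv_apply]
      ring
  simp_rw [e1, e2, integral_const_mul]
  rw [integral_add (integrable_fderiv_mul hWc hW g.2 v)
      ((integrable_fderiv_mul hWc hW g.2 v').const_mul _),
    integral_add (hi v) ((hi v').const_mul _), integral_const_mul, integral_const_mul,
    integral_fderiv_mul_expWeight g.2 h.2 hW, integral_fderiv_mul_expWeight g.2 h.2 hW]

end PolyGrowth

/-! ### Integrals along an admissible path -/

section Path

variable {V : Polynomial ℂ} {c : ℂ} {γ : ℝ → ℂ}

namespace AdmissiblePath

lemma hasDerivAt (h : AdmissiblePath V c γ) (u : ℝ) : HasDerivAt γ (deriv γ u) u :=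
  (h.contDiff.differentiable one_ne_zero u).hasDerivAt

lemma continuous_deriv (h : AdmissiblePath V c γ) : Continuous (deriv γ) :=
  h.contDiff.continuous_deriv le_rfl

lemma hasDerivAt_eval (h : AdmissiblePath V c γ) (p : Polynomial ℂ) (u : ℝ) :
    HasDerivAt (fun u => p.eval (γ u)) (p.derivative.eval (γ u) * deriv γ u) u :=
  (p.hasDerivAt (γ u)).comp u (h.hasDerivAt u)

lemma hasDerivAt_exp (h : AdmissiblePath V c γ) (u : ℝ) :
    HasDerivAt (fun u => Complex.exp (-c * V.eval (γ u)))
      (Complex.exp (-c * V.eval (γ u)) * (-c * (V.derivative.eval (γ u) * deriv γ u))) u :=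
  ((h.hasDerivAt_eval V u).const_mul (-c)).cexp

lemma integrable_eval (h : AdmissiblePath V c γ) (p : Polynomial ℂ) :
    Integrable fun u : ℝ => p.eval (γ u) * Complex.exp (-c * V.eval (γ u)) * deriv γ u := by
  simp_rw [Polynomial.eval_eq_sum_range (p := p), Finset.sum_mul]
  refine integrable_finsetSum _ fun k _ => ?_
  simpa only [mul_assoc] using (h.integrable k).const_mul (p.coeff k)

/-- The derivative of `γ^k e^{-cV(γ)}` is a polynomial in `γ` times `e^{-cV(γ)} γ'`, hence
integrable, so the function has a limit at each end. The same holds for `k + 1`; as `‖γ‖` tends to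
infinity, a nonzero limit for `k` would make the function for `k + 1` unbounded. -/
lemma tendsto_zero_of_atTop_or_atBot (h : AdmissiblePath V c γ) (k : ℕ) {l : Filter ℝ}
    (hl : l = Filter.atTop ∨ l = Filter.atBot) :
    Filter.Tendsto (fun u => γ u ^ k * Complex.exp (-c * V.eval (γ u))) l (nhds 0) := by
  have hγ : Filter.Tendsto (fun u => ‖γ u‖) l Filter.atTop := by
    refine h.tendsto.mono_left ?_
    rw [cocompact_eq_atBot_atTop]
    rcases hl with rfl | rfl
    · exact le_sup_right
    · exact le_sup_left
  have hl' : l.NeBot := by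
    rcases hl with rfl | rfl <;> infer_instance
  have hlim : ∀ k : ℕ, ∃ L, Filter.Tendsto
      (fun u => γ u ^ k * Complex.exp (-c * V.eval (γ u))) l (nhds L) := by
    intro k
    have hd : ∀ u, HasDerivAt (fun u => γ u ^ k * Complex.exp (-c * V.eval (γ u)))
        ((((Polynomial.X ^ k : Polynomial ℂ).derivative -
          Polynomial.C c * V.derivative * Polynomial.X ^ k).eval (γ u)) *
            Complex.exp (-c * V.eval (γ u)) * deriv γ u) u := by
      intro u
      have h1 := (h.hasDerivAt_eval (Polynomial.X ^ k) u).mul (h.hasDerivAt_exp u)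
      have h2 : ∀ u, (Polynomial.X ^ k : Polynomial ℂ).eval (γ u) = γ u ^ k := by simp
      simp only [h2] at h1
      refine h1.congr_deriv ?_
      simp only [Polynomial.eval_sub, Polynomial.eval_mul, Polynomial.eval_C, h2]
      ring
    have hi := h.integrable_eval ((Polynomial.X ^ k : Polynomial ℂ).derivative -
      Polynomial.C c * V.derivative * Polynomial.X ^ k)
    rcases hl with rfl | rfl
    · exact ⟨_, tendsto_limUnder_of_hasDerivAt_of_integrableOn_Ioi (a := 0) (fun u _ => hd u)
        hi.integrableOn⟩
    · exact ⟨_, tendsto_limUnder_of_hasDerivAt_of_integrableOn_Iic (a := 0) (fun u _ => hd u)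
        hi.integrableOn⟩
  obtain ⟨L, hL⟩ := hlim k
  obtain ⟨L', hL'⟩ := hlim (k + 1)
  by_cases h0 : L = 0
  · rwa [h0] at hL
  · exfalso
    have h1 : Filter.Tendsto (fun u => ‖γ u‖ * ‖γ u ^ k * Complex.exp (-c * V.eval (γ u))‖) l
        Filter.atTop := hγ.atTop_mul_pos (norm_pos_iff.2 h0) hL.norm
    refine not_tendsto_nhds_of_tendsto_atTop h1 ‖L'‖ (hL'.norm.congr fun u => ?_)
    rw [← norm_mul]
    congr 1
    ring

lemma tendsto_zero (h : AdmissiblePath V c γ) (k : ℕ) :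
    Filter.Tendsto (fun u => γ u ^ k * Complex.exp (-c * V.eval (γ u))) (Filter.cocompact ℝ)
      (nhds 0) := by
  rw [cocompact_eq_atBot_atTop]
  exact (h.tendsto_zero_of_atTop_or_atBot k (Or.inr rfl)).sup
    (h.tendsto_zero_of_atTop_or_atBot k (Or.inl rfl))

lemma tendsto_one_add_norm_pow (h : AdmissiblePath V c γ) (k : ℕ) :
    Filter.Tendsto (fun u => (1 + ‖γ u‖) ^ k * ‖Complex.exp (-c * V.eval (γ u))‖)
      (Filter.cocompact ℝ) (nhds 0) := by
  have h1 : Filter.Tendsto (fun u => ∑ j ∈ Finset.range (k + 1),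
      ‖γ u ^ j * Complex.exp (-c * V.eval (γ u))‖ * (k.choose j : ℝ)) (Filter.cocompact ℝ)
        (nhds (∑ j ∈ Finset.range (k + 1), ‖(0 : ℂ)‖ * (k.choose j : ℝ))) :=
    tendsto_finsetSum _ fun j _ => (h.tendsto_zero j).norm.mul_const _
  simp only [norm_zero, zero_mul, Finset.sum_const_zero] at h1
  refine h1.congr fun u => ?_
  rw [add_comm (1 : ℝ), add_pow, Finset.sum_mul]
  refine Finset.sum_congr rfl fun j _ => ?_
  rw [norm_mul, norm_pow]
  ring

lemma continuous_exp (h : AdmissiblePath V c γ) :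
    Continuous fun u => Complex.exp (-c * V.eval (γ u)) :=
  (continuous_const.mul (V.continuous.comp h.contDiff.continuous)).cexp

lemma exists_one_add_norm_pow_le (h : AdmissiblePath V c γ) (k : ℕ) :
    ∃ C, ∀ u, (1 + ‖γ u‖) ^ k * ‖Complex.exp (-c * V.eval (γ u))‖ ≤ C := by
  have hc : Continuous fun u => (1 + ‖γ u‖) ^ k * ‖Complex.exp (-c * V.eval (γ u))‖ :=
    ((continuous_const.add h.contDiff.continuous.norm).pow k).mul h.continuous_exp.norm
  let F : ZeroAtInftyContinuousMap ℝ ℝ := ⟨⟨_, hc⟩, h.tendsto_one_add_norm_pow k⟩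
  obtain ⟨C, hC⟩ := F.toBCF.bddAbove_range_norm_comp
  exact ⟨C, fun u => (le_abs_self _).trans (hC ⟨u, rfl⟩)⟩

lemma integrable_one_add_norm_pow (h : AdmissiblePath V c γ) (k : ℕ) :
    Integrable fun u =>
      (1 + ‖γ u‖) ^ k * (‖Complex.exp (-c * V.eval (γ u))‖ * ‖deriv γ u‖) := by
  have h1 : Integrable fun u => ∑ j ∈ Finset.range (k + 1),
      ‖γ u ^ j * Complex.exp (-c * V.eval (γ u)) * deriv γ u‖ * (k.choose j : ℝ) :=
    integrable_finsetSum _ fun j _ => (h.integrable j).norm.mul_const _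
  refine h1.congr (Filter.Eventually.of_forall fun u => ?_)
  change _ = (1 + ‖γ u‖) ^ k * (‖Complex.exp (-c * V.eval (γ u))‖ * ‖deriv γ u‖)
  rw [add_comm (1 : ℝ), add_pow, Finset.sum_mul]
  refine Finset.sum_congr rfl fun j _ => ?_
  rw [norm_mul, norm_mul, norm_pow]
  ring

end AdmissiblePath

/-- `C¹` functions of the parameter, bounded with their derivative along the path by a power of
`1 + ‖γ‖`. -/
def PathGrowth (γ φ : ℝ → ℂ) : Prop :=
  ContDiff ℝ 1 φ ∧ ∃ (C : ℝ) (k : ℕ), ∀ u, ‖φ u‖ ≤ C * (1 + ‖γ u‖) ^ k ∧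
    ‖deriv φ u‖ ≤ C * (1 + ‖γ u‖) ^ k * ‖deriv γ u‖

namespace PathGrowth

lemma one (γ : ℝ → ℂ) : PathGrowth γ fun _ => 1 :=
  ⟨contDiff_const, 1, 0, fun u => by simp⟩

lemma mul {φ ψ : ℝ → ℂ} (hφ : PathGrowth γ φ) (hψ : PathGrowth γ ψ) :
    PathGrowth γ fun u => φ u * ψ u := by
  obtain ⟨h1, C, k, hC⟩ := hφ
  obtain ⟨h2, C', k', hC'⟩ := hψ
  refine ⟨h1.mul h2, 2 * (C * C'), k + k', fun u => ?_⟩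
  have e1 : ‖φ u * ψ u‖ ≤ C * C' * (1 + ‖γ u‖) ^ (k + k') := by
    rw [norm_mul]
    calc _ ≤ (C * (1 + ‖γ u‖) ^ k) * (C' * (1 + ‖γ u‖) ^ k') :=
          mul_le_mul (hC u).1 (hC' u).1 (norm_nonneg _) ((norm_nonneg _).trans (hC u).1)
      _ = _ := by ring
  refine ⟨e1.trans ?_, ?_⟩
  · have := (norm_nonneg _).trans e1
    linarith
  · have hd : deriv (fun u => φ u * ψ u) u = deriv φ u * ψ u + φ u * deriv ψ u :=
      deriv_fun_mul (h1.differentiable one_ne_zero u) (h2.differentiable one_ne_zero u)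
    rw [hd]
    refine (norm_add_le _ _).trans ?_
    rw [norm_mul, norm_mul]
    calc _ ≤ (C * (1 + ‖γ u‖) ^ k * ‖deriv γ u‖) * (C' * (1 + ‖γ u‖) ^ k') +
          (C * (1 + ‖γ u‖) ^ k) * (C' * (1 + ‖γ u‖) ^ k' * ‖deriv γ u‖) :=
          add_le_add
            (mul_le_mul (hC u).2 (hC' u).1 (norm_nonneg _) ((norm_nonneg _).trans (hC u).2))
            (mul_le_mul (hC u).1 (hC' u).2 (norm_nonneg _) ((norm_nonneg _).trans (hC u).1))
      _ = _ := by ring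

lemma self (h : AdmissiblePath V c γ) : PathGrowth γ γ :=
  ⟨h.contDiff, 1, 1, fun u => ⟨by simp, by
    rw [pow_one, one_mul]
    nlinarith [norm_nonneg (γ u), norm_nonneg (deriv γ u)]⟩⟩

lemma resolvent (h : AdmissiblePath V c γ) {x : ℂ} (hx : x ∉ Set.range γ) :
    PathGrowth γ fun u => (x - γ u)⁻¹ := by
  -- The path is proper, so its image is closed and `x` lies at a positive distance from it.
  have hcl : IsClosed (Set.range γ) := by
    have : Filter.Tendsto γ (Filter.cocompact ℝ) (Filter.cocompact ℂ) :=
      tendsto_norm_atTop_iff_cobounded.1 h.tendsto |>.trans Metric.cobounded_le_cocompact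
    exact (isProperMap_iff_tendsto_cocompact.2 ⟨h.contDiff.continuous, this⟩).isClosedMap.isClosed_range
  obtain ⟨ε, hε, hb⟩ := Metric.isOpen_iff.1 hcl.isOpen_compl x hx
  have hε' : ∀ u, ε ≤ ‖x - γ u‖ := fun u => by
    by_contra hlt
    refine hb (a := γ u) ?_ ⟨u, rfl⟩
    rw [Metric.mem_ball, dist_comm, dist_eq_norm]
    exact not_le.1 hlt
  have h0 : ∀ u, x - γ u ≠ 0 := fun u => norm_pos_iff.1 (hε.trans_le (hε' u))
  have hb' : ∀ u, ‖(x - γ u)⁻¹‖ ≤ ε⁻¹ := fun u => by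
    rw [norm_inv]
    exact inv_anti₀ hε (hε' u)
  refine ⟨(contDiff_const.sub h.contDiff).inv h0, ε⁻¹ + ε⁻¹ ^ 2, 0, fun u => ⟨?_, ?_⟩⟩
  · rw [pow_zero, mul_one]
    exact (hb' u).trans (by linarith [sq_nonneg ε⁻¹])
  · have : HasDerivAt (fun u => (x - γ u)⁻¹) ((x - γ u)⁻¹ ^ 2 * deriv γ u) u := by
      have := ((h.hasDerivAt u).const_sub x).inv (h0 u)
      refine this.congr_deriv ?_
      rw [neg_neg, inv_pow, div_eq_inv_mul]
    rw [this.deriv, norm_mul, norm_pow, pow_zero, mul_one]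
    have h1 : ‖(x - γ u)⁻¹‖ ^ 2 ≤ ε⁻¹ ^ 2 := pow_le_pow_left₀ (norm_nonneg _) (hb' u) 2
    exact mul_le_mul_of_nonneg_right (h1.trans (by linarith [inv_pos.2 hε])) (norm_nonneg _)

variable {φ : ℝ → ℂ}

lemma eval (h : AdmissiblePath V c γ) (p : Polynomial ℂ) (hφ : PathGrowth γ φ) :
    Integrable fun u => φ u * p.eval (γ u) * (Complex.exp (-c * V.eval (γ u)) * deriv γ u) := by
  obtain ⟨h1, C, k, hC⟩ := hφ
  simp_rw [Polynomial.eval_eq_sum_range (p := p), Finset.mul_sum, Finset.sum_mul]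
  refine integrable_finsetSum _ fun j _ => ?_
  refine ((h.integrable_one_add_norm_pow (k + j)).const_mul (C * ‖p.coeff j‖)).mono' ?_
    (Filter.Eventually.of_forall fun u => ?_)
  · exact ((h1.continuous.mul (continuous_const.mul (h.contDiff.continuous.pow j))).mul
      (h.continuous_exp.mul h.continuous_deriv)).aestronglyMeasurable
  · rw [norm_mul, norm_mul, norm_mul, norm_mul, norm_pow]
    have e : ‖γ u‖ ^ j ≤ (1 + ‖γ u‖) ^ j :=
      pow_le_pow_left₀ (norm_nonneg _) (by linarith) j
    calc ‖φ u‖ * (‖p.coeff j‖ * ‖γ u‖ ^ j) *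
          (‖Complex.exp (-c * V.eval (γ u))‖ * ‖deriv γ u‖)
        ≤ C * (1 + ‖γ u‖) ^ k * (‖p.coeff j‖ * (1 + ‖γ u‖) ^ j) *
          (‖Complex.exp (-c * V.eval (γ u))‖ * ‖deriv γ u‖) := by
          refine mul_le_mul_of_nonneg_right (mul_le_mul (hC u).1
            (mul_le_mul_of_nonneg_left e (norm_nonneg _)) (by positivity)
            ((norm_nonneg _).trans (hC u).1)) (by positivity)
      _ = _ := by ring

lemma integrable (h : AdmissiblePath V c γ) (hφ : PathGrowth γ φ) :
    Integrable fun u => φ u * (Complex.exp (-c * V.eval (γ u)) * deriv γ u) := by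
  simpa using hφ.eval h 1

/-- The factor `‖γ'‖` in the bound on `φ'` is essential: integrability is assumed for `γ^k
e^{-cV(γ)} γ'`, and not without `γ'`. -/
lemma integrable_deriv (h : AdmissiblePath V c γ) (hφ : PathGrowth γ φ) :
    Integrable fun u => deriv φ u * Complex.exp (-c * V.eval (γ u)) := by
  obtain ⟨h1, C, k, hC⟩ := hφ
  refine ((h.integrable_one_add_norm_pow k).const_mul C).mono' ?_
    (Filter.Eventually.of_forall fun u => ?_)
  · exact ((h1.continuous_deriv le_rfl).mul h.continuous_exp).aestronglyMeasurable
  · rw [norm_mul]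
    calc _ ≤ C * (1 + ‖γ u‖) ^ k * ‖deriv γ u‖ * ‖Complex.exp (-c * V.eval (γ u))‖ :=
          mul_le_mul_of_nonneg_right (hC u).2 (norm_nonneg _)
      _ = _ := by ring

/-- Integration by parts along an admissible path. -/
lemma integral_deriv_mul (h : AdmissiblePath V c γ) (hφ : PathGrowth γ φ) :
    ∫ u, deriv φ u * Complex.exp (-c * V.eval (γ u)) =
      ∫ u, φ u * (Polynomial.C c * V.derivative).eval (γ u) *
        (Complex.exp (-c * V.eval (γ u)) * deriv γ u) := by
  have hi := hφ.eval h (Polynomial.C c * V.derivative)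
  have hi' := hφ.integrable_deriv h
  rw [← sub_eq_zero, ← integral_sub hi' hi]
  obtain ⟨h1, C, k, hC⟩ := hφ
  have hd : ∀ u, HasDerivAt (fun u => φ u * Complex.exp (-c * V.eval (γ u)))
      (deriv φ u * Complex.exp (-c * V.eval (γ u)) - φ u * (Polynomial.C c * V.derivative).eval (γ u) *
        (Complex.exp (-c * V.eval (γ u)) * deriv γ u)) u := by
    intro u
    refine ((h1.differentiable one_ne_zero u).hasDerivAt.mul (h.hasDerivAt_exp u)).congr_deriv ?_
    simp only [Polynomial.eval_mul, Polynomial.eval_C]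
    ring
  -- The boundary terms: `φ` grows at most like a power of `1 + ‖γ‖`, which the exponential beats.
  have ht : Filter.Tendsto (fun u => φ u * Complex.exp (-c * V.eval (γ u)))
      (Filter.cocompact ℝ) (nhds 0) := by
    have h0 := (h.tendsto_one_add_norm_pow k).const_mul C
    rw [mul_zero] at h0
    refine squeeze_zero_norm (fun u => ?_) h0
    rw [norm_mul, ← mul_assoc]
    exact mul_le_mul_of_nonneg_right (hC u).1 (norm_nonneg _)
  rw [cocompact_eq_atBot_atTop, Filter.tendsto_sup] at ht
  rw [integral_of_hasDerivAt_of_tendsto hd (hi'.sub hi) ht.1 ht.2, sub_zero]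

end PathGrowth

end Path

/-! ### Integrals over products of paths -/

section PathAlgebra

variable {N : ℕ} {V : Polynomial ℂ} {κ : ℂ} {g : Fin N → ℝ → ℂ}

/-- The algebra generated by the functions of polynomial growth in a single eigenvalue. -/
def pathAlgebra (g : Fin N → ℝ → ℂ) : Subalgebra ℂ ((Fin N → ℝ) → ℂ) :=
  Algebra.adjoin ℂ {f | ∃ a φ, PathGrowth (g a) φ ∧ f = fun u => φ (u a)}

lemma comp_eval_mem_pathAlgebra {a : Fin N} {φ : ℝ → ℂ} (hφ : PathGrowth (g a) φ) :
    (fun u : Fin N → ℝ => φ (u a)) ∈ pathAlgebra g :=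
  Algebra.subset_adjoin ⟨a, φ, hφ, rfl⟩

/-- The algebra is spanned by products of functions of one variable each, and these can be gathered
into one factor per variable because `PathGrowth` is stable under products. Statements about
integrals thereby reduce to one dimension by Fubini. -/
lemma mem_pathAlgebra_induction {P : ((Fin N → ℝ) → ℂ) → Prop}
    (prod : ∀ φ : Fin N → ℝ → ℂ, (∀ a, PathGrowth (g a) (φ a)) → P fun u => ∏ a, φ a (u a))
    (zero : P 0) (add : ∀ f h, f ∈ pathAlgebra g → h ∈ pathAlgebra g → P f → P h → P (f + h))
    (smul : ∀ (c : ℂ) f, f ∈ pathAlgebra g → P f → P (c • f)) {f : (Fin N → ℝ) → ℂ}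
    (hf : f ∈ pathAlgebra g) : P f := by
  have hm : ∀ f, f ∈ Submodule.span ℂ (Submonoid.closure
      {f : (Fin N → ℝ) → ℂ | ∃ a φ, PathGrowth (g a) φ ∧ f = fun u => φ (u a)} : Set _) ↔
      f ∈ pathAlgebra g := by
    intro f
    rw [← Algebra.adjoin_eq_span]
    rfl
  rw [← hm] at hf
  induction hf using Submodule.span_induction with
  | mem f hf =>
    suffices h : ∃ φ : Fin N → ℝ → ℂ, (∀ a, PathGrowth (g a) (φ a)) ∧
        f = fun u => ∏ a, φ a (u a) by
      obtain ⟨φ, hφ, rfl⟩ := h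
      exact prod φ hφ
    induction hf using Submonoid.closure_induction with
    | mem f hf =>
      obtain ⟨a, φ, hφ, rfl⟩ := hf
      refine ⟨fun b => if b = a then φ else fun _ => 1, fun b => ?_, ?_⟩
      · dsimp only
        split_ifs with h
        · rw [h]
          exact hφ
        · exact PathGrowth.one _
      · funext u
        rw [Finset.prod_eq_single a (fun b _ hb => by simp [hb]) (by simp)]
        simp
    | one => exact ⟨fun _ _ => 1, fun _ => PathGrowth.one _, by funext u; simp⟩
    | mul f h _ _ hf hh =>
      obtain ⟨φ, hφ, rfl⟩ := hf
      obtain ⟨ψ, hψ, rfl⟩ := hh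
      exact ⟨fun a u => φ a u * ψ a u, fun a => (hφ a).mul (hψ a), by
        funext u; simp [Finset.prod_mul_distrib]⟩
  | zero => exact zero
  | add f h hf hh hf' hh' => exact add f h ((hm f).1 hf) ((hm h).1 hh) hf' hh'
  | smul c f hf hf' => exact smul c f ((hm f).1 hf) hf'

lemma hasFDerivAt_comp_eval {φ : ℝ → ℂ} (hφ : Differentiable ℝ φ) (a : Fin N) (u : Fin N → ℝ) :
    HasFDerivAt (fun u : Fin N → ℝ => φ (u a))
      ((ContinuousLinearMap.proj (R := ℝ) (φ := fun _ : Fin N => ℝ) a).smulRight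
        (deriv φ (u a))) u := by
  have h := (hφ (u a)).hasDerivAt.hasFDerivAt.comp u
    (ContinuousLinearMap.proj (R := ℝ) (φ := fun _ : Fin N => ℝ) a).hasFDerivAt
  refine h.congr_fderiv ?_
  ext v
  simp

lemma hasFDerivAt_prod_comp_eval {φ : Fin N → ℝ → ℂ} (hφ : ∀ a, Differentiable ℝ (φ a))
    (u : Fin N → ℝ) :
    HasFDerivAt (fun u : Fin N → ℝ => ∏ a, φ a (u a))
      (∑ a, (∏ b ∈ Finset.univ.erase a, φ b (u b)) •
        (ContinuousLinearMap.proj (R := ℝ) (φ := fun _ : Fin N => ℝ) a).smulRight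
          (deriv (φ a) (u a))) u :=
  HasFDerivAt.finsetProd fun a _ => hasFDerivAt_comp_eval (hφ a) a u

lemma differentiable_of_mem_pathAlgebra (f : (Fin N → ℝ) → ℂ) (hf : f ∈ pathAlgebra g) :
    Differentiable ℝ f := by
  refine mem_pathAlgebra_induction (fun φ hφ u => ?_) (differentiable_const 0)
    (fun f h _ _ hf hh => hf.add hh) (fun c f _ hf => hf.const_smul c) hf
  exact (hasFDerivAt_prod_comp_eval
    (fun a => (hφ a).1.differentiable one_ne_zero) u).differentiableAt

/-- The derivative with respect to the eigenvalue `x_a = g a (u a)`, times `∏_b dx_b / du_b`. -/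
def pathDeriv (g : Fin N → ℝ → ℂ) (a : Fin N) :
    Derivation ℂ (pathAlgebra g) ((Fin N → ℝ) → ℂ) :=
  dirDeriv (pathAlgebra g) differentiable_of_mem_pathAlgebra
    (fun u => ∏ b ∈ Finset.univ.erase a, deriv (g b) (u b)) (Pi.single a 1) 0

/-- The density `∏_b dx_b / du_b`. -/
def pathJacobian (g : Fin N → ℝ → ℂ) (u : Fin N → ℝ) : ℂ := ∏ b, deriv (g b) (u b)

/-- The chain rule for `∂/∂x_a` would divide by `dx_a/du_a`, which may vanish. Multiplying by the
whole density `∏ dx_b/du_b` leaves only the product over `b ≠ a`. -/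
lemma pathDeriv_comp_eval {φ : ℝ → ℂ} (b : Fin N) (hφ : PathGrowth (g b) φ) (a : Fin N)
    (u : Fin N → ℝ) :
    pathDeriv g a ⟨fun u => φ (u b), comp_eval_mem_pathAlgebra hφ⟩ u =
      if a = b then (∏ b ∈ Finset.univ.erase a, deriv (g b) (u b)) * deriv φ (u a) else 0 := by
  rw [pathDeriv, dirDeriv_apply, map_zero, mul_zero, add_zero,
    (hasFDerivAt_comp_eval (hφ.1.differentiable one_ne_zero) b u).fderiv]
  split_ifs with h
  · subst h
    simp
  · simp [Ne.symm h]

/-- The Boltzmann weight of the eigenvalues. -/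
def pathWeight (V : Polynomial ℂ) (κ : ℂ) (g : Fin N → ℝ → ℂ) (u : Fin N → ℝ) : ℂ :=
  ∏ a, Complex.exp (-κ * V.eval (g a (u a)))

variable (hg : ∀ a, AdmissiblePath V κ (g a))

include hg

lemma integrable_pathAlgebra_mul (f : pathAlgebra g) :
    Integrable fun u => (f : (Fin N → ℝ) → ℂ) u * (pathWeight V κ g u * pathJacobian g u) := by
  refine mem_pathAlgebra_induction (P := fun f => Integrable fun u =>
    f u * (pathWeight V κ g u * pathJacobian g u)) (fun φ hφ => ?_) ?_ (fun f h _ _ hf hh => ?_)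
    (fun c f _ hf => ?_) f.2
  · have := Integrable.fintype_prod (μ := fun _ : Fin N => (volume : Measure ℝ))
      fun a => (hφ a).integrable (hg a)
    simp only [Finset.prod_mul_distrib] at this
    exact this
  · simp
  · simpa only [Pi.add_apply, add_mul] using! hf.add hh
  · simpa only [Pi.smul_apply, smul_eq_mul, mul_assoc] using! hf.const_mul c

/-- Integration by parts in the eigenvalue `x_a`. -/
lemma integrable_and_integral_pathDeriv_mul (a : Fin N) (f : pathAlgebra g) :
    (Integrable fun u => pathDeriv g a f u * pathWeight V κ g u) ∧
    (Integrable fun u => (f : (Fin N → ℝ) → ℂ) u *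
        (Polynomial.C κ * V.derivative).eval (g a (u a)) *
          (pathWeight V κ g u * pathJacobian g u)) ∧
    ∫ u, pathDeriv g a f u * pathWeight V κ g u =
      ∫ u, (f : (Fin N → ℝ) → ℂ) u * (Polynomial.C κ * V.derivative).eval (g a (u a)) *
        (pathWeight V κ g u * pathJacobian g u) := by
  obtain ⟨f, hf⟩ := f
  -- Membership becomes part of the statement, since `pathDeriv` is defined only on the subalgebra
  -- while the induction runs over bare functions.
  suffices h : ∃ hf : f ∈ pathAlgebra g,
      (Integrable fun u => pathDeriv g a ⟨f, hf⟩ u * pathWeight V κ g u) ∧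
      (Integrable fun u => f u * (Polynomial.C κ * V.derivative).eval (g a (u a)) *
          (pathWeight V κ g u * pathJacobian g u)) ∧
      ∫ u, pathDeriv g a ⟨f, hf⟩ u * pathWeight V κ g u =
        ∫ u, f u * (Polynomial.C κ * V.derivative).eval (g a (u a)) *
          (pathWeight V κ g u * pathJacobian g u) by
    obtain ⟨_, h⟩ := h
    exact h
  refine mem_pathAlgebra_induction (P := fun f => ∃ hf : f ∈ pathAlgebra g,
      (Integrable fun u => pathDeriv g a ⟨f, hf⟩ u * pathWeight V κ g u) ∧
      (Integrable fun u => f u * (Polynomial.C κ * V.derivative).eval (g a (u a)) *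
          (pathWeight V κ g u * pathJacobian g u)) ∧
      ∫ u, pathDeriv g a ⟨f, hf⟩ u * pathWeight V κ g u =
        ∫ u, f u * (Polynomial.C κ * V.derivative).eval (g a (u a)) *
          (pathWeight V κ g u * pathJacobian g u)) (fun φ hφ => ?_) ?_ ?_ ?_ hf
  · have hmem : (fun u : Fin N → ℝ => ∏ a, φ a (u a)) ∈ pathAlgebra g := by
      have : (fun u : Fin N → ℝ => ∏ a, φ a (u a)) = ∏ a, fun u : Fin N → ℝ => φ a (u a) := by
        funext u
        simp
      rw [this]
      exact prod_mem fun a _ => comp_eval_mem_pathAlgebra (hφ a)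
    -- The one-variable factors of the two integrands `∏ ψ_b` and `∏ χ_b`. They differ only at `b =
    -- a`, where integration by parts on a single path equates their integrals.
    let ψ : Fin N → ℝ → ℂ := fun b s =>
      if b = a then deriv (φ b) s * Complex.exp (-κ * V.eval (g b s))
      else φ b s * (Complex.exp (-κ * V.eval (g b s)) * deriv (g b) s)
    let χ : Fin N → ℝ → ℂ := fun b s =>
      if b = a then φ b s * (Polynomial.C κ * V.derivative).eval (g b s) *
        (Complex.exp (-κ * V.eval (g b s)) * deriv (g b) s)
      else φ b s * (Complex.exp (-κ * V.eval (g b s)) * deriv (g b) s)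
    have hψ : ∀ b, Integrable (ψ b) := fun b => by
      by_cases h : b = a
      · simpa only [ψ, h, if_true] using (hφ a).integrable_deriv (hg a)
      · simpa only [ψ, h, if_false] using (hφ b).integrable (hg b)
    have hχ : ∀ b, Integrable (χ b) := fun b => by
      by_cases h : b = a
      · simpa only [χ, h, if_true] using (hφ a).eval (hg a) _
      · simpa only [χ, h, if_false] using (hφ b).integrable (hg b)
    have hψχ : ∀ b, ∫ s, ψ b s = ∫ s, χ b s := fun b => by
      by_cases h : b = a
      · simpa only [ψ, χ, h, if_true] using (hφ a).integral_deriv_mul (hg a)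
      · simp only [ψ, χ, h, if_false]
    have e1 : ∀ u, pathDeriv g a ⟨_, hmem⟩ u * pathWeight V κ g u = ∏ b, ψ b (u b) := by
      intro u
      rw [pathDeriv, dirDeriv_apply, map_zero, mul_zero, add_zero,
        (hasFDerivAt_prod_comp_eval (fun a => (hφ a).1.differentiable one_ne_zero) u).fderiv,
        sum_apply, Finset.sum_eq_single a, pathWeight,
        ← Finset.mul_prod_erase _ _ (Finset.mem_univ a),
        ← Finset.mul_prod_erase _ (fun b => ψ b (u b)) (Finset.mem_univ a),
        Finset.prod_congr rfl (g := fun b => φ b (u b) *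
          (Complex.exp (-κ * V.eval (g b (u b))) * deriv (g b) (u b)))
          (fun b hb => if_neg (Finset.ne_of_mem_erase hb)), Finset.prod_mul_distrib,
        Finset.prod_mul_distrib, show ψ a (u a) = _ from if_pos rfl]
      · simp
        ring
      · intro b _ hb
        simp [hb]
      · simp
    have e2 : ∀ u : Fin N → ℝ, (∏ a, φ a (u a)) *
        (Polynomial.C κ * V.derivative).eval (g a (u a)) *
          (pathWeight V κ g u * pathJacobian g u) = ∏ b, χ b (u b) := by
      intro u
      rw [← Finset.mul_prod_erase _ (fun b => χ b (u b)) (Finset.mem_univ a),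
        Finset.prod_congr rfl (g := fun b => φ b (u b) *
          (Complex.exp (-κ * V.eval (g b (u b))) * deriv (g b) (u b)))
          (fun b hb => if_neg (Finset.ne_of_mem_erase hb)), show χ a (u a) = _ from if_pos rfl,
        pathWeight, pathJacobian, ← Finset.prod_mul_distrib,
        ← Finset.mul_prod_erase _ _ (Finset.mem_univ a),
        ← Finset.mul_prod_erase _ (fun b => Complex.exp (-κ * V.eval (g b (u b))) *
          deriv (g b) (u b)) (Finset.mem_univ a)]
      simp only [Finset.prod_mul_distrib]
      ring
    refine ⟨hmem, ?_, ?_, ?_⟩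
    · simp_rw [e1]
      exact Integrable.fintype_prod hψ
    · simp_rw [e2]
      exact Integrable.fintype_prod hχ
    · simp_rw [e1, e2]
      rw [integral_fintype_prod_volume_eq_prod, integral_fintype_prod_volume_eq_prod]
      simp_rw [hψχ]
  · refine ⟨zero_mem _, ?_⟩
    have : pathDeriv g a ⟨0, zero_mem _⟩ = 0 := map_zero _
    simp [this]
  · rintro f h - - ⟨hf, f1, f2, f3⟩ ⟨hh, h1, h2, h3⟩
    have e : pathDeriv g a ⟨f + h, add_mem hf hh⟩ =
        pathDeriv g a ⟨f, hf⟩ + pathDeriv g a ⟨h, hh⟩ := map_add _ (⟨f, hf⟩ : pathAlgebra g) ⟨h, hh⟩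
    refine ⟨add_mem hf hh, ?_, ?_, ?_⟩
    · simpa only [e, Pi.add_apply, add_mul] using! f1.add h1
    · simpa only [Pi.add_apply, add_mul] using! f2.add h2
    · simp only [e, Pi.add_apply, add_mul]
      rw [integral_add f1 h1, integral_add f2 h2, f3, h3]
  · rintro c f - ⟨hf, f1, f2, f3⟩
    have e : pathDeriv g a ⟨c • f, Subalgebra.smul_mem _ hf c⟩ = c • pathDeriv g a ⟨f, hf⟩ :=
      Derivation.map_smul _ c (⟨f, hf⟩ : pathAlgebra g)
    refine ⟨Subalgebra.smul_mem _ hf c, ?_, ?_, ?_⟩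
    · simpa only [e, Pi.smul_apply, smul_eq_mul, mul_assoc] using! f1.const_mul c
    · simpa only [Pi.smul_apply, smul_eq_mul, mul_assoc] using! f2.const_mul c
    · simp only [e, Pi.smul_apply, smul_eq_mul, mul_assoc c]
      rw [integral_const_mul, integral_const_mul, f3]

end PathAlgebra

/-! ### Loop equations for convergent integrals over paths -/

section Diagonal

variable {N : ℕ}

lemma trace_wordEval_diagonal {x : Fin N → ℂ}
    (h : ∀ a, ResolventsExist S (Matrix.of fun _ _ : Unit => x a)) (w : Word S) :
    wordEval (Matrix.diagonal x) w =
      Matrix.diagonal fun a => wordEval (Matrix.of fun _ _ : Unit => x a) w () () := by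
  induction w with
  | nil => simp
  | cons l w ih =>
    have hl : Letter.eval (Matrix.diagonal x) l =
        Matrix.diagonal fun a => Letter.eval (Matrix.of fun _ _ : Unit => x a) l () () := by
      cases l with
      | mat => rfl
      | res y =>
        refine Matrix.inv_eq_left_inv ?_
        have h1 : algebraMap ℂ (Matrix (Fin N) (Fin N) ℂ) y = Matrix.diagonal fun _ => (y : ℂ) :=
          rfl
        rw [h1, Matrix.diagonal_sub, Matrix.diagonal_mul_diagonal, ← Matrix.diagonal_one]
        congr 1
        funext a
        have := congrFun₂ ((h a).inv_mul y) () ()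
        rw [Matrix.mul_apply, Finset.univ_unique, Finset.sum_singleton] at this
        have e : (algebraMap ℂ (Matrix Unit Unit ℂ) y - (Matrix.of fun _ _ => x a :
            Matrix Unit Unit ℂ)) () () = y - x a := by
          simp [Matrix.algebraMap_matrix_apply]
        rw [show (default : Unit) = () from rfl, e] at this
        exact this
    rw [wordEval_cons, ih, hl, Matrix.diagonal_mul_diagonal]
    congr 1
    funext a
    simp only [wordEval_cons, Matrix.mul_apply, Finset.univ_unique, Finset.sum_singleton]

lemma evalAt_diagonal {x : Fin N → ℂ}
    (h : ∀ a, ResolventsExist S (Matrix.of fun _ _ : Unit => x a)) (f : Observable S) :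
    evalAt (Matrix.diagonal x) f = evalBlocks (fun a => Matrix.of fun _ _ : Unit => x a) f := by
  rw [evalAt, evalBlocks]
  congr 2
  funext w
  change Matrix.trace (wordEval (Matrix.diagonal x) w) = _
  rw [trace_wordEval_diagonal h, Matrix.trace_diagonal]
  simp [Matrix.trace]

lemma blockVandermonde_unit {R : Type*} [CommRing R] (x : Fin N → R) :
    blockVandermonde (fun a => Matrix.of fun _ _ : Unit => x a) =
      ∏ a, ∏ b ∈ Finset.Ioi a, (x a - x b) ^ 2 := by
  rw [blockVandermonde, Finset.prod_comm' (s' := fun a => Finset.Ioi a) (t' := Finset.univ)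
    (by simp)]
  refine Finset.prod_congr rfl fun a _ => Finset.prod_congr rfl fun b _ => ?_
  rw [Matrix.det_eq_elem_of_subsingleton _ ((), ())]
  simp only [Matrix.sub_apply, Matrix.kronecker_apply, Matrix.of_apply, Matrix.one_apply_eq]
  ring

end Diagonal

section Contour

variable {N : ℕ} {V : Polynomial ℂ} {κ : ℂ} {g : Fin N → ℝ → ℂ}
variable (hg : ∀ a, AdmissiblePath V κ (g a))

/-- The eigenvalues, as elements of the algebra of functions on the product of the paths. -/
def pathEigenvalue (a : Fin N) : pathAlgebra g :=
  ⟨fun u => g a (u a), comp_eval_mem_pathAlgebra (PathGrowth.self (hg a))⟩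

/-- The eigenvalues, as `1 × 1` blocks. -/
def pathBlock (a : Fin N) : Matrix Unit Unit (pathAlgebra g) :=
  Matrix.of fun _ _ => pathEigenvalue hg a

/-- Invertibility is required in `pathAlgebra g` and not only pointwise; this holds because `(x -
γ)⁻¹` is again of controlled growth along the path. -/
lemma resolventsExist_pathBlock (hS : ∀ x ∈ S, ∀ a, x ∉ Set.range (g a)) (a : Fin N) :
    ResolventsExist S (pathBlock hg a) := by
  intro x hx
  let r : pathAlgebra g :=
    ⟨_, comp_eval_mem_pathAlgebra (PathGrowth.resolvent (hg a) (hS x hx a))⟩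
  rw [Matrix.isUnit_iff_isUnit_det, Matrix.det_unique]
  refine IsUnit.of_mul_eq_one r ?_
  refine Subtype.ext (funext fun u => ?_)
  have : x - g a (u a) ≠ 0 := fun h => hS x hx a ⟨u a, (sub_eq_zero.1 h).symm⟩
  exact mul_inv_cancel₀ this

/-- Evaluation at a point of the product of the paths. -/
def pathEval (g : Fin N → ℝ → ℂ) (u : Fin N → ℝ) : pathAlgebra g →ₐ[ℂ] ℂ :=
  (Pi.evalAlgHom ℂ (fun _ : Fin N → ℝ => ℂ) u).comp (pathAlgebra g).val

lemma pathEval_apply (u : Fin N → ℝ) (f : pathAlgebra g) :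
    pathEval g u f = (f : (Fin N → ℝ) → ℂ) u := rfl

lemma map_pathBlock (u : Fin N → ℝ) (a : Fin N) :
    (pathBlock hg a).map (pathEval g u) = Matrix.of fun _ _ : Unit => g a (u a) := rfl

lemma evalAt_diagonal_path (hS : ∀ x ∈ S, ∀ a, x ∉ Set.range (g a)) (f : Observable S)
    (u : Fin N → ℝ) :
    (∏ a, ∏ b ∈ Finset.Ioi a, (g a (u a) - g b (u b)) ^ 2) *
      evalAt (Matrix.diagonal fun a => g a (u a)) f =
      ((blockVandermonde (pathBlock hg) * evalBlocks (pathBlock hg) f : pathAlgebra g) :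
        (Fin N → ℝ) → ℂ) u := by
  have hr := resolventsExist_pathBlock hg hS
  rw [← pathEval_apply, map_mul, map_evalBlocks hr, evalAt_diagonal fun a => by
    simpa only [map_pathBlock] using (hr a).map (pathEval g u)]
  congr 1
  change _ = pathEval g u (blockVandermonde fun a => Matrix.of fun _ _ => pathEigenvalue hg a)
  rw [blockVandermonde_unit, map_prod]
  refine Finset.prod_congr rfl fun a _ => ?_
  rw [map_prod]
  rfl

/-- The integral of an observable over a product of admissible paths. -/
def pathIntegral (f : Observable S) : ℂ :=
  ∫ u, ((blockVandermonde (pathBlock hg) * evalBlocks (pathBlock hg) f : pathAlgebra g) :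
    (Fin N → ℝ) → ℂ) u * (pathWeight V κ g u * pathJacobian g u)

/-- The input of `divergence_eq` for eigenvalues, with `Θ = ∏ dx_b/du_b`. -/
lemma map_pathDeriv_pathBlock (a : Fin N) (i j : Unit) :
    (pathBlock hg a).map (pathDeriv g a) = pathJacobian g • Matrix.single i j 1 := by
  ext _ _ u
  refine (pathDeriv_comp_eval a (PathGrowth.self (hg a)) a u).trans ?_
  rw [if_pos rfl, Finset.prod_erase_mul _ _ (Finset.mem_univ a)]
  simp [pathJacobian]

lemma map_pathDeriv_pathBlock_of_ne {a b : Fin N} (h : b ≠ a) :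
    (pathBlock hg b).map (pathDeriv g a) = 0 := by
  ext _ _ u
  exact (pathDeriv_comp_eval b (PathGrowth.self (hg b)) a u).trans (if_neg h.symm)

/-- Integrate by parts in each `x_a` against the field `G a = w(x_a) Δ² f` and sum over `a`. The
derivatives add up to the Jacobian by `divergence_eq`, and the derivatives of the weight to `κ Tr
V'(M) w(M)`, times `Δ² f`. -/
lemma pathIntegral_loop (hS : ∀ x ∈ S, ∀ a, x ∉ Set.range (g a)) (w : Word S)
    (f : Observable S) :
    κ * pathIntegral hg (trPolyMul V.derivative (Finsupp.single w f)) =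
      pathIntegral hg (jacobian (Finsupp.single w f)) := by
  set M := pathBlock hg
  have hM := resolventsExist_pathBlock hg hS
  have hdiv := divergence_eq (M := M) (D := fun a _ _ => pathDeriv g a) w hM
    (fun a i j => map_pathDeriv_pathBlock hg a i j)
    (fun a b _ _ h => map_pathDeriv_pathBlock_of_ne hg h) (evalBlocks M f)
  rw [flow_evalBlocks w hM (fun a i j => map_pathDeriv_pathBlock hg a i j)
    (fun a b _ _ h => map_pathDeriv_pathBlock_of_ne hg h)] at hdiv
  let G : Fin N → pathAlgebra g := fun a =>
    wordEval (M a) w () () * (blockVandermonde M * evalBlocks M f)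
  have hIBP := fun a => integrable_and_integral_pathDeriv_mul hg a (G a)
  have e1 : ∀ u, ∑ a, pathDeriv g a (G a) u * pathWeight V κ g u =
      ((blockVandermonde M * evalBlocks M (jacobian (Finsupp.single w f)) : pathAlgebra g) :
        (Fin N → ℝ) → ℂ) u * (pathWeight V κ g u * pathJacobian g u) := by
    intro u
    have h := congrFun hdiv u
    simp only [Finset.univ_unique, Finset.sum_singleton] at h
    have hA : ∀ X : pathAlgebra g, algebraMap (pathAlgebra g) ((Fin N → ℝ) → ℂ) X u =
        pathEval g u X := fun _ => rfl
    rw [Finset.sum_apply, show (default : Unit) = () from rfl, Pi.add_apply, Pi.mul_apply,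
      Pi.mul_apply, Pi.mul_apply, hA, hA, hA] at h
    rw [← Finset.sum_mul, h, jacobian_single, ← pathEval_apply]
    simp only [map_mul, map_add]
    ring
  have e2 : ∀ u, ∑ a, (G a : (Fin N → ℝ) → ℂ) u *
      (Polynomial.C κ * V.derivative).eval (g a (u a)) *
        (pathWeight V κ g u * pathJacobian g u) =
      κ * (((blockVandermonde M * evalBlocks M (trPolyMul V.derivative (Finsupp.single w f)) :
        pathAlgebra g) : (Fin N → ℝ) → ℂ) u * (pathWeight V κ g u * pathJacobian g u)) := by
    intro u
    rw [evalBlocks_trPolyMul_single]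
    have h1 : ∀ a, Matrix.trace (Polynomial.aeval (M a) V.derivative * wordEval (M a) w) =
        Polynomial.aeval (pathEigenvalue hg a) V.derivative * wordEval (M a) w () () := by
      intro a
      have h2 : M a = algebraMap (pathAlgebra g) _ (pathEigenvalue hg a) := by
        ext
        simp [M, pathBlock, Matrix.algebraMap_matrix_apply]
      rw [Matrix.trace, Finset.univ_unique, Finset.sum_singleton, Matrix.diag_apply,
        Matrix.mul_apply, Finset.univ_unique, Finset.sum_singleton]
      congr 1
      rw [h2, Polynomial.aeval_algebraMap_apply]
      simp [Matrix.algebraMap_matrix_apply]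
    have h3 : ∀ a, pathEval g u (Polynomial.aeval (pathEigenvalue hg a) V.derivative) =
        V.derivative.eval (g a (u a)) := by
      intro a
      rw [← Polynomial.aeval_algHom_apply, ← Polynomial.coe_aeval_eq_eval]
      rfl
    simp_rw [h1, ← pathEval_apply]
    simp only [G, map_mul, map_sum, h3, Polynomial.eval_mul, Polynomial.eval_C]
    rw [Finset.mul_sum, Finset.mul_sum, Finset.sum_mul, Finset.mul_sum]
    exact Finset.sum_congr rfl fun a _ => by ring
  rw [pathIntegral, pathIntegral, ← integral_const_mul,
    ← integral_congr_ae (Filter.Eventually.of_forall e1),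
    ← integral_congr_ae (Filter.Eventually.of_forall e2), integral_finsetSum _ fun a _ => (hIBP a).1, integral_finsetSum _ fun a _ => (hIBP a).2.1]
  exact Finset.sum_congr rfl fun a _ => (hIBP a).2.2.symm

lemma pathIntegral_add (f h : Observable S) :
    pathIntegral hg (f + h) = pathIntegral hg f + pathIntegral hg h := by
  rw [pathIntegral, pathIntegral, pathIntegral,
    ← integral_add (integrable_pathAlgebra_mul hg _) (integrable_pathAlgebra_mul hg _)]
  congr 1
  funext u
  rw [map_add, mul_add]
  exact add_mul _ _ _

end Contour

/-! ### Fixed filling fractions and combinations of paths -/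

section Filling

variable {d N : ℕ} {V : Polynomial ℂ} {t : ℂ} {γ : Fin d → ℝ → ℂ}

lemma notMem_range_of_mem_compl (c : Fin N → Fin d) :
    ∀ x ∈ (⋃ i, Set.range (γ i))ᶜ, ∀ a, x ∉ Set.range (γ (c a)) :=
  fun _ hx a h => hx (Set.mem_iUnion.2 ⟨c a, h⟩)

lemma contourIntegrand_eq (hγ : ∀ i, AdmissiblePath V ((N : ℂ) / t) (γ i)) (c : Fin N → Fin d)
    (f : Observable (⋃ i, Set.range (γ i))ᶜ) (u : Fin N → ℝ) :
    contourIntegrand V t γ c f u =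
      ((blockVandermonde (pathBlock fun a => hγ (c a)) *
        evalBlocks (pathBlock fun a => hγ (c a)) f : pathAlgebra fun a => γ (c a)) :
          (Fin N → ℝ) → ℂ) u * (pathWeight V ((N : ℂ) / t) (fun a => γ (c a)) u *
            pathJacobian (fun a => γ (c a)) u) := by
  rw [← evalAt_diagonal_path (fun a => hγ (c a))
    (notMem_range_of_mem_compl c), contourIntegrand, pathWeight, pathJacobian,
    ← Complex.exp_sum, ← Finset.mul_sum]
  ring

theorem integrable_contourIntegrand (hγ : ∀ i, AdmissiblePath V ((N : ℂ) / t) (γ i))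
    (c : Fin N → Fin d) (f : Observable (⋃ i, Set.range (γ i))ᶜ) :
    Integrable (contourIntegrand V t γ c f) := by
  have := integrable_pathAlgebra_mul (fun a => hγ (c a))
    (blockVandermonde (pathBlock fun a => hγ (c a)) * evalBlocks (pathBlock fun a => hγ (c a)) f)
  simpa only [← contourIntegrand_eq] using this

lemma fillingIntegral_eq (hγ : ∀ i, AdmissiblePath V ((N : ℂ) / t) (γ i)) (c : Fin N → Fin d)
    (f : Observable (⋃ i, Set.range (γ i))ᶜ) :
    fillingIntegral V t γ c f = pathIntegral (fun a => hγ (c a)) f := by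
  simp only [fillingIntegral, pathIntegral, contourIntegrand_eq hγ]

lemma fillingIntegral_loop (ht : t ≠ 0) (hγ : ∀ i, AdmissiblePath V ((N : ℂ) / t) (γ i))
    (c : Fin N → Fin d) (w : Word (⋃ i, Set.range (γ i))ᶜ)
    (f : Observable (⋃ i, Set.range (γ i))ᶜ) :
    (N : ℂ) * fillingIntegral V t γ c (trPolyMul V.derivative (Finsupp.single w f)) =
      t * fillingIntegral V t γ c (jacobian (Finsupp.single w f)) := by
  rw [fillingIntegral_eq hγ, fillingIntegral_eq hγ, ← pathIntegral_loop (fun a => hγ (c a))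
    (notMem_range_of_mem_compl c)]
  field_simp

lemma fillingIntegral_add (hγ : ∀ i, AdmissiblePath V ((N : ℂ) / t) (γ i)) (c : Fin N → Fin d)
    (f h : Observable (⋃ i, Set.range (γ i))ᶜ) :
    fillingIntegral V t γ c (f + h) = fillingIntegral V t γ c f + fillingIntegral V t γ c h := by
  rw [fillingIntegral_eq hγ, fillingIntegral_eq hγ, fillingIntegral_eq hγ, pathIntegral_add]

theorem loopEquations_fillingIntegral (ht : t ≠ 0)
    (hγ : ∀ i, AdmissiblePath V ((N : ℂ) / t) (γ i)) (c : Fin N → Fin d) :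
    LoopEquations (S := (⋃ i, Set.range (γ i))ᶜ) V N t (mean (fillingIntegral V t γ c)) :=
  loopEquations_mean _ (fillingIntegral_add hγ c) (fillingIntegral_loop ht hγ c)

theorem loopEquations_contourIntegral (ht : t ≠ 0)
    (hγ : ∀ i, AdmissiblePath V ((N : ℂ) / t) (γ i)) (κ : Fin d → ℂ) :
    LoopEquations (S := (⋃ i, Set.range (γ i))ᶜ) V N t
      (mean (contourIntegral (N := N) V t γ κ)) := by
  refine loopEquations_mean _ (fun f h => ?_) fun w f => ?_
  · simp only [contourIntegral, fillingIntegral_add hγ, mul_add, Finset.sum_add_distrib]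
  · simp only [contourIntegral, Finset.mul_sum]
    refine Finset.sum_congr rfl fun c _ => ?_
    rw [mul_left_comm, fillingIntegral_loop ht hγ, mul_left_comm]

end Filling

/-! ### Hermitian matrices in real coordinates -/

section HermitianCoordinates

variable {n : ℕ}

lemma isHermitian_hermitian (B : Fin n → Fin n → ℝ) : (hermitian B).IsHermitian := by
  ext a b
  simp only [hermitian, Matrix.conjTranspose_apply, Matrix.of_apply]
  rcases lt_trichotomy a b with h | h | h
  · simp [h, h.ne, h.ne', h.not_gt, sub_eq_add_neg]
  · simp [h]
  · simp [h, h.ne, h.ne', h.not_gt, sub_eq_add_neg]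

lemma hermitian_add (B B' : Fin n → Fin n → ℝ) :
    hermitian (B + B') = hermitian B + hermitian B' := by
  ext a b
  simp only [hermitian, Matrix.add_apply, Matrix.of_apply, Pi.add_apply, Complex.ofReal_add]
  split_ifs <;> ring

lemma hermitian_smul (r : ℝ) (B : Fin n → Fin n → ℝ) :
    hermitian (r • B) = (r : ℂ) • hermitian B := by
  ext a b
  simp only [hermitian, Matrix.smul_apply, Matrix.of_apply, Pi.smul_apply, smul_eq_mul,
    Complex.ofReal_mul]
  split_ifs <;> ring

/-- The entries of `hermitian` as real linear functionals. -/
def hermitianEntry (a b : Fin n) : (Fin n → Fin n → ℝ) →L[ℝ] ℂ :=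
  LinearMap.toContinuousLinearMap
    { toFun := fun B => hermitian B a b
      map_add' := fun B B' => by rw [hermitian_add]; rfl
      map_smul' := fun r B => by
        rw [hermitian_smul, Matrix.smul_apply, RingHom.id_apply, smul_eq_mul, Complex.real_smul] }

lemma hermitianEntry_apply (a b : Fin n) (B : Fin n → Fin n → ℝ) :
    hermitianEntry a b B = hermitian B a b := rfl

lemma hermitian_zero : hermitian (0 : Fin n → Fin n → ℝ) = 0 := by
  ext a b
  rw [← hermitianEntry_apply, map_zero]
  rfl

/-- The matrix units are complex combinations of the coordinate directions. -/
lemma exists_hermitian_add_I_smul (a b : Fin n) : ∃ v v' : Fin n → Fin n → ℝ,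
    hermitian v + Complex.I • hermitian v' = Matrix.single a b 1 := by
  rcases lt_trichotomy a b with h | rfl | h
  -- `E_ab = (E_ab + E_ba)/2 + i (E_ab - E_ba)/(2i)`, a combination of two Hermitian matrices. For
  -- `a < b` the first has only the real-part coordinate `(a, b)`, the second only the
  -- imaginary-part coordinate `(b, a)`. For `b < a` the roles of the indices and the sign in the
  -- second are exchanged.
  · refine ⟨fun c e => if c = a ∧ e = b then 1 / 2 else 0,
      fun c e => if c = b ∧ e = a then -1 / 2 else 0, ?_⟩
    ext c e
    simp only [hermitian, Matrix.add_apply, Matrix.smul_apply, Matrix.of_apply, Matrix.single_apply,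
      smul_eq_mul]
    split_ifs <;> first
      | (exfalso; omega)
      | (push_cast; linear_combination (-1 / 2) * Complex.I_mul_I)
      | (push_cast; linear_combination (1 / 2) * Complex.I_mul_I)
      | (push_cast; ring)
  · refine ⟨fun c e => if c = a ∧ e = a then 1 else 0, 0, ?_⟩
    rw [hermitian_zero, smul_zero, add_zero]
    ext c e
    simp only [hermitian, Matrix.of_apply, Matrix.single_apply]
    split_ifs <;> first
      | (exfalso; omega)
      | simp
  · refine ⟨fun c e => if c = b ∧ e = a then 1 / 2 else 0,
      fun c e => if c = a ∧ e = b then 1 / 2 else 0, ?_⟩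
    ext c e
    simp only [hermitian, Matrix.add_apply, Matrix.smul_apply, Matrix.of_apply, Matrix.single_apply,
      smul_eq_mul]
    split_ifs <;> first
      | (exfalso; omega)
      | (push_cast; linear_combination (-1 / 2) * Complex.I_mul_I)
      | (push_cast; linear_combination (1 / 2) * Complex.I_mul_I)
      | (push_cast; ring)

/-- Diagonal in the real coordinates, so the Gaussian weight is a product of one-dimensional
Gaussians. Off-diagonal coordinates count twice because each enters two entries. -/
lemma trace_hermitian_sq (B : Fin n → Fin n → ℝ) :
    Matrix.trace (hermitian B ^ 2) =
      ((∑ a, ∑ b, (if a = b then 1 else 2) * B a b ^ 2 : ℝ) : ℂ) := by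
  -- Written symmetrically in `a` and `b`, so that exchanging the summation indices in the second
  -- half merges it with the first.
  have h1 : ∀ a b, hermitian B a b * hermitian B b a =
      (((if a = b then 1 else 2) / 2 * B a b ^ 2 + (if b = a then 1 else 2) / 2 * B b a ^ 2 : ℝ) :
        ℂ) := by
    intro a b
    have hI := Complex.I_mul_I
    simp only [hermitian, Matrix.of_apply]
    rcases lt_trichotomy a b with h | rfl | h
    · simp only [h.ne, h.ne', h, h.not_gt, if_true, if_false]
      push_cast
      linear_combination -(B b a : ℂ) ^ 2 * hI
    · simp only [if_true]
      push_cast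
      ring
    · simp only [h.ne, h.ne', h, h.not_gt, if_true, if_false]
      push_cast
      linear_combination -(B a b : ℂ) ^ 2 * hI
  rw [pow_two, Matrix.trace]
  simp_rw [Matrix.diag_apply, Matrix.mul_apply, h1]
  simp_rw [← Complex.ofReal_sum]
  rw [Complex.ofReal_inj]
  simp_rw [Finset.sum_add_distrib]
  rw [Finset.sum_comm (f := fun a b => (if b = a then (1 : ℝ) else 2) / 2 * B b a ^ 2),
    ← Finset.sum_add_distrib]
  refine Finset.sum_congr rfl fun a _ => ?_
  rw [← Finset.sum_add_distrib]
  exact Finset.sum_congr rfl fun b _ => by ring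

lemma norm_sq_le_sum_sq (B : Fin n → Fin n → ℝ) : ‖B‖ ^ 2 ≤ ∑ a, ∑ b, B a b ^ 2 := by
  have h0 : 0 ≤ ∑ a, ∑ b, B a b ^ 2 := by positivity
  refine (Real.le_sqrt (norm_nonneg _) h0).1 ?_
  refine (pi_norm_le_iff_of_nonneg (Real.sqrt_nonneg _)).2 fun a =>
    (pi_norm_le_iff_of_nonneg (Real.sqrt_nonneg _)).2 fun b => ?_
  refine (Real.le_sqrt (norm_nonneg _) h0).2 ?_
  rw [Real.norm_eq_abs, sq_abs]
  calc B a b ^ 2 ≤ ∑ b, B a b ^ 2 :=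
        Finset.single_le_sum (fun b _ => sq_nonneg (B a b)) (Finset.mem_univ b)
    _ ≤ _ := Finset.single_le_sum (f := fun a => ∑ b, B a b ^ 2) (fun a _ => by positivity)
        (Finset.mem_univ a)

lemma sum_sq_le_trace_coeff (B : Fin n → Fin n → ℝ) :
    ∑ a, ∑ b, B a b ^ 2 ≤ ∑ a, ∑ b, (if a = b then 1 else 2) * B a b ^ 2 := by
  refine Finset.sum_le_sum fun a _ => Finset.sum_le_sum fun b _ => ?_
  split_ifs <;> nlinarith [sq_nonneg (B a b)]

end HermitianCoordinates

/-! ### Traces and determinants through eigenvalues -/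

section Eigenvalues

variable {n : ℕ} {A : Matrix (Fin n) (Fin n) ℂ}

lemma trace_aeval_of_isHermitian (hA : A.IsHermitian) (p : Polynomial ℂ) :
    Matrix.trace (Polynomial.aeval A p) = ∑ i, p.eval (hA.eigenvalues i : ℂ) := by
  have h1 : Polynomial.aeval A p = Unitary.conjStarAlgAut ℂ _ hA.eigenvectorUnitary
      (Polynomial.aeval (Matrix.diagonal (RCLike.ofReal ∘ hA.eigenvalues)) p) := by
    conv_lhs => rw [hA.spectral_theorem]
    exact Polynomial.aeval_algHom_apply
      (Unitary.conjStarAlgAut ℂ _ hA.eigenvectorUnitary).toAlgEquiv.toAlgHom _ _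
  have h2 : Polynomial.aeval (Matrix.diagonal (RCLike.ofReal ∘ hA.eigenvalues)) p =
      Matrix.diagonal fun i => p.eval (hA.eigenvalues i : ℂ) := by
    have := Polynomial.aeval_algHom_apply (Matrix.diagonalAlgHom (n := Fin n) (α := ℂ) ℂ)
      (RCLike.ofReal ∘ hA.eigenvalues) p
    refine this.trans ?_
    rw [Matrix.diagonalAlgHom_apply]
    congr 1
    funext i
    have h3 := Polynomial.aeval_algHom_apply (Pi.evalAlgHom ℂ (fun _ : Fin n => ℂ) i)
      (RCLike.ofReal ∘ hA.eigenvalues) p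
    rw [← Polynomial.coe_aeval_eq_eval]
    exact h3.symm
  rw [h1, h2, Unitary.conjStarAlgAut_apply, Matrix.trace_mul_cycle, Unitary.coe_star_mul_self,
    one_mul, Matrix.trace_diagonal]

/-- The eigenvalues are real, so each factor of the characteristic polynomial at `x` has modulus at
least `|Im x|`. The bound is uniform in `A`, as `inv_mem_polyGrowth` requires. -/
lemma norm_det_sub_ge (hA : A.IsHermitian) (x : ℂ) :
    |x.im| ^ n ≤ ‖Matrix.det (algebraMap ℂ (Matrix (Fin n) (Fin n) ℂ) x - A)‖ := by
  have h1 : Matrix.det (algebraMap ℂ (Matrix (Fin n) (Fin n) ℂ) x - A) = A.charpoly.eval x := by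
    rw [Matrix.eval_charpoly]
    rfl
  rw [h1, hA.charpoly_eq, Polynomial.eval_prod, norm_prod]
  calc |x.im| ^ n = ∏ i : Fin n, |x.im| := by simp
    _ ≤ _ := Finset.prod_le_prod (fun _ _ => abs_nonneg _) fun i _ => by
        refine le_trans (le_of_eq ?_) (Complex.abs_im_le_norm _)
        simp

end Eigenvalues

/-! ### Loop equations for convergent integrals over Hermitian matrices -/

section HermitianBlock

variable {E : Type*} [NormedAddCommGroup E] [NormedSpace ℝ E] {n : ℕ}

/-- The Hermitian matrix with coordinates `L x`, with functions of `x` as entries. -/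
def hermitianBlock (L : E →L[ℝ] (Fin n → Fin n → ℝ)) : Matrix (Fin n) (Fin n) (polyGrowth E) :=
  Matrix.of fun a b => ⟨_, clm_mem_polyGrowth ((hermitianEntry a b).comp L)⟩

variable (E) in
/-- Evaluation at a point. -/
def growthEval (x : E) : polyGrowth E →ₐ[ℂ] ℂ :=
  (Pi.evalAlgHom ℂ (fun _ : E => ℂ) x).comp (polyGrowth E).val

lemma growthEval_apply (x : E) (f : polyGrowth E) : growthEval E x f = (f : E → ℂ) x := rfl

lemma map_growthEval_hermitianBlock (L : E →L[ℝ] (Fin n → Fin n → ℝ)) (x : E) :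
    (hermitianBlock L).map (growthEval E x) = hermitian (L x) := rfl

lemma map_polyDeriv_hermitianBlock_apply (L : E →L[ℝ] (Fin n → Fin n → ℝ)) (c : ℂ) (v v' : E)
    (a b : Fin n) (x : E) :
    (hermitianBlock L).map (polyDeriv E c v v') a b x =
      c * (hermitian (L v) + Complex.I • hermitian (L v')) a b := by
  rw [Matrix.map_apply, dirDeriv_apply, hermitianBlock, Matrix.of_apply,
    ContinuousLinearMap.fderiv]
  rfl

lemma map_polyDeriv_hermitianBlock (L : E →L[ℝ] (Fin n → Fin n → ℝ)) (c : ℂ) {v v' : E}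
    {a b : Fin n}
    (h : hermitian (L v) + Complex.I • hermitian (L v') = Matrix.single a b 1) :
    (hermitianBlock L).map (polyDeriv E c v v') =
      (algebraMap ℂ (E → ℂ) c) • Matrix.single a b 1 := by
  ext a' b' x
  rw [map_polyDeriv_hermitianBlock_apply, h, Matrix.smul_apply, smul_eq_mul, Pi.mul_apply,
    Matrix.single_apply, Matrix.single_apply]
  split_ifs <;> simp

lemma map_polyDeriv_hermitianBlock_of_eq_zero (L : E →L[ℝ] (Fin n → Fin n → ℝ)) (c : ℂ) {v v' : E}
    (h : L v = 0) (h' : L v' = 0) : (hermitianBlock L).map (polyDeriv E c v v') = 0 := by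
  ext a b x
  rw [map_polyDeriv_hermitianBlock_apply, h, h', hermitian_zero]
  simp

lemma derivation_trace_aeval_of_single {ι R R' : Type*} [Fintype ι] [DecidableEq ι] [CommRing R]
    [Algebra ℂ R] [CommRing R'] [Algebra ℂ R'] [Algebra R R'] [IsScalarTower ℂ R R']
    (D : Derivation ℂ R R') {M : Matrix ι ι R} {Θ : R'} {a b : ι}
    (h : M.map D = Θ • Matrix.single a b 1) (p : Polynomial ℂ) :
    D (Matrix.trace (Polynomial.aeval M p)) =
      Θ * algebraMap R R' (Polynomial.aeval M p.derivative b a) := by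
  rw [derivation_trace_aeval, h, Matrix.mul_smul, Matrix.trace_smul, Matrix.trace_mul_single]
  simp

variable [FiniteDimensional ℝ E] [MeasureSpace E] [BorelSpace E]
  [(volume : Measure E).IsAddHaarMeasure]

/-- The divergence theorem for a vector field with coefficients of polynomial growth. -/
lemma integral_sum_polyDeriv_mul {J : Type*} [Fintype J] (h : polyGrowth E)
    (hW : RapidDecay (expWeight (h : E → ℂ))) (c : J → ℂ) (v v' : J → E) (G : J → polyGrowth E) :
    ∫ x, (∑ j, polyDeriv E (c j) (v j) (v' j) (G j)) x * expWeight (h : E → ℂ) x =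
      ∫ x, (∑ j, algebraMap (polyGrowth E) (E → ℂ) (G j) * polyDeriv E (c j) (v j) (v' j) h) x *
        expWeight (h : E → ℂ) x := by
  have hWc := (contDiff_expWeight h.2).continuous
  simp_rw [Finset.sum_apply, Finset.sum_mul]
  have hi : ∀ j, Integrable fun x => (algebraMap (polyGrowth E) (E → ℂ) (G j) *
      polyDeriv E (c j) (v j) (v' j) h) x * expWeight (h : E → ℂ) x := by
    intro j
    have h1 : Continuous (polyDeriv E (c j) (v j) (v' j) h) :=
      continuous_const.mul ((continuous_fderiv_apply_of_mem_polyGrowth h.2 _).add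
        (continuous_const.mul (continuous_fderiv_apply_of_mem_polyGrowth h.2 _)))
    have h2 : PolyBounded (polyDeriv E (c j) (v j) (v' j) h) :=
      (PolyBounded.const (c j)).mul_of_le ((polyBounded_fderiv_apply h.2 (v j)).add
        ((PolyBounded.const Complex.I).mul_of_le (polyBounded_fderiv_apply h.2 (v' j))
          fun x => (norm_mul _ _).le)) fun x => (norm_mul _ _).le
    exact integrable_mul_rapidDecay ((G j).2.1.continuous.mul h1)
      ((G j).2.2.1.mul_of_le h2 fun x => (norm_mul _ _).le) hWc hW
  rw [integral_finsetSum _ fun j _ => integrable_polyDeriv_mul hWc hW _ _ _ _,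
    integral_finsetSum _ fun j _ => hi j]
  exact Finset.sum_congr rfl fun j _ => integral_polyDeriv_mul h hW _ _ _ _

end HermitianBlock

/-! ### Decay of the Hermitian weight and integration by parts -/

section HermitianIntegral

variable {N : ℕ} {V : Polynomial ℂ} {t : ℂ}

/-- A matrix is invertible over the algebra of functions of polynomial growth as soon as the inverse
of its determinant belongs to that algebra. -/
lemma resolventsExist_hermitianBlock (hS : ∀ x ∈ S, x.im ≠ 0) :
    ResolventsExist S (hermitianBlock (ContinuousLinearMap.id ℝ (Fin N → Fin N → ℝ))) := by
  intro x hx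
  rw [Matrix.isUnit_iff_isUnit_det]
  set M := hermitianBlock (ContinuousLinearMap.id ℝ (Fin N → Fin N → ℝ))
  set δ := Matrix.det (algebraMap ℂ (Matrix (Fin N) (Fin N) (polyGrowth (Fin N → Fin N → ℝ))) x - M)
  have h1 : ∀ B, |x.im| ^ N ≤ ‖(δ : (Fin N → Fin N → ℝ) → ℂ) B‖ := by
    intro B
    refine (norm_det_sub_ge (isHermitian_hermitian B) x).trans (le_of_eq ?_)
    rw [← growthEval_apply, AlgHom.map_det, AlgHom.mapMatrix_apply, map_algebraMap_sub,
      map_growthEval_hermitianBlock]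
    rfl
  have h2 : 0 < |x.im| ^ N := pow_pos (abs_pos.2 (hS x hx)) N
  refine IsUnit.of_mul_eq_one ⟨_, inv_mem_polyGrowth δ.2 h2 h1⟩ (Subtype.ext (funext fun B => ?_))
  exact mul_inv_cancel₀ (norm_pos_iff.1 (h2.trans_le (h1 B)))

/-- The action `(N / t) Tr V(M)`. -/
def hermitianAction (N : ℕ) (V : Polynomial ℂ) (c : ℂ) : polyGrowth (Fin N → Fin N → ℝ) :=
  c • Matrix.trace (Polynomial.aeval
    (hermitianBlock (ContinuousLinearMap.id ℝ (Fin N → Fin N → ℝ))) V)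

lemma hermitianAction_apply (c : ℂ) (B : Fin N → Fin N → ℝ) :
    (hermitianAction N V c : (Fin N → Fin N → ℝ) → ℂ) B =
      c * Matrix.trace (Polynomial.aeval (hermitian B) V) := by
  rw [← growthEval_apply, hermitianAction, map_smul, smul_eq_mul]
  congr 1
  rw [AddMonoidHom.map_trace, ← AlgHom.mapMatrix_apply (growthEval _ B),
    ← Polynomial.aeval_algHom_apply]
  rfl

lemma one_add_sum_le_prod_one_add {ι : Type*} (s : Finset ι) (x : ι → ℝ) (hx : ∀ i, 0 ≤ x i) :
    1 + ∑ i ∈ s, x i ≤ ∏ i ∈ s, (1 + x i) := by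
  classical
  induction s using Finset.induction_on with
  | empty => simp
  | insert a s ha ih =>
    rw [Finset.sum_insert ha, Finset.prod_insert ha]
    nlinarith [mul_le_mul_of_nonneg_left ih (by linarith [hx a] : (0 : ℝ) ≤ 1 + x a),
      Finset.sum_nonneg fun i (_ : i ∈ s) => hx i, hx a,
      mul_nonneg (hx a) (Finset.sum_nonneg fun i (_ : i ∈ s) => hx i)]

/-- From `‖B‖² ≤ Tr M² = ∑ λ_i² ≤ (∑ |λ_i|)²`. The product form matches the factorization of the
weight over the eigenvalues. -/
lemma one_add_norm_le_prod_eigenvalues (B : Fin N → Fin N → ℝ) :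
    1 + ‖B‖ ≤ ∏ i, (1 + |(isHermitian_hermitian B).eigenvalues i|) := by
  refine le_trans ?_ (one_add_sum_le_prod_one_add _ _ fun i => abs_nonneg _)
  gcongr
  have h1 := trace_aeval_of_isHermitian (isHermitian_hermitian B) (Polynomial.X ^ 2)
  simp only [map_pow, Polynomial.aeval_X, Polynomial.eval_pow, Polynomial.eval_X] at h1
  rw [trace_hermitian_sq] at h1
  norm_cast at h1
  have h2 := (norm_sq_le_sum_sq B).trans (sum_sq_le_trace_coeff B)
  have h3 : ∑ i, (isHermitian_hermitian B).eigenvalues i ^ 2 ≤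
      (∑ i, |(isHermitian_hermitian B).eigenvalues i|) ^ 2 := by
    simp_rw [← sq_abs ((isHermitian_hermitian B).eigenvalues _)]
    exact Finset.sum_sq_le_sq_sum_of_nonneg fun i _ => abs_nonneg _
  refine le_of_sq_le_sq ?_ (Finset.sum_nonneg fun i _ => abs_nonneg _)
  push_cast at h1
  linarith

/-- The weight and the bound on `1 + ‖B‖` both factor over the eigenvalues, and each factor is
bounded on the real line by the hypothesis on one-dimensional integrals. -/
lemma rapidDecay_hermitianAction {c : ℂ} (h : AdmissiblePath V c fun u : ℝ => (u : ℂ)) :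
    RapidDecay (expWeight (hermitianAction N V c : (Fin N → Fin N → ℝ) → ℂ)) := by
  intro k
  obtain ⟨C, hC⟩ := h.exists_one_add_norm_pow_le k
  refine ⟨C ^ N, fun B => ?_⟩
  rw [expWeight, hermitianAction_apply, trace_aeval_of_isHermitian (isHermitian_hermitian B),
    ← neg_mul, Finset.mul_sum, Complex.exp_sum, norm_prod]
  calc (1 + ‖B‖) ^ k * ∏ i, ‖Complex.exp
        (-c * V.eval ((isHermitian_hermitian B).eigenvalues i : ℂ))‖
      ≤ (∏ i, (1 + |(isHermitian_hermitian B).eigenvalues i|)) ^ k * ∏ i, ‖Complex.exp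
        (-c * V.eval ((isHermitian_hermitian B).eigenvalues i : ℂ))‖ := by
        refine mul_le_mul_of_nonneg_right (pow_le_pow_left₀ (by positivity)
          (one_add_norm_le_prod_eigenvalues B) k) (Finset.prod_nonneg fun i _ => norm_nonneg _)
    _ = ∏ i, ((1 + ‖((isHermitian_hermitian B).eigenvalues i : ℂ)‖) ^ k * ‖Complex.exp
        (-c * V.eval ((isHermitian_hermitian B).eigenvalues i : ℂ))‖) := by
        rw [Finset.prod_mul_distrib, Finset.prod_pow]
        simp
    _ ≤ ∏ i : Fin N, C :=
        Finset.prod_le_prod (fun _ _ => by positivity) fun i _ => hC _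
    _ = C ^ N := by simp

lemma hermitianIntegrand_eq (hS : ∀ x ∈ S, x.im ≠ 0) (f : Observable S)
    (B : Fin N → Fin N → ℝ) :
    hermitianIntegrand V t f B =
      (evalBlocks (fun _ : Fin 1 => hermitianBlock (ContinuousLinearMap.id ℝ _)) f :
        polyGrowth (Fin N → Fin N → ℝ)).1 B *
          expWeight (hermitianAction N V ((N : ℂ) / t) : (Fin N → Fin N → ℝ) → ℂ) B := by
  rw [hermitianIntegrand, mul_comm, expWeight, hermitianAction_apply, neg_mul, ← growthEval_apply,
    map_evalBlocks fun _ => resolventsExist_hermitianBlock hS, evalAt_eq_evalBlocks]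
  rfl

theorem integrable_hermitianIntegrand (hS : ∀ x ∈ S, x.im ≠ 0)
    (h : AdmissiblePath V ((N : ℂ) / t) fun u : ℝ => (u : ℂ)) (f : Observable S) :
    Integrable (hermitianIntegrand (N := N) V t f) := by
  have := integrable_polyGrowth_mul (contDiff_expWeight (hermitianAction N V ((N : ℂ) / t)).2).continuous
    (rapidDecay_hermitianAction h)
    (evalBlocks (fun _ : Fin 1 => hermitianBlock (ContinuousLinearMap.id ℝ _)) f)
  exact this.congr (Filter.Eventually.of_forall fun B => (hermitianIntegrand_eq hS f B).symm)

/-- The divergence theorem for the field `w(M) f(M)` in the complex directions `E_ab`; the action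
contributes `(N/t) V'(M)_ba`, and summing against `w(M)_ab` gives the trace. -/
lemma hermitianIntegral_loop (hS : ∀ x ∈ S, x.im ≠ 0) (ht : t ≠ 0)
    (h : AdmissiblePath V ((N : ℂ) / t) fun u : ℝ => (u : ℂ)) (w : Word S) (f : Observable S) :
    (N : ℂ) * hermitianIntegral N V t (trPolyMul V.derivative (Finsupp.single w f)) =
      t * hermitianIntegral N V t (jacobian (Finsupp.single w f)) := by
  have hr := resolventsExist_hermitianBlock (N := N) hS
  set M := hermitianBlock (ContinuousLinearMap.id ℝ (Fin N → Fin N → ℝ)) with hMdef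
  choose v v' hv using fun a b : Fin N => exists_hermitian_add_I_smul a b
  let D : Fin N → Fin N → Derivation ℂ (polyGrowth (Fin N → Fin N → ℝ)) _ := fun a b =>
    polyDeriv (Fin N → Fin N → ℝ) 1 (v a b) (v' a b)
  have hD : ∀ a b, M.map (D a b) = (1 : (Fin N → Fin N → ℝ) → ℂ) • Matrix.single a b 1 :=
    fun a b => by
      have := map_polyDeriv_hermitianBlock (ContinuousLinearMap.id ℝ (Fin N → Fin N → ℝ)) 1 (hv a b)
      rwa [map_one] at this
  have hdiv := divergence_eq (M := fun _ : Fin 1 => M) (D := fun _ => D) w (fun _ => hr)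
    (fun _ => hD) (fun i j _ _ hij => (hij (Subsingleton.elim _ _)).elim)
    (evalBlocks (fun _ : Fin 1 => M) f)
  -- With a single block the product over pairs is empty: the whole split comes from the divergence
  -- of `w`.
  have hvdm : blockVandermonde (fun _ : Fin 1 => M) = 1 := by
    simp [blockVandermonde]
  rw [flow_evalBlocks w (fun _ => hr) (fun _ => hD)
    (fun i j _ _ hij => (hij (Subsingleton.elim _ _)).elim), hvdm, map_one, one_mul, one_mul,
    one_mul, one_mul, Fin.sum_univ_one, mul_comm (evalBlocks _ _), ← map_add, ← map_mul, ← map_add,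
    ← jacobian_single] at hdiv
  have hIBP := integral_sum_polyDeriv_mul (hermitianAction N V ((N : ℂ) / t))
    (rapidDecay_hermitianAction h) (J := Fin N × Fin N) (fun _ => 1) (fun j => v j.1 j.2)
    (fun j => v' j.1 j.2)
    (fun j => wordEval M w j.1 j.2 * evalBlocks (fun _ : Fin 1 => M) f)
  rw [Fintype.sum_prod_type, Fintype.sum_prod_type, hdiv] at hIBP
  have hact : ∀ a b, D a b (hermitianAction N V ((N : ℂ) / t)) = ((N : ℂ) / t) •
      algebraMap (polyGrowth (Fin N → Fin N → ℝ)) ((Fin N → Fin N → ℝ) → ℂ)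
        (Polynomial.aeval M V.derivative b a) := fun a b => by
    rw [hermitianAction, Derivation.map_smul, derivation_trace_aeval_of_single _ (hD a b), one_mul]
  have hsum : ∑ a, ∑ b, algebraMap (polyGrowth (Fin N → Fin N → ℝ)) ((Fin N → Fin N → ℝ) → ℂ)
      (wordEval M w a b * evalBlocks (fun _ : Fin 1 => M) f) *
        D a b (hermitianAction N V ((N : ℂ) / t)) = ((N : ℂ) / t) •
      algebraMap (polyGrowth (Fin N → Fin N → ℝ)) ((Fin N → Fin N → ℝ) → ℂ)
        (evalBlocks (fun _ : Fin 1 => M) (trPolyMul V.derivative (Finsupp.single w f))) := by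
    rw [evalBlocks_trPolyMul_single, Fin.sum_univ_one, Matrix.trace_mul_comm, Matrix.trace]
    simp_rw [hact, mul_smul_comm, ← Finset.smul_sum, Matrix.diag_apply, Matrix.mul_apply,
      Finset.mul_sum, map_sum, map_mul]
    congr 1
    exact Finset.sum_congr rfl fun a _ => Finset.sum_congr rfl fun b _ => by ring
  rw [hsum] at hIBP
  have hI : ∀ F : Observable S, hermitianIntegral N V t F = ∫ B, algebraMap
      (polyGrowth (Fin N → Fin N → ℝ)) ((Fin N → Fin N → ℝ) → ℂ)
        (evalBlocks (fun _ : Fin 1 => M) F) B *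
          expWeight (hermitianAction N V ((N : ℂ) / t) : (Fin N → Fin N → ℝ) → ℂ) B := fun F =>
    integral_congr_ae (Filter.Eventually.of_forall fun B => hermitianIntegrand_eq hS F B)
  rw [hI, hI, hIBP]
  simp_rw [Pi.smul_apply, smul_eq_mul, mul_assoc]
  rw [integral_const_mul]
  field_simp

theorem loopEquations_hermitianIntegral (hS : ∀ x ∈ S, x.im ≠ 0) (ht : t ≠ 0)
    (h : AdmissiblePath V ((N : ℂ) / t) fun u : ℝ => (u : ℂ)) :
    LoopEquations (S := S) V N t (mean (hermitianIntegral N V t)) := by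
  refine loopEquations_mean _ (fun f g => ?_) (hermitianIntegral_loop hS ht h)
  rw [hermitianIntegral, hermitianIntegral, hermitianIntegral, ← integral_add
    (integrable_hermitianIntegrand hS h f) (integrable_hermitianIntegrand hS h g)]
  congr 1
  funext B
  simp only [hermitianIntegrand, evalAt, map_add, mul_add]

end HermitianIntegral

/-! ### Power series with coefficients in an algebra with derivations -/

section PowerSeriesDerivation

variable {A A' : Type*} [CommRing A] [Algebra ℂ A] [CommRing A'] [Algebra ℂ A'] [Algebra A A']
  [IsScalarTower ℂ A A']

instance : IsScalarTower ℂ (PowerSeries A) (PowerSeries A') :=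
  IsScalarTower.of_algebraMap_eq fun c => by
    rw [PowerSeries.algebraMap_apply, PowerSeries.algebraMap_apply, PowerSeries.algebraMap_apply'',
      PowerSeries.map_C, ← IsScalarTower.algebraMap_apply]

/-- The coefficientwise extension of a derivation to power series. -/
def coeffDeriv (D : Derivation ℂ A A') : Derivation ℂ (PowerSeries A) (PowerSeries A') :=
  Derivation.mk'
    { toFun := fun f => PowerSeries.mk fun m => D (PowerSeries.coeff m f)
      map_add' := fun f g => by ext m; simp
      map_smul' := fun c f => by ext m; simp }
    fun f g => by
      ext m
      rw [Algebra.smul_def, Algebra.smul_def, PowerSeries.algebraMap_apply'',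
        PowerSeries.algebraMap_apply'']
      simp only [LinearMap.coe_mk, AddHom.coe_mk, PowerSeries.coeff_mk, map_add,
        PowerSeries.coeff_mul, map_sum, Derivation.leibniz, Finset.sum_add_distrib,
        PowerSeries.coeff_map, Algebra.smul_def]
      congr 1
      rw [← Finset.Nat.sum_antidiagonal_swap]
      rfl

lemma coeff_coeffDeriv (D : Derivation ℂ A A') (f : PowerSeries A) (m : ℕ) :
    PowerSeries.coeff m (coeffDeriv D f) = D (PowerSeries.coeff m f) := by
  exact PowerSeries.coeff_mk m fun m => D (PowerSeries.coeff m f)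

lemma coeffDeriv_X_mul_C (D : Derivation ℂ A A') (a : A) :
    coeffDeriv D (PowerSeries.X * PowerSeries.C a) = PowerSeries.X * PowerSeries.C (D a) := by
  ext m
  rw [coeff_coeffDeriv]
  cases m with
  | zero => simp
  | succ m =>
    rw [PowerSeries.coeff_succ_X_mul, PowerSeries.coeff_succ_X_mul, PowerSeries.coeff_C,
      PowerSeries.coeff_C]
    split_ifs <;> simp

variable {ι : Type*} [Fintype ι] [DecidableEq ι]

/-- The matrix `x + s K`, with power series in `s` as entries. -/
def affineMatrix (x : ℂ) (K : Matrix ι ι A) : Matrix ι ι (PowerSeries A) :=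
  algebraMap ℂ (Matrix ι ι (PowerSeries A)) x +
    (PowerSeries.X : PowerSeries A) • K.map (algebraMap A (PowerSeries A))

lemma isUnit_of_map_constantCoeff {M : Matrix ι ι (PowerSeries A)}
    (h : IsUnit (M.map PowerSeries.constantCoeff)) : IsUnit M := by
  rw [Matrix.isUnit_iff_isUnit_det] at h ⊢
  rw [PowerSeries.isUnit_iff_constantCoeff, RingHom.map_det]
  exact h

lemma map_constantCoeff_affineMatrix (x : ℂ) (K : Matrix ι ι A) :
    (affineMatrix x K).map PowerSeries.constantCoeff = algebraMap ℂ (Matrix ι ι A) x := by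
  ext a b
  rw [Matrix.map_apply, affineMatrix, Matrix.add_apply, Matrix.smul_apply, map_add, smul_eq_mul,
    map_mul, PowerSeries.constantCoeff_X, zero_mul, add_zero, Matrix.algebraMap_matrix_apply,
    Matrix.algebraMap_matrix_apply]
  split_ifs
  · rw [PowerSeries.algebraMap_apply, PowerSeries.constantCoeff_C]
  · exact map_zero _

/-- At `s = 0` the matrix is the nonzero scalar `y - x`, and a matrix of power series is invertible
as soon as its constant term is. -/
lemma resolventsExist_affineMatrix {x : ℂ} (hx : x ∉ S) (K : Matrix ι ι A) :
    ResolventsExist S (affineMatrix x K) := by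
  intro y hy
  refine isUnit_of_map_constantCoeff ?_
  have h1 : (algebraMap ℂ (Matrix ι ι (PowerSeries A)) y - affineMatrix x K).map
      PowerSeries.constantCoeff = algebraMap ℂ (Matrix ι ι A) (y - x) := by
    have h2 : (algebraMap ℂ (Matrix ι ι (PowerSeries A)) y).map PowerSeries.constantCoeff =
        algebraMap ℂ (Matrix ι ι A) y := by
      have := map_constantCoeff_affineMatrix y (0 : Matrix ι ι A)
      simpa [affineMatrix] using this
    rw [map_sub, ← map_constantCoeff_affineMatrix x K, ← h2]
    exact map_sub (PowerSeries.constantCoeff (R := A)).mapMatrix _ _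
  rw [h1]
  exact (sub_ne_zero.2 fun h : y = x => hx (h ▸ hy)).isUnit.map _

lemma map_coeffDeriv_affineMatrix (D : Derivation ℂ A A') (x : ℂ) (K : Matrix ι ι A) :
    (affineMatrix x K).map (coeffDeriv D) =
      (PowerSeries.X : PowerSeries A') • (K.map D).map (PowerSeries.C (R := A')) := by
  ext1 a b
  have h := congrFun₂ (map_derivation_algebraMap (coeffDeriv D) (ι := ι) x) a b
  rw [Matrix.map_apply] at h
  rw [Matrix.map_apply, affineMatrix, Matrix.add_apply, map_add, h, Matrix.zero_apply, zero_add,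
    Matrix.smul_apply, Matrix.smul_apply, Matrix.map_apply, Matrix.map_apply, Matrix.map_apply,
    smul_eq_mul, smul_eq_mul, ← coeffDeriv_X_mul_C]
  rfl

lemma map_mapAlgHom_affineMatrix {T : Type*} [CommRing T] [Algebra ℂ T] (φ : A →ₐ[ℂ] T) (x : ℂ)
    (K : Matrix ι ι A) :
    (affineMatrix x K).map (PowerSeries.mapAlgHom φ) = affineMatrix x (K.map φ) := by
  ext1 a b
  have h := congrFun₂ ((AlgHom.mapMatrix (m := ι) (PowerSeries.mapAlgHom φ)).commutes x) a b
  rw [AlgHom.mapMatrix_apply, Matrix.map_apply] at h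
  rw [Matrix.map_apply, affineMatrix, affineMatrix, Matrix.add_apply, Matrix.add_apply, map_add, h,
    Matrix.smul_apply, Matrix.smul_apply, smul_eq_mul, smul_eq_mul, map_mul]
  congr 1
  rw [Matrix.map_apply, Matrix.map_apply, Matrix.map_apply, PowerSeries.mapAlgHom_apply,
    PowerSeries.mapAlgHom_apply, PowerSeries.map_X]
  congr 1
  exact PowerSeries.map_C _ _

end PowerSeriesDerivation

/-! ### The formal integrand over an arbitrary algebra, and its parity -/

section FormalExpression

variable {d : ℕ} (V : Polynomial ℂ) (ξ : Fin d → ℂ) {n : Fin d → ℕ}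
variable {R T : Type*} [CommRing R] [Algebra ℂ R] [CommRing T] [Algebra ℂ T]

/-- The non-Gaussian part `∑_i Tr δV_i(M_i)` of the action. -/
def interaction (M : ∀ i, Matrix (Fin (n i)) (Fin (n i)) R) : R :=
  ∑ i, Matrix.trace (Polynomial.aeval (M i) (nonGaussian V ξ i))

lemma map_interaction (φ : R →ₐ[ℂ] T) (M : ∀ i, Matrix (Fin (n i)) (Fin (n i)) R) :
    φ (interaction V ξ M) = interaction V ξ fun i => (M i).map φ := by
  rw [interaction, interaction, map_sum]
  refine Finset.sum_congr rfl fun i _ => ?_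
  rw [AddMonoidHom.map_trace, ← AlgHom.mapMatrix_apply, ← AlgHom.mapMatrix_apply,
    ← Polynomial.aeval_algHom_apply]

lemma map_blockVandermonde {n : Fin d → Type*} [∀ i, Fintype (n i)] [∀ i, DecidableEq (n i)]
    (φ : R →ₐ[ℂ] T) (M : ∀ i, Matrix (n i) (n i) R) :
    φ (blockVandermonde M) = blockVandermonde fun i => (M i).map φ := by
  simp_rw [blockVandermonde, map_prod, map_pow, AlgHom.map_det]
  refine Finset.prod_congr rfl fun i _ => Finset.prod_congr rfl fun j _ => ?_
  congr 2
  ext ⟨a, a'⟩ ⟨b, b'⟩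
  simp only [AlgHom.mapMatrix_apply, Matrix.map_apply, Matrix.sub_apply, Matrix.kronecker_apply,
    map_sub, map_mul, Matrix.one_apply]
  congr 2 <;> split_ifs <;> simp

/-- The integrand `(∑_i Tr δV_i(M_i))^k Δ(M)² f(M)`. -/
def formalExpr (k : ℕ) (f : Observable S) (M : ∀ i, Matrix (Fin (n i)) (Fin (n i)) R) : R :=
  interaction V ξ M ^ k * (blockVandermonde M * evalBlocks M f)

/-- Naturality allows one computation over functions of the coordinates to be specialized at each
point, and the parity in `s` to be obtained from the substitution `s ↦ -s`. -/
lemma map_formalExpr (φ : R →ₐ[ℂ] T) {M : ∀ i, Matrix (Fin (n i)) (Fin (n i)) R}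
    (hM : ∀ i, ResolventsExist S (M i)) (k : ℕ) (f : Observable S) :
    φ (formalExpr V ξ k f M) = formalExpr V ξ k f fun i => (M i).map φ := by
  rw [formalExpr, formalExpr, map_mul, map_mul, map_pow, map_interaction, map_blockVandermonde,
    map_evalBlocks hM]

variable {ξ} (ω : Fin d → ℂ)

lemma block_eq_affineMatrix (B : Coords n) (i : Fin d) :
    block ξ ω B i = affineMatrix (ξ i) (ω i • hermitian (B i)) := rfl

lemma resolventsExist_block (hS : ∀ i, ξ i ∉ S) (B : Coords n) (i : Fin d) :
    ResolventsExist S (block ξ ω B i) :=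
  resolventsExist_affineMatrix (hS i) _

lemma formalIntegrand_eq (hS : ∀ i, ξ i ∉ S) (k : ℕ) (f : Observable S) (B : Coords n) :
    formalIntegrand V ξ ω k f B = formalExpr V ξ k f (block ξ ω B) := by
  rw [formalIntegrand, formalExpr,
    evalAt_blockDiagonal' (resolventsExist_block ω hS B), mul_assoc]
  rfl

/-- The parity of the integrand: `A ↦ -A` is `s ↦ -s`. -/
lemma coeff_formalIntegrand_neg (hS : ∀ i, ξ i ∉ S) (k p : ℕ) (f : Observable S) (B : Coords n) :
    PowerSeries.coeff p (formalIntegrand V ξ ω k f (-B)) =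
      (-1) ^ p * PowerSeries.coeff p (formalIntegrand V ξ ω k f B) := by
  have hr : ∀ g : PowerSeries ℂ,
      PowerSeries.rescaleAlgHom (-1 : ℂ) g = PowerSeries.rescale (-1 : ℂ) g :=
    DFunLike.congr_fun (PowerSeries.coe_rescaleAlgHom (-1 : ℂ))
  have h1 : ∀ i, (block ξ ω B i).map (PowerSeries.rescaleAlgHom (-1 : ℂ)) = block ξ ω (-B) i := by
    intro i
    have h2 : hermitian ((-B) i) = -hermitian (B i) := by
      have := hermitian_smul (-1) (B i)
      rw [neg_one_smul] at this
      rw [Pi.neg_apply, this]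
      simp
    rw [block_eq_affineMatrix, block_eq_affineMatrix, h2]
    ext1 a b
    have h := congrFun₂ ((AlgHom.mapMatrix (m := Fin (n i))
      (PowerSeries.rescaleAlgHom (-1 : ℂ))).commutes (ξ i)) a b
    rw [AlgHom.mapMatrix_apply, Matrix.map_apply] at h
    rw [Matrix.map_apply, affineMatrix, affineMatrix, Matrix.add_apply, Matrix.add_apply, map_add,
      h, Matrix.smul_apply, Matrix.smul_apply, smul_eq_mul, smul_eq_mul, map_mul, Matrix.map_apply,
      Matrix.map_apply, AlgHom.commutes, hr, PowerSeries.rescale_X, Matrix.smul_apply,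
      Matrix.smul_apply, Matrix.neg_apply, smul_neg, map_neg, map_neg, map_one, neg_one_mul,
      neg_mul, mul_neg]
  have h2 := map_formalExpr V ξ (PowerSeries.rescaleAlgHom (-1 : ℂ))
    (resolventsExist_block ω hS B) k f
  rw [funext h1] at h2
  rw [formalIntegrand_eq V ω hS, formalIntegrand_eq V ω hS, ← h2, hr,
    PowerSeries.coeff_rescale]

end FormalExpression

/-! ### Algebra of the formal loop equations -/

section FormalSum

variable {A : Type*} [CommRing A] [Algebra ℂ A]

/-- The coefficient of `s ^ p` of `∑_k ((-N)^k / (s^{2k} k!)) L(Φ^k G)`. -/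
def expandedCoeff (L : ℕ → PowerSeries A →ₗ[ℂ] ℂ) (N : ℂ) (Φ : PowerSeries A) (p : ℕ)
    (G : PowerSeries A) : ℂ :=
  ∑ k ∈ Finset.range (p + 1), (-N) ^ k / (k.factorial : ℂ) * L (p + 2 * k) (Φ ^ k * G)

variable {L : ℕ → PowerSeries A →ₗ[ℂ] ℂ} (hX : ∀ m r, L (m + 1) (PowerSeries.X * r) = L m r)
  (hX0 : ∀ r, L 0 (PowerSeries.X * r) = 0)

include hX

lemma functional_X_pow_mul (m j : ℕ) (r : PowerSeries A) :
    L (m + j) (PowerSeries.X ^ j * r) = L m r := by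
  induction j with
  | zero => simp
  | succ j ih => rw [← add_assoc, pow_succ', mul_assoc, hX, ih]

include hX0

lemma functional_eq_zero_of_lt {m j : ℕ} (h : m < j) {r : PowerSeries A}
    (hr : PowerSeries.X ^ j ∣ r) : L m r = 0 := by
  obtain ⟨e, rfl⟩ := Nat.exists_eq_add_of_lt h
  obtain ⟨r', rfl⟩ := hr
  have : L (0 + m) (PowerSeries.X ^ m * (PowerSeries.X * (PowerSeries.X ^ e * r'))) = 0 := by
    rw [functional_X_pow_mul hX, hX0]
  rw [zero_add] at this
  rw [← this]
  congr 1
  ring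

variable {N : ℂ} {Φ P Z F G : PowerSeries A}
  (key : ∀ m k : ℕ, N * L m (Z * F * Φ ^ k) =
    L m (PowerSeries.X ^ 2 * (G * Φ ^ k + (k : PowerSeries A) * (Φ ^ (k - 1) * P * F))))

omit hX0 in
include key in
-- The term-by-term form of differentiating `e^{-NΦ/s²}`. By `key`, Gaussian integration by parts at
-- order `k` creates `k s² Φ^{k-1} P F`; with the coefficients `(-N)^k/k!` and the shift by `s²` it
-- cancels the `P`-term of order `k - 1`. Only the `P`-term of the last order is left.
lemma partial_sum_loop (p j : ℕ) :
    N * ∑ k ∈ Finset.range (j + 1),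
      (-N) ^ k / (k.factorial : ℂ) * L (p + 2 * k) (Φ ^ k * (F * (P + Z))) =
    ∑ k ∈ Finset.range (j + 1), (-N) ^ k / (k.factorial : ℂ) *
      L (p + 2 * k) (PowerSeries.X ^ 2 * (Φ ^ k * G)) +
      N * ((-N) ^ j / (j.factorial : ℂ) * L (p + 2 * j) (Φ ^ j * (F * P))) := by
  have hk : ∀ m k : ℕ, N * L m (Φ ^ k * (F * (P + Z))) = N * L m (Φ ^ k * (F * P)) +
      (L m (PowerSeries.X ^ 2 * (Φ ^ k * G)) +
        (k : ℂ) * L m (PowerSeries.X ^ 2 * (Φ ^ (k - 1) * (F * P)))) := by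
    intro m k
    have h1 : Φ ^ k * (F * (P + Z)) = Φ ^ k * (F * P) + Z * F * Φ ^ k := by ring
    have h2 : PowerSeries.X ^ 2 * (G * Φ ^ k + (k : PowerSeries A) * (Φ ^ (k - 1) * P * F)) =
        PowerSeries.X ^ 2 * (Φ ^ k * G) +
          (k : ℂ) • (PowerSeries.X ^ 2 * (Φ ^ (k - 1) * (F * P))) := by
      rw [Nat.cast_smul_eq_nsmul, nsmul_eq_mul]
      ring
    rw [h1, map_add, mul_add, key, h2, map_add, map_smul, smul_eq_mul]
  induction j with
  | zero =>
    have := hk (p + 2 * 0) 0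
    simp only [zero_add, Finset.sum_range_one, pow_zero, Nat.factorial_zero, Nat.cast_one, div_one,
      one_mul, Nat.cast_zero, zero_mul, add_zero] at this ⊢
    rw [this, add_comm]
  | succ j ih =>
    rw [Finset.sum_range_succ, mul_add, ih, Finset.sum_range_succ _ (j + 1)]
    have h1 := hk (p + 2 * (j + 1)) (j + 1)
    have h2 : L (p + 2 * (j + 1)) (PowerSeries.X ^ 2 * (Φ ^ (j + 1 - 1) * (F * P))) =
        L (p + 2 * j) (Φ ^ j * (F * P)) := functional_X_pow_mul hX (p + 2 * j) 2 _
    have h3 : (-N) ^ (j + 1) / ((j + 1).factorial : ℂ) * ((j + 1 : ℕ) : ℂ) =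
        -N * ((-N) ^ j / (j.factorial : ℂ)) := by
      have : ((j + 1 : ℕ) : ℂ) ≠ 0 := Nat.cast_ne_zero.2 (Nat.succ_ne_zero j)
      have : (j.factorial : ℂ) ≠ 0 := Nat.cast_ne_zero.2 (Nat.factorial_ne_zero j)
      rw [Nat.factorial_succ, Nat.cast_mul, pow_succ]
      field_simp
    rw [h2] at h1
    linear_combination (-N) ^ (j + 1) / ((j + 1).factorial : ℂ) * h1 +
      L (p + 2 * j) (Φ ^ j * (F * P)) * h3

variable (hΦ : PowerSeries.X ^ 3 ∣ Φ) (hP : PowerSeries.X ∣ P)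
include key hΦ hP

lemma expandedCoeff_loop_aux (p : ℕ) :
    N * expandedCoeff L N Φ p (F * (P + Z)) =
      ∑ k ∈ Finset.range (p + 1), (-N) ^ k / (k.factorial : ℂ) *
        L (p + 2 * k) (PowerSeries.X ^ 2 * (Φ ^ k * G)) := by
  have h : L (p + 2 * p) (Φ ^ p * (F * P)) = 0 := by
    -- The remaining term has order at least `3p + 1` in `s`, while the coefficient of `s^{3p}` is
    -- read off.
    refine functional_eq_zero_of_lt hX hX0 (show p + 2 * p < 3 * p + 1 by omega) ?_
    rw [pow_succ, pow_mul]
    exact mul_dvd_mul (pow_dvd_pow_of_dvd hΦ p) (hP.mul_left F)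
  rw [expandedCoeff, partial_sum_loop hX key, h, mul_zero, mul_zero, add_zero]

lemma expandedCoeff_loop (q : ℕ) :
    N * expandedCoeff L N Φ (q + 2) (F * (P + Z)) = expandedCoeff L N Φ q G := by
  -- The factor `s²` shifts `q + 2` to `q`, which leaves two terms too many, `k = q + 1` and `k = q
  -- + 2`. Both vanish, `Φ^k` being of order at least `3k > q + 2k`.
  rw [expandedCoeff_loop_aux hX hX0 key hΦ hP, expandedCoeff, show q + 2 + 1 = q + 1 + 2 by ring,
    Finset.sum_range_succ, Finset.sum_range_succ]
  have h : ∀ k, L (q + 2 + 2 * k) (PowerSeries.X ^ 2 * (Φ ^ k * G)) =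
      L (q + 2 * k) (Φ ^ k * G) := fun k => by
    rw [← functional_X_pow_mul hX (q + 2 * k) 2, show q + 2 * k + 2 = q + 2 + 2 * k by ring]
  have h' : ∀ k, q < k → L (q + 2 * k) (Φ ^ k * G) = 0 := fun k hk => by
    refine functional_eq_zero_of_lt hX hX0 (show q + 2 * k < 3 * k by omega) ?_
    rw [pow_mul]
    exact (pow_dvd_pow_of_dvd hΦ k).mul_right G
  simp_rw [h]
  rw [h' (q + 1) (by omega), h' (q + 1 + 1) (by omega), mul_zero, mul_zero, add_zero, add_zero]

lemma expandedCoeff_loop_zero : N * expandedCoeff L N Φ 0 (F * (P + Z)) = 0 := by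
  rw [expandedCoeff_loop_aux hX hX0 key hΦ hP, zero_add, Finset.sum_range_one,
    functional_eq_zero_of_lt hX hX0 (show 0 + 2 * 0 < 2 by omega) (Dvd.intro _ rfl), mul_zero]

end FormalSum

/-! ### The formal action and its forces near the critical points -/

section FormalDivergence

variable {d : ℕ} {V : Polynomial ℂ} {ξ : Fin d → ℂ} {n : Fin d → ℕ}
variable {A A' : Type*} [CommRing A] [Algebra ℂ A] [CommRing A'] [Algebra ℂ A'] [Algebra A A']
  [IsScalarTower ℂ A A']

lemma aeval_affineMatrix_of_dvd {ι : Type*} [Fintype ι] [DecidableEq ι] {x : ℂ} {k : ℕ}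
    {p : Polynomial ℂ} (hp : (Polynomial.X - Polynomial.C x) ^ k ∣ p) (K : Matrix ι ι A) :
    ∃ Q : Matrix ι ι (PowerSeries A),
      Polynomial.aeval (affineMatrix x K) p = (PowerSeries.X : PowerSeries A) ^ k • Q := by
  obtain ⟨r, rfl⟩ := hp
  refine ⟨K.map (algebraMap A (PowerSeries A)) ^ k * Polynomial.aeval (affineMatrix x K) r, ?_⟩
  rw [map_mul, map_pow, map_sub, Polynomial.aeval_X, Polynomial.aeval_C, affineMatrix,
    add_sub_cancel_left, smul_pow, smul_mul_assoc]

lemma derivative_nonGaussian (i : Fin d) :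
    (nonGaussian V ξ i).derivative = V.derivative -
      Polynomial.C (V.derivative.derivative.eval (ξ i)) *
        (Polynomial.X - Polynomial.C (ξ i)) := by
  simp only [nonGaussian, Polynomial.derivative_sub, Polynomial.derivative_C, sub_zero,
    Polynomial.derivative_mul, zero_mul, zero_add, Polynomial.derivative_X_sub_C_pow]
  rw [div_eq_mul_inv, Polynomial.C_mul]
  have h2 : Polynomial.C (2⁻¹ : ℂ) * Polynomial.C ((2 : ℕ) : ℂ) = 1 := by
    rw [← Polynomial.C_mul]
    norm_num
  simp only [Nat.add_one_sub_one, pow_one]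
  linear_combination -(Polynomial.C (Polynomial.eval (ξ i) V.derivative.derivative) * (Polynomial.X - Polynomial.C (ξ i)))* h2

/-- The value and the second derivative at `ξ_i` are subtracted, and the first derivative vanishes
because `ξ_i` is critical. -/
lemma dvd_nonGaussian {i : Fin d} (h : V.derivative.eval (ξ i) = 0) :
    (Polynomial.X - Polynomial.C (ξ i)) ^ 3 ∣ nonGaussian V ξ i := by
  by_cases h0 : nonGaussian V ξ i = 0
  · rw [h0]
    exact dvd_zero _
  refine (Polynomial.le_rootMultiplicity_iff h0).1
    (Polynomial.lt_rootMultiplicity_of_isRoot_iterate_derivative h0 fun m hm => ?_)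
  interval_cases m
  · simp [nonGaussian]
  · simp [derivative_nonGaussian, h]
  · simp [derivative_nonGaussian]

lemma dvd_derivative_nonGaussian {i : Fin d} (h : V.derivative.eval (ξ i) = 0) :
    (Polynomial.X - Polynomial.C (ξ i)) ^ 1 ∣ (nonGaussian V ξ i).derivative := by
  rw [pow_one, Polynomial.dvd_iff_isRoot]
  simp [derivative_nonGaussian, h]

variable (K : ∀ i, Matrix (Fin (n i)) (Fin (n i)) A)

/-- The blocks `M_i = ξ_i + s K_i`. -/
abbrev affineBlocks (ξ : Fin d → ℂ) (K : ∀ i, Matrix (Fin (n i)) (Fin (n i)) A) (i : Fin d) :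
    Matrix (Fin (n i)) (Fin (n i)) (PowerSeries A) := affineMatrix (ξ i) (K i)

lemma dvd_interaction (h : ∀ i, V.derivative.eval (ξ i) = 0) :
    (PowerSeries.X : PowerSeries A) ^ 3 ∣ interaction V ξ (affineBlocks ξ K) := by
  refine Finset.dvd_sum fun i _ => ?_
  obtain ⟨Q, hQ⟩ := aeval_affineMatrix_of_dvd (dvd_nonGaussian (h i)) (K i)
  rw [hQ, Matrix.trace_smul]
  exact Dvd.intro _ rfl

/-- `∑_i Tr δV_i'(M_i) w(M_i)`. -/
def interactionForce (V : Polynomial ℂ) (ξ : Fin d → ℂ) {R : Type*} [CommRing R] [Algebra ℂ R]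
    (M : ∀ i, Matrix (Fin (n i)) (Fin (n i)) R) (w : Word S) : R :=
  ∑ i, Matrix.trace (Polynomial.aeval (M i) (nonGaussian V ξ i).derivative * wordEval (M i) w)

/-- `∑_i V''(ξ_i) Tr (M_i - ξ_i) w(M_i)`. -/
def gaussianForce (V : Polynomial ℂ) (ξ : Fin d → ℂ) {R : Type*} [CommRing R] [Algebra ℂ R]
    (M : ∀ i, Matrix (Fin (n i)) (Fin (n i)) R) (w : Word S) : R :=
  ∑ i, V.derivative.derivative.eval (ξ i) • Matrix.trace
    ((M i - algebraMap ℂ (Matrix (Fin (n i)) (Fin (n i)) R) (ξ i)) * wordEval (M i) w)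

/-- Block by block `V' = δV_i' + V''(ξ_i)(x - ξ_i)`. The Gaussian weight accounts for the second
part, the expanded exponential for the first. -/
lemma evalBlocks_trPolyMul_derivative {R : Type*} [CommRing R] [Algebra ℂ R]
    (M : ∀ i, Matrix (Fin (n i)) (Fin (n i)) R) (w : Word S) (f : Observable S) :
    evalBlocks M (trPolyMul V.derivative (Finsupp.single w f)) =
      evalBlocks M f * (interactionForce V ξ M w + gaussianForce V ξ M w) := by
  rw [evalBlocks_trPolyMul_single, interactionForce, gaussianForce, ← Finset.sum_add_distrib]
  congr 1
  refine Finset.sum_congr rfl fun i _ => ?_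
  rw [derivative_nonGaussian, ← Matrix.trace_smul, ← Matrix.trace_add, ← smul_mul_assoc, ← add_mul,
    map_sub, map_mul, map_sub, Polynomial.aeval_X, Polynomial.aeval_C, Polynomial.aeval_C,
    ← Algebra.smul_def, sub_add_cancel]

lemma dvd_interactionForce (h : ∀ i, V.derivative.eval (ξ i) = 0) (w : Word S) :
    (PowerSeries.X : PowerSeries A) ∣ interactionForce V ξ (affineBlocks ξ K) w := by
  refine Finset.dvd_sum fun i _ => ?_
  obtain ⟨Q, hQ⟩ := aeval_affineMatrix_of_dvd (dvd_derivative_nonGaussian (h i)) (K i)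
  rw [hQ, Matrix.smul_mul, Matrix.trace_smul, pow_one]
  exact Dvd.intro _ rfl

lemma gaussianForce_affineBlocks (w : Word S) :
    gaussianForce V ξ (affineBlocks ξ K) w = PowerSeries.X * ∑ i, ∑ a, ∑ b,
      wordEval (affineBlocks ξ K i) w a b *
        PowerSeries.C (V.derivative.derivative.eval (ξ i) • K i b a) := by
  rw [gaussianForce, Finset.mul_sum]
  refine Finset.sum_congr rfl fun i _ => ?_
  have h1 : affineBlocks ξ K i - algebraMap ℂ (Matrix (Fin (n i)) (Fin (n i)) (PowerSeries A)) (ξ i)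
      = (PowerSeries.X : PowerSeries A) • (K i).map (algebraMap A (PowerSeries A)) := by
    rw [affineBlocks, affineMatrix, add_sub_cancel_left]
  rw [h1, Matrix.smul_mul, Matrix.trace_smul, Matrix.trace_mul_comm, smul_eq_mul, ← mul_smul_comm]
  congr 1
  simp_rw [Matrix.trace, Matrix.diag_apply, Matrix.mul_apply, Matrix.map_apply, Finset.smul_sum]
  refine Finset.sum_congr rfl fun a _ => Finset.sum_congr rfl fun b _ => ?_
  rw [← mul_smul_comm]
  congr 1
  rw [Algebra.smul_def, Algebra.smul_def, PowerSeries.algebraMap_apply, map_mul]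
  rfl

variable {K} {D : ∀ i, Fin (n i) → Fin (n i) → Derivation ℂ A A'} (hξ : ∀ i, ξ i ∉ S)
  (hD : ∀ i a b, (K i).map (D i a b) = Matrix.single a b 1)
  (hD' : ∀ i j a b, j ≠ i → (K j).map (D i a b) = 0)

include hξ hD hD'

/-- This is `divergence_eq` with `Θ = s` and `g = f Φ^k`; besides `J`, the flow differentiates
`Φ^k`, and `Φ` changes by `s` times the interaction force. -/
lemma formal_divergence (w : Word S) (f : Observable S) (k : ℕ) :
    ∑ i, ∑ a, ∑ b, coeffDeriv (D i a b) (wordEval (affineBlocks ξ K i) w a b *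
      (blockVandermonde (affineBlocks ξ K) *
        (evalBlocks (affineBlocks ξ K) f * interaction V ξ (affineBlocks ξ K) ^ k))) =
      algebraMap (PowerSeries A) (PowerSeries A') (PowerSeries.X *
        ((blockVandermonde (affineBlocks ξ K) *
          evalBlocks (affineBlocks ξ K) (jacobian (Finsupp.single w f))) *
            interaction V ξ (affineBlocks ξ K) ^ k + (k : PowerSeries A) *
          (interaction V ξ (affineBlocks ξ K) ^ (k - 1) *
            interactionForce V ξ (affineBlocks ξ K) w *
            (blockVandermonde (affineBlocks ξ K) * evalBlocks (affineBlocks ξ K) f)))) := by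
  have hM : ∀ i, ResolventsExist S (affineBlocks ξ K i) := fun i =>
    resolventsExist_affineMatrix (hξ i) _
  have h1 : ∀ i a b, (affineBlocks ξ K i).map (coeffDeriv (D i a b)) =
      (PowerSeries.X : PowerSeries A') • Matrix.single a b 1 := fun i a b => by
    rw [affineBlocks, map_coeffDeriv_affineMatrix, hD, Matrix.map_single, map_one]
  have h2 : ∀ i j a b, j ≠ i → (affineBlocks ξ K j).map (coeffDeriv (D i a b)) = 0 :=
    fun i j a b hij => by
      rw [affineBlocks, map_coeffDeriv_affineMatrix, hD' i j a b hij, Matrix.map_zero _ (map_zero _),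
        smul_zero]
  have hX : (PowerSeries.X : PowerSeries A') =
      algebraMap (PowerSeries A) (PowerSeries A') PowerSeries.X := by
    rw [PowerSeries.algebraMap_apply'', PowerSeries.map_X]
  have h3 : flow (affineBlocks ξ K) (fun i a b => coeffDeriv (D i a b)) w
      (interaction V ξ (affineBlocks ξ K)) = algebraMap (PowerSeries A) (PowerSeries A')
        (PowerSeries.X * interactionForce V ξ (affineBlocks ξ K) w) := by
    rw [interaction, map_sum, interactionForce, map_mul, map_sum, Finset.mul_sum, ← hX]
    exact Finset.sum_congr rfl fun i _ => flow_trace_aeval w h1 h2 _ i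
  rw [divergence_eq (D := fun i a b => coeffDeriv (D i a b)) w hM h1 h2, Derivation.leibniz,
    Derivation.leibniz_pow, h3, flow_evalBlocks w hM h1 h2, jacobian_single, hX]
  simp only [Algebra.smul_def, map_mul, map_add, map_pow, nsmul_eq_mul, map_natCast]
  ring

end FormalDivergence

/-! ### Formal matrix integrals -/

section Moments

variable {E : Type*} [NormedAddCommGroup E] [NormedSpace ℝ E] [FiniteDimensional ℝ E]
  [MeasureSpace E] [BorelSpace E] [(volume : Measure E).IsAddHaarMeasure]

/-- The integral of the coefficient of `s ^ m` against the weight `W`. -/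
def moment {W : E → ℂ} (hWc : Continuous W) (hW : RapidDecay W) (m : ℕ) :
    PowerSeries (polyGrowth E) →ₗ[ℂ] ℂ where
  toFun r := ∫ x, ((PowerSeries.coeff m r : polyGrowth E) : E → ℂ) x * W x
  map_add' r r' := by
    rw [← integral_add (integrable_polyGrowth_mul hWc hW _) (integrable_polyGrowth_mul hWc hW _)]
    congr 1
    funext x
    rw [map_add, Subalgebra.coe_add, Pi.add_apply, add_mul]
  map_smul' c r := by
    rw [RingHom.id_apply, smul_eq_mul, ← integral_const_mul]
    congr 1
    funext x
    rw [← mul_assoc]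
    rfl

variable {W : E → ℂ} (hWc : Continuous W) (hW : RapidDecay W)

lemma moment_apply (m : ℕ) (r : PowerSeries (polyGrowth E)) : moment hWc hW m r =
    ∫ x, ((PowerSeries.coeff m r : polyGrowth E) : E → ℂ) x * W x := rfl

lemma moment_succ_X_mul (m : ℕ) (r : PowerSeries (polyGrowth E)) :
    moment hWc hW (m + 1) (PowerSeries.X * r) = moment hWc hW m r := by
  rw [moment_apply, moment_apply, PowerSeries.coeff_succ_X_mul]

lemma moment_zero_X_mul (r : PowerSeries (polyGrowth E)) :
    moment hWc hW 0 (PowerSeries.X * r) = 0 := by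
  rw [moment_apply, PowerSeries.coeff_zero_X_mul]
  simp

lemma rapidDecay_of_norm_le {a : ℝ} (ha : 0 < a)
    (h : ∀ x, ‖W x‖ ≤ Real.exp (-(a * ‖x‖ ^ 2))) : RapidDecay W := by
  intro k
  -- `(1 + r)^k ≤ e^{kr}`, and `k r - a r²` has maximum `k²/(4a)`.
  refine ⟨Real.exp ((k : ℝ) ^ 2 / (4 * a)), fun x => ?_⟩
  have h1 : (1 + ‖x‖) ^ k ≤ Real.exp (k * ‖x‖) := by
    rw [Real.exp_nat_mul, add_comm]
    exact pow_le_pow_left₀ (by positivity) (Real.add_one_le_exp _) k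
  calc (1 + ‖x‖) ^ k * ‖W x‖ ≤ Real.exp (k * ‖x‖) * Real.exp (-(a * ‖x‖ ^ 2)) := by
        gcongr
        exact h x
    _ ≤ _ := by
        rw [← Real.exp_add, Real.exp_le_exp, le_div_iff₀ (by positivity)]
        nlinarith [sq_nonneg (2 * a * ‖x‖ - k)]

end Moments

/-! ### The Gaussian weight and the coefficients of the formal integral -/

section FormalIntegral

variable {d : ℕ} {n : Fin d → ℕ}

lemma isAddHaarMeasure_pi {ι : Type*} [Fintype ι] {E : ι → Type*} [∀ i, NormedAddCommGroup (E i)]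
    [∀ i, MeasureSpace (E i)] [∀ i, MeasurableAdd (E i)]
    [∀ i, SigmaFinite (volume : Measure (E i))]
    (h : ∀ i, (volume : Measure (E i)).IsAddHaarMeasure) :
    (volume : Measure (∀ i, E i)).IsAddHaarMeasure := inferInstance

instance : (volume : Measure (Coords n)).IsAddHaarMeasure :=
  isAddHaarMeasure_pi fun _ => isAddHaarMeasure_pi fun _ => isAddHaarMeasure_pi fun _ =>
    inferInstance

variable (V : Polynomial ℂ) (ξ ω : Fin d → ℂ)

/-- The fluctuations `ω_i A_i`, with functions of the coordinates as entries. -/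
def fluctuation (i : Fin d) : Matrix (Fin (n i)) (Fin (n i)) (polyGrowth (Coords n)) :=
  ω i • hermitianBlock (ContinuousLinearMap.proj i : Coords n →L[ℝ] (Fin (n i) → Fin (n i) → ℝ))

lemma map_growthEval_fluctuation (B : Coords n) (i : Fin d) :
    (fluctuation ω i).map (growthEval (Coords n) B) = ω i • hermitian (B i) := rfl

/-- The Gaussian part of the action. -/
def gaussianAction : polyGrowth (Coords n) :=
  (((∑ i, n i : ℕ) : ℂ) / 2) •
    ∑ i, V.derivative.derivative.eval (ξ i) • Matrix.trace (fluctuation ω i ^ 2)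

lemma expWeight_gaussianAction :
    expWeight ((gaussianAction V ξ ω : polyGrowth (Coords n)) : Coords n → ℂ) =
      gaussianWeight V ξ ω := by
  funext B
  rw [expWeight, ← growthEval_apply, gaussianAction, map_smul, map_sum, gaussianWeight, smul_eq_mul,
    ← neg_mul]
  congr 2
  refine Finset.sum_congr rfl fun i _ => ?_
  rw [map_smul, smul_eq_mul, AddMonoidHom.map_trace, ← map_growthEval_fluctuation,
    ← AlgHom.mapMatrix_apply, ← AlgHom.mapMatrix_apply, map_pow]

lemma gaussianWeight_eq_exp (B : Coords n) :
    gaussianWeight V ξ ω B = Complex.exp (∑ i, ∑ a, ∑ b,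
      -((((∑ i, n i : ℕ) : ℂ) / 2 * (V.derivative.derivative.eval (ξ i) * ω i ^ 2)) *
        (if a = b then 1 else 2)) * (B i a b : ℂ) ^ 2) := by
  rw [gaussianWeight, Finset.mul_sum]
  congr 1
  refine Finset.sum_congr rfl fun i _ => ?_
  rw [smul_pow, Matrix.trace_smul, trace_hermitian_sq]
  push_cast
  rw [smul_eq_mul, Finset.mul_sum, Finset.mul_sum, Finset.mul_sum]
  refine Finset.sum_congr rfl fun a _ => ?_
  rw [Finset.mul_sum, Finset.mul_sum, Finset.mul_sum]
  refine Finset.sum_congr rfl fun b _ => ?_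
  split_ifs <;> push_cast <;> ring

lemma gaussianWeight_neg (B : Coords n) :
    gaussianWeight V ξ ω (-B) = gaussianWeight V ξ ω B := by
  simp [gaussianWeight_eq_exp]

lemma integral_comp_neg {E : Type*} [NormedAddCommGroup E] [NormedSpace ℝ E] [FiniteDimensional ℝ E]
    [MeasureSpace E] [BorelSpace E] [(volume : Measure E).IsAddHaarMeasure] (g : E → ℂ) :
    ∫ x, g (-x) = ∫ x, g x := integral_neg_eq_self g volume

variable {V ξ ω} (hω : ∀ i, 0 < (V.derivative.derivative.eval (ξ i) * ω i ^ 2).re)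

include hω in
lemma rapidDecay_gaussianWeight : RapidDecay (gaussianWeight (n := n) V ξ ω) := by
  -- For `N = 0` the exponent is zero, but the space of coordinates is a point.
  by_cases hN : ∑ i, n i = 0
  · have hn : ∀ i, n i = 0 := fun i => Finset.sum_eq_zero_iff.1 hN i (Finset.mem_univ i)
    have : Subsingleton (Coords n) := ⟨fun B B' => by
      funext i a
      exact absurd ((Nat.zero_le _).trans_lt a.2) (hn i).not_gt⟩
    exact fun k => ⟨(1 + ‖(0 : Coords n)‖) ^ k * ‖gaussianWeight (n := n) V ξ ω 0‖, fun B => by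
      rw [Subsingleton.elim B 0]⟩
  · obtain ⟨i₀, -, -⟩ := Finset.exists_ne_zero_of_sum_ne_zero hN
    have : Nonempty (Fin d) := ⟨i₀⟩
    obtain ⟨j, hj⟩ := Finite.exists_min
      fun i => (V.derivative.derivative.eval (ξ i) * ω i ^ 2).re
    have hN' : (0 : ℝ) < (∑ i, n i : ℕ) := Nat.cast_pos.2 (Nat.pos_of_ne_zero hN)
    -- The rate is `N/2` times the smallest of the numbers `Re (V''(ξ_i) ω_i²)`.
    refine rapidDecay_of_norm_le (a := ((∑ i, n i : ℕ) : ℝ) / 2 *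
      (V.derivative.derivative.eval (ξ j) * ω j ^ 2).re)
      (mul_pos (half_pos hN') (hω j)) fun B => ?_
    rw [gaussianWeight, Complex.norm_exp, Real.exp_le_exp]
    have h1 : (-(((∑ i, n i : ℕ) : ℂ) / 2) * ∑ i, V.derivative.derivative.eval (ξ i) *
        Matrix.trace ((ω i • hermitian (B i)) ^ 2)).re = -(((∑ i, n i : ℕ) : ℝ) / 2 *
        ∑ i, (V.derivative.derivative.eval (ξ i) * ω i ^ 2).re *
          ∑ a, ∑ b, (if a = b then 1 else 2) * B i a b ^ 2) := by
      have h2 : (-(((∑ i, n i : ℕ) : ℂ) / 2)) = ((-(((∑ i, n i : ℕ) : ℝ) / 2) : ℝ) : ℂ) := by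
        push_cast
        ring
      rw [h2, Complex.re_ofReal_mul, Complex.re_sum, neg_mul]
      congr 3
      funext i
      rw [smul_pow, Matrix.trace_smul, trace_hermitian_sq, smul_eq_mul, ← mul_assoc,
        Complex.re_mul_ofReal]
    rw [h1, neg_le_neg_iff, mul_assoc]
    refine mul_le_mul_of_nonneg_left ?_ (half_pos hN').le
    have h3 : ‖B‖ ^ 2 ≤ ∑ i, ‖B i‖ ^ 2 := by
      refine (Real.le_sqrt (norm_nonneg _) (by positivity)).1 ?_
      refine (pi_norm_le_iff_of_nonneg (Real.sqrt_nonneg _)).2 fun i => ?_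
      refine (Real.le_sqrt (norm_nonneg _) (by positivity)).2 ?_
      exact Finset.single_le_sum (f := fun i => ‖B i‖ ^ 2) (fun i _ => sq_nonneg _)
        (Finset.mem_univ i)
    calc _ ≤ _ := mul_le_mul_of_nonneg_left h3 (hω j).le
      _ = ∑ i, (V.derivative.derivative.eval (ξ j) * ω j ^ 2).re * ‖B i‖ ^ 2 := Finset.mul_sum _ _ _
      _ ≤ _ := Finset.sum_le_sum fun i _ => mul_le_mul (hj i)
        ((norm_sq_le_sum_sq (B i)).trans (sum_sq_le_trace_coeff (B i))) (sq_nonneg _) (hω i).le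

lemma continuous_gaussianWeight : Continuous (gaussianWeight (n := n) V ξ ω) := by
  rw [← expWeight_gaussianAction]
  exact (contDiff_expWeight (gaussianAction V ξ ω).2).continuous

/-- The integral of the coefficient of `s ^ m` against the Gaussian weight. -/
abbrev gaussianMoment (n : Fin d → ℕ) : ℕ → PowerSeries (polyGrowth (Coords n)) →ₗ[ℂ] ℂ :=
  moment (continuous_gaussianWeight (n := n)) (rapidDecay_gaussianWeight hω)

section Expansion

variable (hξ : ∀ i, ξ i ∉ S)
include hξ

lemma coeff_formalIntegrand (k p : ℕ) (f : Observable S) (B : Coords n) :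
    PowerSeries.coeff p (formalIntegrand V ξ ω k f B) =
      ((PowerSeries.coeff p (formalExpr V ξ k f (affineBlocks ξ (fluctuation (n := n) ω))) :
        polyGrowth (Coords n)) : Coords n → ℂ) B := by
  have h1 : ∀ i, (affineBlocks ξ (fluctuation (n := n) ω) i).map
      (PowerSeries.mapAlgHom (growthEval (Coords n) B)) = block ξ ω B i := fun i => by
    rw [affineBlocks, map_mapAlgHom_affineMatrix, map_growthEval_fluctuation, block_eq_affineMatrix]
  have h2 := map_formalExpr V ξ (PowerSeries.mapAlgHom (growthEval (Coords n) B))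
    (M := affineBlocks ξ (fluctuation (n := n) ω))
    (fun i => resolventsExist_affineMatrix (hξ i) _) k f
  rw [funext h1] at h2
  rw [formalIntegrand_eq V ω hξ, ← h2, ← growthEval_apply, PowerSeries.mapAlgHom_apply,
    PowerSeries.coeff_map]
  rfl

include hω in
theorem integrable_formalIntegrand (k p : ℕ) (f : Observable S) :
    Integrable fun B : Coords n => PowerSeries.coeff p (formalIntegrand V ξ ω k f B) *
      gaussianWeight V ξ ω B := by
  simp_rw [coeff_formalIntegrand hξ]
  exact integrable_polyGrowth_mul continuous_gaussianWeight (rapidDecay_gaussianWeight hω) _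

/-- Under `B ↦ -B` the Gaussian weight is even and the coefficient of an odd power of `s` is odd. -/
theorem formalCoeff_of_odd {p : ℕ} (hp : Odd p) (f : Observable S) :
    formalCoeff V ξ ω n p f = 0 := by
  refine Finset.sum_eq_zero fun k _ => ?_
  have h : ∫ B : Coords n, PowerSeries.coeff (p + 2 * k) (formalIntegrand V ξ ω k f B) *
      gaussianWeight V ξ ω B = 0 := by
    have h1 := integral_comp_neg fun B : Coords n =>
      PowerSeries.coeff (p + 2 * k) (formalIntegrand V ξ ω k f B) * gaussianWeight V ξ ω B
    have h2 : (-1 : ℂ) ^ (p + 2 * k) = -1 := (hp.add_even (even_two_mul k)).neg_one_pow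
    simp only [coeff_formalIntegrand_neg V ω hξ, gaussianWeight_neg, h2, neg_mul, one_mul,
      integral_neg] at h1
    exact self_eq_neg.1 h1.symm
  rw [h, mul_zero]

lemma formalCoeff_eq_expandedCoeff (p : ℕ) (f : Observable S) :
    formalCoeff V ξ ω n p f = expandedCoeff (gaussianMoment hω n) (∑ i, n i : ℕ)
      (interaction V ξ (affineBlocks ξ (fluctuation (n := n) ω))) p
      (blockVandermonde (affineBlocks ξ (fluctuation (n := n) ω)) *
        evalBlocks (affineBlocks ξ (fluctuation (n := n) ω)) f) := by
  refine Finset.sum_congr rfl fun k _ => ?_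
  congr 1
  rw [moment_apply]
  congr 1
  funext B
  rw [coeff_formalIntegrand hξ, formalExpr]

end Expansion

end FormalIntegral

/-! ### Loop equations for the formal integral -/

section FormalLoop

variable {d : ℕ} {n : Fin d → ℕ} {V : Polynomial ℂ} {ξ ω : Fin d → ℂ}
  (hω : ∀ i, 0 < (V.derivative.derivative.eval (ξ i) * ω i ^ 2).re)

include hω in
lemma direction_ne_zero (i : Fin d) : ω i ≠ 0 := by
  intro h
  have := hω i
  rw [h] at this
  simp at this

lemma derivation_gaussianAction {A' : Type*} [CommRing A'] [Algebra ℂ A']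
    [Algebra (polyGrowth (Coords n)) A'] [IsScalarTower ℂ (polyGrowth (Coords n)) A']
    {D : ∀ i, Fin (n i) → Fin (n i) → Derivation ℂ (polyGrowth (Coords n)) A'}
    (hD : ∀ i a b, (fluctuation ω i).map (D i a b) = Matrix.single a b 1)
    (hD' : ∀ i j a b, j ≠ i → (fluctuation ω j).map (D i a b) = 0) (i : Fin d)
    (a b : Fin (n i)) :
    D i a b (gaussianAction V ξ ω) = algebraMap (polyGrowth (Coords n)) A'
      (((∑ i, n i : ℕ) : ℂ) • (V.derivative.derivative.eval (ξ i) • fluctuation ω i b a)) := by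
  have h1 : D i a b (Matrix.trace (fluctuation ω i ^ 2)) =
      algebraMap (polyGrowth (Coords n)) A' ((2 : ℂ) • fluctuation ω i b a) := by
    have := derivation_trace_aeval_of_single (D i a b) (M := fluctuation ω i) (Θ := 1) (a := a)
      (b := b) (by rw [hD, one_smul]) (Polynomial.X ^ 2)
    rw [map_pow, Polynomial.aeval_X, one_mul] at this
    rw [this]
    congr 1
    simp only [Polynomial.derivative_X_pow, map_mul, Polynomial.aeval_C, Polynomial.aeval_X,
      ← Algebra.smul_def, Nat.add_one_sub_one, pow_one, Matrix.smul_apply, Nat.cast_ofNat]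
  have h2 : ∀ j, j ≠ i → D i a b (Matrix.trace (fluctuation ω j ^ 2)) = 0 := fun j hj => by
    have := derivation_trace_aeval (D i a b) (fluctuation ω j) (Polynomial.X ^ 2)
    rw [map_pow, Polynomial.aeval_X, hD' i j a b hj, Matrix.mul_zero, Matrix.trace_zero] at this
    exact this
  rw [gaussianAction]
  generalize ((∑ i, n i : ℕ) : ℂ) = c
  rw [Derivation.map_smul, map_sum, Finset.sum_eq_single i, Derivation.map_smul, h1]
  · have hsm : ∀ (c : ℂ) (x : polyGrowth (Coords n)), algebraMap (polyGrowth (Coords n)) A' (c • x) =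
        c • algebraMap (polyGrowth (Coords n)) A' x := fun c x =>
      map_smul (IsScalarTower.toAlgHom ℂ (polyGrowth (Coords n)) A') c x
    rw [hsm, hsm, hsm, smul_comm _ (2 : ℂ), smul_smul, div_mul_cancel₀ _ two_ne_zero]
  · intro j _ hj
    rw [Derivation.map_smul, h2 j hj, smul_zero]
  · simp

/-- The factor `ω_i⁻¹` compensates the direction `ω_i`, so that `ω_i A_i` is moved exactly by a
matrix unit. -/
lemma exists_fluctuation_derivations (n : Fin d → ℕ) (hω' : ∀ i, ω i ≠ 0) :
    ∃ v v' : ∀ i, Fin (n i) → Fin (n i) → Coords n,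
      (∀ i a b, (fluctuation ω i).map (polyDeriv (Coords n) (ω i)⁻¹ (v i a b) (v' i a b)) =
        Matrix.single a b 1) ∧
      ∀ i j a b, j ≠ i →
        (fluctuation ω j).map (polyDeriv (Coords n) (ω i)⁻¹ (v i a b) (v' i a b)) = 0 := by
  choose v v' hv using fun i (a b : Fin (n i)) => exists_hermitian_add_I_smul a b
  have h1 : ∀ (i : Fin d) (D : Derivation ℂ (polyGrowth (Coords n)) (Coords n → ℂ)),
      (fluctuation ω i).map D = ω i • (hermitianBlock
        (ContinuousLinearMap.proj i : Coords n →L[ℝ] (Fin (n i) → Fin (n i) → ℝ))).map D := by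
    intro i D
    ext1 a b
    exact D.map_smul _ _
  refine ⟨fun i a b => Pi.single i (v i a b), fun i a b => Pi.single i (v' i a b), fun i a b => ?_,
    fun i j a b hij => ?_⟩
  · rw [h1, map_polyDeriv_hermitianBlock (a := a) (b := b)]
    · rw [algebraMap_smul (Coords n → ℂ), smul_smul, mul_inv_cancel₀ (hω' i), one_smul]
    · simpa using hv i a b
  · rw [h1, map_polyDeriv_hermitianBlock_of_eq_zero, smul_zero]
    · simp [hij]
    · simp [hij]

variable (hξ : ∀ i, ξ i ∉ S)
include hξ

/-- Gaussian integration by parts, in the form `key` needed for telescoping. One factor `s` comes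
from `M_i - ξ_i = s ω_i A_i` in the force, which makes up for the derivative of the Gaussian action
being free of `s`; the other is the `Θ = s` of the divergence. -/
lemma moment_loop {M : ∀ i, Matrix (Fin (n i)) (Fin (n i)) (PowerSeries (polyGrowth (Coords n)))}
    (hM : M = affineBlocks ξ (fluctuation ω)) (w : Word S) (f : Observable S) (m k : ℕ) :
    ((∑ i, n i : ℕ) : ℂ) * gaussianMoment hω n m
      (gaussianForce V ξ M w *
        (blockVandermonde M *
          evalBlocks M f) *
        interaction V ξ M ^ k) =
    gaussianMoment hω n m (PowerSeries.X ^ 2 *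
        ((blockVandermonde M *
          evalBlocks M (jacobian (Finsupp.single w f))) *
            interaction V ξ M ^ k +
          (k : PowerSeries (polyGrowth (Coords n))) *
          (interaction V ξ M ^ (k - 1) *
            interactionForce V ξ M w *
            (blockVandermonde M *
              evalBlocks M f)))) := by
  obtain ⟨v, v', hD, hD'⟩ := exists_fluctuation_derivations n (direction_ne_zero hω)
  have hdiv := formal_divergence (V := V) (K := fluctuation ω)
    (D := fun i a b => polyDeriv (Coords n) (ω i)⁻¹ (v i a b) (v' i a b)) hξ hD hD' w f k
  rw [← hM] at hdiv
  set G := blockVandermonde M * (evalBlocks M f * interaction V ξ M ^ k) with hG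
  set H := (blockVandermonde M * evalBlocks M (jacobian (Finsupp.single w f))) *
    interaction V ξ M ^ k + (k : PowerSeries (polyGrowth (Coords n))) *
      (interaction V ξ M ^ (k - 1) * interactionForce V ξ M w *
        (blockVandermonde M * evalBlocks M f)) with hH
  have hZ : gaussianForce V ξ M w * (blockVandermonde M * evalBlocks M f) * interaction V ξ M ^ k =
      PowerSeries.X * ∑ i, ∑ a, ∑ b, wordEval (M i) w a b * G *
        PowerSeries.C (V.derivative.derivative.eval (ξ i) • fluctuation ω i b a) := by
    have hZ' := gaussianForce_affineBlocks (V := V) (ξ := ξ) (fluctuation (n := n) ω) w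
    rw [← hM] at hZ'
    rw [hZ', mul_assoc, mul_assoc, hG, mul_assoc, Finset.sum_mul]
    congr 1
    refine Finset.sum_congr rfl fun i _ => ?_
    rw [Finset.sum_mul]
    refine Finset.sum_congr rfl fun a _ => ?_
    rw [Finset.sum_mul]
    exact Finset.sum_congr rfl fun b _ => by ring
  rw [hZ, pow_two, mul_assoc]
  -- Both sides are multiples of `s`: there is nothing to prove for `m = 0`, and otherwise one
  -- factor is removed.
  cases m with
  | zero => rw [moment_zero_X_mul, moment_zero_X_mul, mul_zero]
  | succ m =>
    rw [moment_succ_X_mul, moment_succ_X_mul, moment_apply, moment_apply]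
    have hIBP := integral_sum_polyDeriv_mul (gaussianAction V ξ ω : polyGrowth (Coords n))
      (by rw [expWeight_gaussianAction]; exact rapidDecay_gaussianWeight hω)
      (J := Σ i, Fin (n i) × Fin (n i)) (fun j => (ω j.1)⁻¹) (fun j => v j.1 j.2.1 j.2.2)
      (fun j => v' j.1 j.2.1 j.2.2)
      (fun j => PowerSeries.coeff m (wordEval (M j.1) w j.2.1 j.2.2 * G))
    rw [expWeight_gaussianAction] at hIBP
    have hL : ∑ j : Σ i, Fin (n i) × Fin (n i), polyDeriv (Coords n) (ω j.1)⁻¹ (v j.1 j.2.1 j.2.2)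
        (v' j.1 j.2.1 j.2.2) (PowerSeries.coeff m (wordEval (M j.1) w j.2.1 j.2.2 * G)) =
        algebraMap (polyGrowth (Coords n)) (Coords n → ℂ)
          (PowerSeries.coeff m (PowerSeries.X * H)) := by
      have := congrArg (PowerSeries.coeff m) hdiv
      rw [PowerSeries.algebraMap_apply'', PowerSeries.coeff_map] at this
      rw [← this, Fintype.sum_sigma, map_sum]
      refine Finset.sum_congr rfl fun i _ => ?_
      rw [Fintype.sum_prod_type, map_sum]
      refine Finset.sum_congr rfl fun a _ => ?_
      rw [map_sum]
      exact Finset.sum_congr rfl fun b _ => (coeff_coeffDeriv _ _ _).symm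
    have hR : ∑ j : Σ i, Fin (n i) × Fin (n i), algebraMap (polyGrowth (Coords n)) (Coords n → ℂ)
        (PowerSeries.coeff m (wordEval (M j.1) w j.2.1 j.2.2 * G)) *
          polyDeriv (Coords n) (ω j.1)⁻¹ (v j.1 j.2.1 j.2.2) (v' j.1 j.2.1 j.2.2)
            (gaussianAction V ξ ω) = ((∑ i, n i : ℕ) : ℂ) •
        algebraMap (polyGrowth (Coords n)) (Coords n → ℂ) (PowerSeries.coeff m
          (∑ i, ∑ a, ∑ b, wordEval (M i) w a b * G *
            PowerSeries.C (V.derivative.derivative.eval (ξ i) • fluctuation ω i b a))) := by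
      rw [Fintype.sum_sigma, map_sum, map_sum, Finset.smul_sum]
      refine Finset.sum_congr rfl fun i _ => ?_
      rw [Fintype.sum_prod_type, map_sum, map_sum, Finset.smul_sum]
      refine Finset.sum_congr rfl fun a _ => ?_
      rw [map_sum, map_sum, Finset.smul_sum]
      refine Finset.sum_congr rfl fun b _ => ?_
      rw [derivation_gaussianAction (D := fun i a b =>
        polyDeriv (Coords n) (ω i)⁻¹ (v i a b) (v' i a b)) hD hD', PowerSeries.coeff_mul_C,
        ← map_mul, mul_smul_comm]
      rfl
    rw [hL, hR] at hIBP
    rw [← integral_const_mul]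
    refine Eq.trans ?_ hIBP.symm
    congr 1
    funext B
    rw [Pi.smul_apply, smul_eq_mul, mul_assoc]
    rfl

variable (hV : ∀ i, V.derivative.eval (ξ i) = 0)
include hω hV

lemma formalCoeff_loop (w : Word S) (f : Observable S) (q : ℕ) :
    ((∑ i, n i : ℕ) : ℂ) *
      formalCoeff V ξ ω n (q + 2) (trPolyMul V.derivative (Finsupp.single w f)) =
        formalCoeff V ξ ω n q (jacobian (Finsupp.single w f)) := by
  rw [formalCoeff_eq_expandedCoeff hω hξ, formalCoeff_eq_expandedCoeff hω hξ,
    evalBlocks_trPolyMul_derivative (ξ := ξ), ← mul_assoc]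
  refine expandedCoeff_loop (L := gaussianMoment hω n)
    (F := blockVandermonde (affineBlocks ξ (fluctuation (n := n) ω)) *
      evalBlocks (affineBlocks ξ (fluctuation (n := n) ω)) f)
    (Z := gaussianForce V ξ (affineBlocks ξ (fluctuation (n := n) ω)) w) (moment_succ_X_mul _ _) (moment_zero_X_mul _ _)
    (moment_loop hω hξ rfl w f) (dvd_interaction _ hV) (dvd_interactionForce _ hV w) q

lemma formalCoeff_loop_zero (w : Word S) (f : Observable S) :
    ((∑ i, n i : ℕ) : ℂ) *
      formalCoeff V ξ ω n 0 (trPolyMul V.derivative (Finsupp.single w f)) = 0 := by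
  rw [formalCoeff_eq_expandedCoeff hω hξ, evalBlocks_trPolyMul_derivative (ξ := ξ), ← mul_assoc]
  refine expandedCoeff_loop_zero (L := gaussianMoment hω n)
    (F := blockVandermonde (affineBlocks ξ (fluctuation (n := n) ω)) *
      evalBlocks (affineBlocks ξ (fluctuation (n := n) ω)) f)
    (Z := gaussianForce V ξ (affineBlocks ξ (fluctuation (n := n) ω)) w)
    (G := blockVandermonde (affineBlocks ξ (fluctuation (n := n) ω)) *
      evalBlocks (affineBlocks ξ (fluctuation (n := n) ω)) (jacobian (Finsupp.single w f))) (moment_succ_X_mul _ _) (moment_zero_X_mul _ _)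
    (moment_loop hω hξ rfl w f) (dvd_interaction _ hV) (dvd_interactionForce _ hV w)

theorem loopEquations_formalIntegral :
    LoopEquations (S := S) V (∑ i, n i) (PowerSeries.X : PowerSeries ℂ)
      (mean (formalIntegral V ξ ω n)) := by
  refine loopEquations_mean _ (fun f g => ?_) fun w f => ?_
  · ext q
    simp only [formalIntegral, PowerSeries.coeff_mk, map_add, formalCoeff_eq_expandedCoeff hω hξ,
      mul_add, expandedCoeff, Finset.sum_add_distrib]
  · ext q
    rw [← nsmul_eq_mul, map_nsmul, nsmul_eq_mul, formalIntegral, PowerSeries.coeff_mk]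
    -- Multiplication by `t` shifts the index by one, that is by two powers of `s`. The constant
    -- coefficient of the right side is zero, so the left one has to vanish separately.
    cases q with
    | zero => rw [PowerSeries.coeff_zero_X_mul, mul_zero, formalCoeff_loop_zero hω hξ hV]
    | succ q =>
      rw [PowerSeries.coeff_succ_X_mul, mul_add, mul_one, formalCoeff_loop hω hξ hV, formalIntegral,
        PowerSeries.coeff_mk]

end FormalLoop

/-! ### Invertibility of the partition function -/

section PartitionFunction

variable {d : ℕ} {n : Fin d → ℕ} {V : Polynomial ℂ} {ξ ω : Fin d → ℂ}
  (hω : ∀ i, 0 < (V.derivative.derivative.eval (ξ i) * ω i ^ 2).re)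

include hω in
-- The integral factors over the real coordinates into complex Gaussians `(π/b)^{1/2}` with `Re b >
-- 0`.
lemma integral_gaussianWeight_ne_zero : ∫ B : Coords n, gaussianWeight V ξ ω B ≠ 0 := by
  have h1 : ∀ B : Coords n, gaussianWeight V ξ ω B = ∏ i, ∏ a, ∏ b,
      Complex.exp (-((((∑ i, n i : ℕ) : ℂ) / 2 * (V.derivative.derivative.eval (ξ i) * ω i ^ 2)) *
        (if a = b then 1 else 2)) * (B i a b : ℂ) ^ 2) := fun B => by
    simp_rw [gaussianWeight_eq_exp, Complex.exp_sum]
  simp_rw [h1]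
  rw [integral_fintype_prod_volume_eq_prod (fun (i : Fin d) (B : Fin (n i) → Fin (n i) → ℝ) =>
    ∏ a, ∏ b, Complex.exp (-((((∑ i, n i : ℕ) : ℂ) / 2 *
      (V.derivative.derivative.eval (ξ i) * ω i ^ 2)) *
        (if a = b then 1 else 2)) * (B a b : ℂ) ^ 2))]
  refine Finset.prod_ne_zero_iff.2 fun i _ => ?_
  rw [integral_fintype_prod_volume_eq_prod (fun (a : Fin (n i)) (B : Fin (n i) → ℝ) =>
    ∏ b, Complex.exp (-((((∑ i, n i : ℕ) : ℂ) / 2 *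
      (V.derivative.derivative.eval (ξ i) * ω i ^ 2)) *
        (if a = b then 1 else 2)) * (B b : ℂ) ^ 2))]
  refine Finset.prod_ne_zero_iff.2 fun a _ => ?_
  rw [integral_fintype_prod_volume_eq_prod (fun (b : Fin (n i)) (x : ℝ) =>
    Complex.exp (-((((∑ i, n i : ℕ) : ℂ) / 2 *
      (V.derivative.derivative.eval (ξ i) * ω i ^ 2)) *
        (if a = b then 1 else 2)) * (x : ℂ) ^ 2))]
  refine Finset.prod_ne_zero_iff.2 fun b _ => ?_
  -- The existence of an index `a : Fin (n i)` forces `N > 0`, so each of these Gaussians does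
  -- decay.
  have hN : (0 : ℝ) < (∑ i, n i : ℕ) := Nat.cast_pos.2 (((Nat.zero_le _).trans_lt a.2).trans_le
    (Finset.single_le_sum (f := n) (fun _ _ => Nat.zero_le _) (Finset.mem_univ i)))
  have hre : 0 < ((((∑ i, n i : ℕ) : ℂ) / 2 * (V.derivative.derivative.eval (ξ i) * ω i ^ 2)) *
      (if a = b then 1 else 2)).re := by
    have : ((((∑ i, n i : ℕ) : ℂ) / 2 * (V.derivative.derivative.eval (ξ i) * ω i ^ 2)) *
        (if a = b then 1 else 2)) = (((((∑ i, n i : ℕ) : ℝ) / 2 * (if a = b then 1 else 2)) : ℝ) : ℂ)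
          * (V.derivative.derivative.eval (ξ i) * ω i ^ 2) := by
      split_ifs <;> push_cast <;> ring
    rw [this, Complex.re_ofReal_mul]
    refine mul_pos (mul_pos (half_pos hN) ?_) (hω i)
    split_ifs <;> norm_num
  rw [integral_gaussian_complex hre, Complex.cpow_ne_zero_iff]
  refine Or.inl (div_ne_zero (Complex.ofReal_ne_zero.2 Real.pi_ne_zero) fun h => ?_)
  rw [h] at hre
  simp at hre

/-- At scalar blocks each determinant is `(ξ_i - ξ_j)^{n_i n_j}`. The distinctness of the critical
points enters here. -/
lemma blockVandermonde_algebraMap_ne_zero (hξ : Function.Injective ξ) :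
    blockVandermonde (fun i => algebraMap ℂ (Matrix (Fin (n i)) (Fin (n i)) ℂ) (ξ i)) ≠ 0 := by
  refine Finset.prod_ne_zero_iff.2 fun i _ => Finset.prod_ne_zero_iff.2 fun j hj => pow_ne_zero _ ?_
  have h : algebraMap ℂ (Matrix (Fin (n i)) (Fin (n i)) ℂ) (ξ i) ⊗ₖ
      (1 : Matrix (Fin (n j)) (Fin (n j)) ℂ) - (1 : Matrix (Fin (n i)) (Fin (n i)) ℂ) ⊗ₖ
        algebraMap ℂ (Matrix (Fin (n j)) (Fin (n j)) ℂ) (ξ j) = (ξ i - ξ j) • 1 := by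
    rw [Algebra.algebraMap_eq_smul_one, Algebra.algebraMap_eq_smul_one, Matrix.smul_kronecker,
      Matrix.kronecker_smul, Matrix.one_kronecker_one, sub_smul]
  rw [h, Matrix.det_smul, Matrix.det_one, mul_one]
  exact pow_ne_zero _ (sub_ne_zero.2 fun h => (Finset.mem_Iio.1 hj).ne' (hξ h))

include hω in
-- In the constant coefficient only `k = 0` and `s = 0` remain: the Vandermonde at the critical
-- points times the Gaussian integral.
theorem isUnit_formalIntegral_one (hS : ∀ i, ξ i ∉ S) (hξ : Function.Injective ξ) :
    IsUnit (formalIntegral V ξ ω n (1 : Observable S)) := by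
  let φ : PowerSeries ℂ →ₐ[ℂ] ℂ :=
    { PowerSeries.constantCoeff (R := ℂ) with commutes' := fun c => by simp }
  have h0 : ∀ B : Coords n, PowerSeries.coeff 0 (formalIntegrand V ξ ω 0 (1 : Observable S) B) =
      blockVandermonde (fun i => algebraMap ℂ (Matrix (Fin (n i)) (Fin (n i)) ℂ) (ξ i)) := by
    intro B
    rw [formalIntegrand_eq V ω hS, formalExpr, pow_zero, one_mul, map_one, mul_one,
      PowerSeries.coeff_zero_eq_constantCoeff_apply]
    refine (map_blockVandermonde φ _).trans ?_
    congr 1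
    funext i
    exact map_constantCoeff_affineMatrix _ _
  rw [PowerSeries.isUnit_iff_constantCoeff, ← PowerSeries.coeff_zero_eq_constantCoeff_apply,
    formalIntegral, PowerSeries.coeff_mk, isUnit_iff_ne_zero, formalCoeff]
  simp only [mul_zero, zero_add, Finset.sum_range_one, pow_zero, Nat.factorial_zero, Nat.cast_one,
    div_one, one_mul, h0]
  rw [integral_const_mul]
  exact mul_ne_zero (blockVandermonde_algebraMap_ne_zero hξ) (integral_gaussianWeight_ne_zero hω)

end PartitionFunction

end MatrixModel

end

/-! ### Convergent and formal integrals together -/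

theorem mainTheorem6 {d N : ℕ} (V : Polynomial ℂ) (hV : V.natDegree = d + 1) :
    -- convergent integrals over normal matrices with eigenvalues on admissible paths
    (∀ (t : ℂ) (γ : Fin d → ℝ → ℂ), t ≠ 0 →
      (∀ i, MatrixModel.AdmissiblePath V ((N : ℂ) / t) (γ i)) →
      (∀ (c : Fin N → Fin d) (f : MatrixModel.Observable (⋃ i, Set.range (γ i))ᶜ),
        MeasureTheory.Integrable (MatrixModel.contourIntegrand V t γ c f)) ∧
      (∀ c : Fin N → Fin d,
        MatrixModel.fillingIntegral V t γ c
          (1 : MatrixModel.Observable (⋃ i, Set.range (γ i))ᶜ) ≠ 0 →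
        MatrixModel.LoopEquations (S := (⋃ i, Set.range (γ i))ᶜ) V N t
          (MatrixModel.mean (MatrixModel.fillingIntegral V t γ c))) ∧
      (∀ κ : Fin d → ℂ,
        MatrixModel.contourIntegral (N := N) V t γ κ
          (1 : MatrixModel.Observable (⋃ i, Set.range (γ i))ᶜ) ≠ 0 →
        MatrixModel.LoopEquations (S := (⋃ i, Set.range (γ i))ᶜ) V N t
          (MatrixModel.mean (MatrixModel.contourIntegral (N := N) V t γ κ)))) ∧
    -- convergent integrals over Hermitian matrices
    (∀ t : ℂ, t ≠ 0 →
      MatrixModel.AdmissiblePath V ((N : ℂ) / t) (fun u : ℝ => (u : ℂ)) →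
      (∀ f : MatrixModel.Observable (Set.range (fun u : ℝ => (u : ℂ)))ᶜ,
        MeasureTheory.Integrable (MatrixModel.hermitianIntegrand (N := N) V t f)) ∧
      (MatrixModel.hermitianIntegral N V t
          (1 : MatrixModel.Observable (Set.range (fun u : ℝ => (u : ℂ)))ᶜ) ≠ 0 →
        MatrixModel.LoopEquations (S := (Set.range (fun u : ℝ => (u : ℂ)))ᶜ) V N t
          (MatrixModel.mean (MatrixModel.hermitianIntegral N V t)))) ∧
    -- formal integrals
    (∀ (ξ ω : Fin d → ℂ) (n : Fin d → ℕ), Function.Injective ξ →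
      (∀ i, V.derivative.eval (ξ i) = 0) →
      (∀ i, 0 < (V.derivative.derivative.eval (ξ i) * ω i ^ 2).re) →
      ∑ i, n i = N →
      -- the coefficients are convergent Gaussian integrals
      (∀ (k p : ℕ) (f : MatrixModel.Observable (Set.range ξ)ᶜ),
        MeasureTheory.Integrable fun B : MatrixModel.Coords n =>
          PowerSeries.coeff p (MatrixModel.formalIntegrand V ξ ω k f B) *
            MatrixModel.gaussianWeight V ξ ω B) ∧
      -- only integer powers of `t` occur
      (∀ (p : ℕ) (f : MatrixModel.Observable (Set.range ξ)ᶜ), Odd p →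
        MatrixModel.formalCoeff V ξ ω n p f = 0) ∧
      -- the partition function can be divided by
      IsUnit (MatrixModel.formalIntegral V ξ ω n
        (1 : MatrixModel.Observable (Set.range ξ)ᶜ)) ∧
      -- the same loop equations
      MatrixModel.LoopEquations (S := (Set.range ξ)ᶜ) V N (PowerSeries.X : PowerSeries ℂ)
        (MatrixModel.mean (MatrixModel.formalIntegral V ξ ω n))) := by
  refine ⟨fun t γ ht hγ => ⟨fun c f => MatrixModel.integrable_contourIntegrand hγ c f,
    fun c _ => MatrixModel.loopEquations_fillingIntegral ht hγ c,
    fun κ _ => MatrixModel.loopEquations_contourIntegral ht hγ κ⟩, fun t ht h => ?_,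
    fun ξ ω n hinj hV' hω hn => ?_⟩
  · have hS : ∀ x ∈ (Set.range fun u : ℝ => (u : ℂ))ᶜ, x.im ≠ 0 := fun x hx h0 =>
      hx ⟨x.re, Complex.ext rfl h0.symm⟩
    exact ⟨fun f => MatrixModel.integrable_hermitianIntegrand hS h f,
      fun _ => MatrixModel.loopEquations_hermitianIntegral hS ht h⟩
  · subst hn
    have hξ : ∀ i, ξ i ∉ (Set.range ξ)ᶜ := fun i => Set.notMem_compl_iff.2 (Set.mem_range_self i)
    exact ⟨fun k p f => MatrixModel.integrable_formalIntegrand hω hξ k p f,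
      fun p f hp => MatrixModel.formalCoeff_of_odd hξ hp f,
      MatrixModel.isUnit_formalIntegral_one hω hξ hinj,
      MatrixModel.loopEquations_formalIntegral hω hξ hV'⟩
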